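/- Let $D\ge 0$, let $U\subseteq\mathbb R^{2D}$ be open (for instance $U=\mathbb R^{2D}$), with coordinates $X=(x^i,\tilde x_i)$, $\partial_i=\partial/\partial x^i$, $\tilde\partial^i=\partial/\partial\tilde x_i$, $\partial^M\partial_M=2\,\partial_i\tilde\partial^i$ (repeated indices are summed). Let $\mathcal E=(\mathcal E_{ij})$ be a smooth $D\times D$ matrix field and $d$ a smooth function on $U$, such that $g_{ij}=\tfrac12(\mathcal E_{ij}+\mathcal E_{ji})$ is invertible at every point of $U$ (any signature), with inverse $g^{ij}$; indices are raised and lowered with $g$. Assume the strong constraint: $\partial^M\partial_M A=0$ and $\partial^M\partial_M(AB)=0$ on $U$ for all $A,B$ among the components $\mathcal E_{ij}$, the field $d$, and their iterated partial derivatives. Put $$\mathcal D_i=\partial_i-\mathcal E_{ik}\tilde\partial^k,\qquad \bar{\mathcal D}_i=\partial_i+\mathcal E_{ki}\tilde\partial^k,$$ and let $S=\int dx\,d\tilde x\,L$ be the double field theory action with $$L=e^{-2d}\Big[-\tfrac14 g^{ik}g^{jl}\mathcal D^p\mathcal E_{kl}\mathcal D_p\mathcal E_{ij}+\tfrac14 g^{kl}\big(\mathcal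 D^j\mathcal E_{ik}\mathcal D^i\mathcal E_{jl}+\bar{\mathcal D}^j\mathcal E_{ki}\bar{\mathcal D}^i\mathcal E_{lj}\big)+\big(\mathcal D^id\,\bar{\mathcal D}^j\mathcal E_{ij}+\bar{\mathcal D}^id\,\mathcal D^j\mathcal E_{ji}\big)+4\,\mathcal D^id\,\mathcal D_id\Big].$$ Define $\mathcal K^{pq}$ and $\mathcal R$ by the first variation $\delta S=\int dx\,d\tilde x\,e^{-2d}\big(\delta\mathcal E_{pq}\mathcal K^{pq}-2\,\delta d\,\mathcal R\big)$, that is, through the Euler–Lagrange derivatives $$e^{-2d}\mathcal K^{pq}=\frac{\partial L}{\partial\mathcal E_{pq}}-\partial_M\frac{\partial L}{\partial(\partial_M\mathcal E_{pq})},\qquad -2e^{-2d}\mathcal R=\frac{\partial L}{\partial d}-\partial_M\frac{\partial L}{\partial(\partial_M d)},$$ and put $\mathcal K_{pq}=g_{pk}g_{ql}\mathcal K^{kl}$. The first index of $\mathcal K_{pq}$ is unbarred and the second is barred, and the covariant derivatives are $$\nabla_i\mathcal K_{pq}=\mathcal D_i\mathcal K_{pq}-\Gamma_{ip}^{k}\mathcal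 K_{kq}-\Gamma_{i\bar q}^{\bar k}\mathcal K_{pk},\qquad \bar\nabla_i\mathcal K_{pq}=\bar{\mathcal D}_i\mathcal K_{pq}-\Gamma_{\bar ip}^{k}\mathcal K_{kq}-\Gamma_{\bar i\bar q}^{\bar k}\mathcal K_{pk},$$ with $$\Gamma_{ij}^k=\tfrac12g^{kl}\mathcal D_i\mathcal E_{jl},\qquad \Gamma_{i\bar j}^{\bar k}=\tfrac12g^{kl}\big(\mathcal D_i\mathcal E_{lj}+\bar{\mathcal D}_j\mathcal E_{il}-\bar{\mathcal D}_l\mathcal E_{ij}\big),$$ $$\Gamma_{\bar i\bar j}^{\bar k}=\tfrac12g^{kl}\bar{\mathcal D}_i\mathcal E_{lj},\qquad \Gamma_{\bar ij}^{k}=\tfrac12g^{kl}\big(\bar{\mathcal D}_i\mathcal E_{jl}+\mathcal D_j\mathcal E_{li}-\mathcal D_l\mathcal E_{ji}\big).$$ Then the contracted Bianchi identities hold at every point of $U$: for all $q$, respectively all $p$, $$\Big[\nabla^p-\tfrac12g^{ps}\big(\bar{\mathcal D}^r\mathcal E_{sr}+4\mathcal D_sd\big)\Big]\mathcal K_{pq}+\tfrac12\bar{\mathcal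 D}_q\mathcal R=0,$$ $$\Big[\bar\nabla^q-\tfrac12g^{qs}\big(\mathcal D^r\mathcal E_{rs}+4\bar{\mathcal D}_sd\big)\Big]\mathcal K_{pq}+\tfrac12\mathcal D_p\mathcal R=0.$$ -/

import Mathlib

open scoped ContDiff

noncomputable section

namespace DFT

/-- Indices `M` of the doubled space: `inl i` labels `x^i`, `inr i` labels the dual
coordinate `x̃_i`. -/
abbrev DIdx (D : ℕ) := Fin D ⊕ Fin D

/-- The doubled space `ℝ^{2D}`, with points `X = (x, x̃)`. -/
abbrev DSpace (D : ℕ) := DIdx D → ℝ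

/-- The partial derivative `∂_M f`, i.e. `∂_i = ∂/∂x^i` for `M = inl i` and
`∂̃^i = ∂/∂x̃_i` for `M = inr i`. -/
def pd {D : ℕ} (M : DIdx D) (f : DSpace D → ℝ) (X : DSpace D) : ℝ :=
  fderiv ℝ f X (Pi.single M 1)

/-- The gradient `M ↦ ∂_M f`. -/
def grad {D : ℕ} (f : DSpace D → ℝ) (X : DSpace D) : DIdx D → ℝ := fun M => pd M f X

/-- The operator `∂^M ∂_M = 2 ∂_i ∂̃^i` of the constant `O(D,D)` metric. -/
def box {D : ℕ} (f : DSpace D → ℝ) (X : DSpace D) : ℝ :=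
  2 * ∑ i, pd (Sum.inl i) (pd (Sum.inr i) f) X

/-- The components of the fields `ℰ_{ij}` and `d`, together with all their iterated partial
derivatives. -/
inductive IsFieldQuantity {D : ℕ} (E : DSpace D → Matrix (Fin D) (Fin D) ℝ)
    (d : DSpace D → ℝ) : (DSpace D → ℝ) → Prop
  | metric (i j : Fin D) : IsFieldQuantity E d (fun X => E X i j)
  | dilaton : IsFieldQuantity E d d
  | deriv (M : DIdx D) (A : DSpace D → ℝ) :
      IsFieldQuantity E d A → IsFieldQuantity E d (pd M A)

/-- The strong constraint on `U`: `∂^M ∂_M` annihilates the fields (and their derivatives) and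
all their products. -/
def StrongConstraint {D : ℕ} (U : Set (DSpace D)) (E : DSpace D → Matrix (Fin D) (Fin D) ℝ)
    (d : DSpace D → ℝ) : Prop :=
  ∀ A B, IsFieldQuantity E d A → IsFieldQuantity E d B →
    ∀ X ∈ U, box A X = 0 ∧ box (fun Y => A Y * B Y) X = 0

/-! Pointwise algebra. Here `E` is the value of `ℰ` at a point, and `v` is a gradient. -/

/-- `g_{ij} = ½ (ℰ_{ij} + ℰ_{ji})`. -/
def gLow {D : ℕ} (E : Matrix (Fin D) (Fin D) ℝ) : Matrix (Fin D) (Fin D) ℝ :=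
  (1 / 2 : ℝ) • (E + E.transpose)

/-- `g^{ij}`, the inverse matrix of `g_{ij}`. -/
def gUp {D : ℕ} (E : Matrix (Fin D) (Fin D) ℝ) : Matrix (Fin D) (Fin D) ℝ := (gLow E)⁻¹

/-- `𝒟_i = ∂_i - ℰ_{ik} ∂̃^k`, applied to a quantity with gradient `v`. -/
def cD {D : ℕ} (E : Matrix (Fin D) (Fin D) ℝ) (v : DIdx D → ℝ) (i : Fin D) : ℝ :=
  v (Sum.inl i) - ∑ k, E i k * v (Sum.inr k)

/-- `𝒟̄_i = ∂_i + ℰ_{ki} ∂̃^k`, applied to a quantity with gradient `v`. -/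
def cDbar {D : ℕ} (E : Matrix (Fin D) (Fin D) ℝ) (v : DIdx D → ℝ) (i : Fin D) : ℝ :=
  v (Sum.inl i) + ∑ k, E k i * v (Sum.inr k)

/-- `𝒟^i = g^{ij} 𝒟_j`. -/
def cDUp {D : ℕ} (E : Matrix (Fin D) (Fin D) ℝ) (v : DIdx D → ℝ) (i : Fin D) : ℝ :=
  ∑ j, gUp E i j * cD E v j

/-- `𝒟̄^i = g^{ij} 𝒟̄_j`. -/
def cDbarUp {D : ℕ} (E : Matrix (Fin D) (Fin D) ℝ) (v : DIdx D → ℝ) (i : Fin D) : ℝ :=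
  ∑ j, gUp E i j * cDbar E v j

/-- The Lagrangian density of double field theory (including the factor `e^{-2d}`), as a function
of the values `E`, `d` of the fields and of their first derivatives `dE M i j = ∂_M ℰ_{ij}`,
`dd M = ∂_M d`. The action is its integral over the doubled space. -/
def lagrangian {D : ℕ} (E : Matrix (Fin D) (Fin D) ℝ) (d : ℝ)
    (dE : DIdx D → Matrix (Fin D) (Fin D) ℝ) (dd : DIdx D → ℝ) : ℝ :=
  Real.exp (-2 * d) *
    (-(1 / 4) * (∑ i, ∑ j, ∑ k, ∑ l, ∑ p, gUp E i k * gUp E j l *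
          cDUp E (fun M => dE M k l) p * cD E (fun M => dE M i j) p)
      + (1 / 4) * (∑ i, ∑ j, ∑ k, ∑ l, gUp E k l *
          (cDUp E (fun M => dE M i k) j * cDUp E (fun M => dE M j l) i
            + cDbarUp E (fun M => dE M k i) j * cDbarUp E (fun M => dE M l j) i))
      + (∑ i, ∑ j, (cDUp E dd i * cDbarUp E (fun M => dE M i j) j
            + cDbarUp E dd i * cDUp E (fun M => dE M j i) j))
      + 4 * ∑ i, cDUp E dd i * cD E dd i)

/-! Objects built from the fields `ℰ`, `d` on the doubled space. -/

section Fields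

variable {D : ℕ} (E : DSpace D → Matrix (Fin D) (Fin D) ℝ) (d : DSpace D → ℝ)

/-- `∂_M ℰ_{ij}` at `X`. -/
def gradE (X : DSpace D) (M : DIdx D) : Matrix (Fin D) (Fin D) ℝ :=
  Matrix.of fun i j => pd M (fun Y => E Y i j) X

/-- The variational (Euler-Lagrange) derivative `δS/δℰ_{pq}`, that is
`∂L/∂ℰ_{pq} - ∂_M (∂L/∂(∂_M ℰ_{pq}))`. -/
def varE (p q : Fin D) (X : DSpace D) : ℝ :=
  deriv (fun t : ℝ => lagrangian (E X + t • Matrix.single p q 1) (d X) (gradE E X) (grad d X)) 0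
  - ∑ M, pd M (fun Y => deriv (fun t : ℝ => lagrangian (E Y) (d Y)
        (gradE E Y + t • (Pi.single M (Matrix.single p q 1) :
          DIdx D → Matrix (Fin D) (Fin D) ℝ)) (grad d Y)) 0) X

/-- The variational (Euler-Lagrange) derivative `δS/δd`, that is
`∂L/∂d - ∂_M (∂L/∂(∂_M d))`. -/
def varD (X : DSpace D) : ℝ :=
  deriv (fun t : ℝ => lagrangian (E X) (d X + t) (gradE E X) (grad d X)) 0
  - ∑ M, pd M (fun Y => deriv (fun t : ℝ => lagrangian (E Y) (d Y)
        (gradE E Y) (grad d Y + t • Pi.single M 1)) 0) X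

/-- `𝒦^{pq}`, defined by `δ_ℰ S = ∫ e^{-2d} δℰ_{pq} 𝒦^{pq}`. -/
def KUp (p q : Fin D) (X : DSpace D) : ℝ := Real.exp (2 * d X) * varE E d p q X

/-- `𝒦_{pq} = g_{pk} g_{ql} 𝒦^{kl}`. -/
def K (p q : Fin D) (X : DSpace D) : ℝ :=
  ∑ k, ∑ l, gLow (E X) p k * gLow (E X) q l * KUp E d k l X

/-- `𝓡`, defined by `δ_d S = ∫ e^{-2d} (-2 δd) 𝓡`. -/
def Rscal (X : DSpace D) : ℝ := -(1 / 2) * (Real.exp (2 * d X) * varD E d X)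

/-- `𝒟_i f`. -/
def Dop (i : Fin D) (f : DSpace D → ℝ) (X : DSpace D) : ℝ := cD (E X) (grad f X) i

/-- `𝒟̄_i f`. -/
def Dbar (i : Fin D) (f : DSpace D → ℝ) (X : DSpace D) : ℝ := cDbar (E X) (grad f X) i

/-- `𝒟_i ℰ_{jk}`. -/
def DE (i j k : Fin D) (X : DSpace D) : ℝ := Dop E i (fun Y => E Y j k) X

/-- `𝒟̄_i ℰ_{jk}`. -/
def DbarE (i j k : Fin D) (X : DSpace D) : ℝ := Dbar E i (fun Y => E Y j k) X

/-- `Γ_{ij}^k` (all indices unbarred). -/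
def Gam (k i j : Fin D) (X : DSpace D) : ℝ :=
  (1 / 2) * ∑ l, gUp (E X) k l * DE E i j l X

/-- `Γ_{i j̄}^{k̄}` (`i` unbarred; `j`, `k` barred). -/
def GamUB (k i j : Fin D) (X : DSpace D) : ℝ :=
  (1 / 2) * ∑ l, gUp (E X) k l * (DE E i l j X + DbarE E j i l X - DbarE E l i j X)

/-- `Γ_{ī j}^k` (`i` barred; `j`, `k` unbarred). -/
def GamBU (k i j : Fin D) (X : DSpace D) : ℝ :=
  (1 / 2) * ∑ l, gUp (E X) k l * (DbarE E i j l X + DE E j l i X - DE E l j i X)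

/-- `Γ_{ī j̄}^{k̄}` (all indices barred). -/
def GamBB (k i j : Fin D) (X : DSpace D) : ℝ :=
  (1 / 2) * ∑ l, gUp (E X) k l * DbarE E i l j X

/-- `∇_i T_{pq}` for a tensor whose first index is unbarred and whose second index is barred. -/
def nabla (i : Fin D) (T : Fin D → Fin D → DSpace D → ℝ) (p q : Fin D) (X : DSpace D) : ℝ :=
  Dop E i (T p q) X - ∑ k, Gam E k i p X * T k q X - ∑ k, GamUB E k i q X * T p k X

/-- `∇̄_i T_{pq}` for a tensor whose first index is unbarred and whose second index is barred. -/
def nablaBar (i : Fin D) (T : Fin D → Fin D → DSpace D → ℝ) (p q : Fin D) (X : DSpace D) : ℝ :=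
  Dbar E i (T p q) X - ∑ k, GamBU E k i p X * T k q X - ∑ k, GamBB E k i q X * T p k X

end Fields

end DFT

end

/-!
The identities are the Noether identities of the gauge symmetry of the action, but the proof below
is a direct verification in three steps.

* Every quantity in sight is a linear combination, with integer coefficients, of complete or
  partial contractions of `g^{ij}` with the frame derivatives `𝒟 ⋯ 𝒟̄ ⋯` of `ℰ` and `d`. Here an
  iterated frame derivative means the array of iterated partial derivatives `∂_M ∂_N ⋯` contracted
  with the vector fields `𝒟_i = e_i^M ∂_M`, `𝒟̄_i = ē_i^M ∂_M`, which are not differentiated; it is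
  thus symmetric in its slots. Such contractions are represented by a syntax (`Fac`, `Mono`,
  `Poly`), with values (`evalP`) in a context (`Ctx`) that holds the fields and their jets at a
  point. Differentiation acts on the syntax (`derP`): the derivative of `g^{ij}` and that of the
  frames are again of the same kind, because
  `∂̃^k = ½ g^{kl} (𝒟̄_l - 𝒟_l)`. This is `derP_hasDir` with `derRule_metric` and `derRule_jet`.

* The strong constraint says precisely that `∂^M A ∂_M B = 0` and `∂^M ∂_M A = 0` for all jets.
  As `g^{ij} (ē_i^M ē_j^N - e_i^M e_j^N) = 2 η^{MN}` (`frame_completeness`), it amounts to the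
  following rewriting rule: a contraction of two barred derivatives may be replaced by a contraction
  of two unbarred ones. After this rule has been applied, two contractions are equal as soon as they
  agree up to the symmetries of `g`, the symmetry of the jets, and renaming of dummy indices. The
  function `isZero` brings an expression to such a normal form, and `evalP_eq_zero` is its
  soundness: no completeness is needed.

* The Euler-Lagrange derivatives of the Lagrangian are computed from the syntax
  (`FieldHyp.divergence`, `FieldHyp.varD_eq`, `FieldHyp.varE_eq`) and are found, by normalization,
  to be the explicit expressions `scalarPoly` for `𝓡` and `ricciPoly` for `𝒦_{pq}`
  (`FieldHyp.Rscal_eq`, `FieldHyp.K_eq`). The left-hand sides of the Bianchi identities are then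
  expressions in the same syntax (`bianchiPoly`), and `isZero_bianchi` says that they normalize to
  zero.
-/

noncomputable section

namespace DFT

variable {D : ℕ}

/-! ### Contracted tensor expressions and their values -/

/-- An elementary factor of a tensor monomial; indices are named by natural numbers.
* `g i j` is `g^{ij}`;
* `T (some (i, j)) l` is half the jet of `ℰ_{ij}`, and `T none l` the jet of `d`, with one frame
  derivative for each slot `(b, a)` of `l`: `𝒟_a` for `b = false` and `𝒟̄_a` for `b = true`. The
  factor `½` keeps all coefficients integral;
* `X i j` is a parameter with two indices, which stands for half the variation of `ℰ_{ij}`;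
* `Y b i` is the contraction of a parameter `v_M` with the frame, `e_i^M v_M` or `ē_i^M v_M`. -/
inductive Fac
  | g (i j : ℕ)
  | T (c : Option (ℕ × ℕ)) (l : List (Bool × ℕ))
  | X (i j : ℕ)
  | Y (b : Bool) (i : ℕ)
  deriving DecidableEq

/-- A tensor monomial: the list of its dummy (summed) indices, and the list of its factors. -/
abbrev Mono := List ℕ × List Fac

/-- An integral linear combination of tensor monomials. -/
abbrev Poly := List (ℤ × Mono)

/-- The data at a point that give a value to every factor: the value `E` of `ℰ`, the iterated
partial derivatives `J` of `ℰ_{ij}/2` and of `d`, and the two parameters `X`, `v`. -/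
structure Ctx (D : ℕ) where
  E : Matrix (Fin D) (Fin D) ℝ
  J : Option (Fin D × Fin D) → List (DIdx D) → ℝ
  X : Fin D → Fin D → ℝ
  v : DIdx D → ℝ

/-- The components `e_i^M` (for `b = false`) and `ē_i^M` (for `b = true`) of the vector fields
`𝒟_i = e_i^M ∂_M` and `𝒟̄_i = ē_i^M ∂_M`. -/
def frame (E : Matrix (Fin D) (Fin D) ℝ) (b : Bool) (i : Fin D) : DIdx D → ℝ :=
  Sum.elim (fun k => if i = k then 1 else 0) (fun k => if b then E k i else -E i k)

/-- The contraction of an array `J_{MN⋯}` with frame vectors, one for each slot. -/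
def proj (E : Matrix (Fin D) (Fin D) ℝ) :
    List (Bool × Fin D) → (List (DIdx D) → ℝ) → ℝ
  | [], J => J []
  | s :: l, J => ∑ M, frame E s.1 s.2 M * proj E l (fun Ms => J (M :: Ms))

/-- The value of a factor, when `x` assigns values to the index names. -/
def val (C : Ctx D) (x : ℕ → Fin D) : Fac → ℝ
  | .g i j => gUp C.E (x i) (x j)
  | .T c l => proj C.E (l.map (Prod.map id x)) (C.J (c.map (Prod.map x x)))
  | .X i j => C.X (x i) (x j)
  | .Y b i => ∑ M, frame C.E b (x i) M * C.v M

/-- The value of the monomial with dummy indices `bs` and factors `fs`. -/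
def evalM (C : Ctx D) : List ℕ → List Fac → (ℕ → Fin D) → ℝ
  | [], fs, x => (fs.map (val C x)).prod
  | b :: bs, fs, x => ∑ i, evalM C bs fs (Function.update x b i)

/-- The value of a linear combination of monomials. -/
def evalP (C : Ctx D) (e : Poly) (x : ℕ → Fin D) : ℝ :=
  (e.map fun t => (t.1 : ℝ) * evalM C t.2.1 t.2.2 x).sum

namespace Fac

/-- The index names in a factor. -/
def vars : Fac → List ℕ
  | g i j => [i, j]
  | T c l => (match c with | none => [] | some (i, j) => [i, j]) ++ l.map Prod.snd
  | X i j => [i, j]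
  | Y _ i => [i]

/-- Renaming of the indices of a factor. -/
def rename (r : ℕ → ℕ) : Fac → Fac
  | g i j => g (r i) (r j)
  | T c l => T (c.map (Prod.map r r)) (l.map (Prod.map id r))
  | X i j => X (r i) (r j)
  | Y b i => Y b (r i)

end Fac

/-- The index names in a list of factors. -/
def varsL (fs : List Fac) : List ℕ := fs.flatMap Fac.vars

theorem val_rename (C : Ctx D) (r : ℕ → ℕ) (x : ℕ → Fin D) (f : Fac) :
    val C x (f.rename r) = val C (x ∘ r) f := by
  cases f with
  | T c l =>
    have hl : (l.map (Prod.map id r)).map (Prod.map id x) = l.map (Prod.map id (x ∘ r)) := by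
      simp
    cases c <;> simp only [val, Fac.rename, hl, Option.map_none, Option.map_some,
      Prod.map_map]
  | _ => simp [val, Fac.rename]

theorem map_congr_of_vars {x y : ℕ → Fin D} {c : Option (ℕ × ℕ)}
    {l : List (Bool × ℕ)} (h : ∀ u ∈ (Fac.T c l).vars, x u = y u) :
    l.map (Prod.map id x) = l.map (Prod.map id y) ∧
      c.map (Prod.map x x) = c.map (Prod.map y y) := by
  constructor
  · apply List.map_congr_left
    intro s hs
    have := h s.2 (by
      simp only [Fac.vars, List.mem_append, List.mem_map]
      exact Or.inr ⟨s, hs, rfl⟩)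
    ext <;> simp [this]
  · rcases c with _ | ⟨i, j⟩
    · rfl
    · have hi := h i (by simp [Fac.vars])
      have hj := h j (by simp [Fac.vars])
      simp [hi, hj]

theorem val_congr (C : Ctx D) {x y : ℕ → Fin D} {f : Fac} (h : ∀ u ∈ f.vars, x u = y u) :
    val C x f = val C y f := by
  cases f with
  | T c l => simp only [val, (map_congr_of_vars h).1, (map_congr_of_vars h).2]
  | g i j => simp [val, h i (by simp [Fac.vars]), h j (by simp [Fac.vars])]
  | X i j => simp [val, h i (by simp [Fac.vars]), h j (by simp [Fac.vars])]
  | Y b i => simp [val, h i (by simp [Fac.vars])]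

theorem prod_val_congr (C : Ctx D) {x y : ℕ → Fin D} {fs : List Fac}
    (h : ∀ u ∈ varsL fs, x u = y u) :
    (fs.map (val C x)).prod = (fs.map (val C y)).prod := by
  congr 1
  apply List.map_congr_left
  intro f hf
  exact val_congr C fun u hu => h u (List.mem_flatMap.2 ⟨f, hf, hu⟩)

theorem evalM_congr (C : Ctx D) {bs : List ℕ} {fs : List Fac} {x y : ℕ → Fin D}
    (h : ∀ u ∈ varsL fs, u ∉ bs → x u = y u) : evalM C bs fs x = evalM C bs fs y := by
  induction bs generalizing x y with
  | nil => exact prod_val_congr C fun u hu => h u hu (by simp)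
  | cons b bs ih =>
    refine Finset.sum_congr rfl fun i _ => ih fun u hu hb => ?_
    by_cases hub : u = b
    · simp [hub]
    · simp only [Function.update_of_ne hub]
      exact h u hu (by simp [hub, hb])

theorem evalM_perm_fs (C : Ctx D) {fs fs' : List Fac} (h : fs.Perm fs') (bs : List ℕ)
    (x : ℕ → Fin D) : evalM C bs fs x = evalM C bs fs' x := by
  induction bs generalizing x with
  | nil => exact (h.map _).prod_eq
  | cons b bs ih => exact Finset.sum_congr rfl fun i _ => ih _

theorem evalM_perm_bs (C : Ctx D) {bs bs' : List ℕ} (h : bs.Perm bs') (fs : List Fac)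
    (x : ℕ → Fin D) : evalM C bs fs x = evalM C bs' fs x := by
  induction h generalizing x with
  | nil => rfl
  | cons b _ ih => exact Finset.sum_congr rfl fun i _ => ih _
  | swap a b l =>
    by_cases hab : a = b
    · rw [hab]
    · simp only [evalM]
      rw [Finset.sum_comm]
      refine Finset.sum_congr rfl fun i _ => Finset.sum_congr rfl fun j _ => ?_
      rw [Function.update_comm hab]
  | trans _ _ ih1 ih2 => rw [ih1, ih2]

theorem evalM_append_congr (C : Ctx D) {bs' : List ℕ} {fs fs' : List Fac}
    (h : ∀ x, evalM C bs' fs x = evalM C bs' fs' x) (bs : List ℕ) (x : ℕ → Fin D) :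
    evalM C (bs ++ bs') fs x = evalM C (bs ++ bs') fs' x := by
  induction bs generalizing x with
  | nil => exact h x
  | cons b bs ih => exact Finset.sum_congr rfl fun i _ => ih _

theorem evalM_rename_of_injOn (C : Ctx D) {r : ℕ → ℕ} {bs : List ℕ} {fs : List Fac}
    (hr : ∀ u ∈ bs ++ varsL fs, ∀ v ∈ bs ++ varsL fs, r u = r v → u = v) (x : ℕ → Fin D) :
    evalM C (bs.map r) (fs.map (Fac.rename r)) x = evalM C bs fs (x ∘ r) := by
  induction bs generalizing x with
  | nil =>
    simp only [List.map_nil, evalM, List.map_map]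
    congr 1
    exact List.map_congr_left fun f _ => val_rename C r x f
  | cons b bs ih =>
    refine Finset.sum_congr rfl fun i _ => ?_
    rw [ih fun u hu v hv => hr u (by simp_all) v (by simp_all)]
    refine evalM_congr C fun u hu _ => ?_
    by_cases hub : u = b
    · simp [hub]
    · have : r u ≠ r b := fun h => hub (hr u (by simp [hu]) b (by simp) h)
      simp [Function.update_of_ne hub, Function.update_of_ne this]

theorem evalM_nil_append (C : Ctx D) (fs fs' : List Fac) (x : ℕ → Fin D) :
    evalM C [] (fs ++ fs') x = evalM C [] fs x * evalM C [] fs' x := by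
  simp [evalM]

theorem evalM_append_fs (C : Ctx D) (bs : List ℕ) (fs fs' : List Fac) (x : ℕ → Fin D)
    (h : ∀ b ∈ bs, b ∉ varsL fs') :
    evalM C bs (fs ++ fs') x = evalM C bs fs x * evalM C [] fs' x := by
  induction bs generalizing x with
  | nil => exact evalM_nil_append C fs fs' x
  | cons b bs ih =>
    simp only [evalM, Finset.sum_mul]
    refine Finset.sum_congr rfl fun i _ => ?_
    rw [ih _ (fun b hb => h b (by simp [hb]))]
    congr 1
    refine prod_val_congr C fun u hu => Function.update_of_ne ?_ _ _
    rintro rfl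
    exact h _ (by simp) hu

theorem evalM_mul (C : Ctx D) (bs bs' : List ℕ) (fs fs' : List Fac) (x : ℕ → Fin D)
    (h : ∀ b ∈ bs, b ∉ varsL fs') (h' : ∀ b ∈ bs', b ∉ varsL fs) :
    evalM C (bs ++ bs') (fs ++ fs') x = evalM C bs fs x * evalM C bs' fs' x := by
  induction bs generalizing x with
  | nil =>
    rw [List.nil_append, evalM_perm_fs C List.perm_append_comm, evalM_append_fs C _ _ _ _ h',
      mul_comm]
  | cons b bs ih =>
    simp only [List.cons_append, evalM, Finset.sum_mul]
    refine Finset.sum_congr rfl fun i _ => ?_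
    rw [ih _ (fun b hb => h b (by simp [hb]))]
    congr 1
    refine evalM_congr C fun u hu _ => Function.update_of_ne ?_ _ _
    rintro rfl
    exact h _ (by simp) hu

@[simp] theorem evalP_nil (C : Ctx D) (x : ℕ → Fin D) : evalP C [] x = 0 := rfl

@[simp] theorem evalP_cons (C : Ctx D) (t : ℤ × Mono) (e : Poly) (x : ℕ → Fin D) :
    evalP C (t :: e) x = t.1 * evalM C t.2.1 t.2.2 x + evalP C e x := rfl

@[simp] theorem evalP_append (C : Ctx D) (e e' : Poly) (x : ℕ → Fin D) :
    evalP C (e ++ e') x = evalP C e x + evalP C e' x := by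
  simp [evalP]

namespace Poly

/-- Multiplication by an integer. -/
def scale (n : ℤ) (e : Poly) : Poly := e.map fun t => (n * t.1, t.2)

/-- Summation over the index `b`. -/
def bind (b : ℕ) (e : Poly) : Poly := e.map fun t => (t.1, (b :: t.2.1, t.2.2))

/-- The product; it is correct only for `Compat` factors. -/
def mul (e e' : Poly) : Poly :=
  e.flatMap fun t => e'.map fun t' => (t.1 * t'.1, (t.2.1 ++ t'.2.1, t.2.2 ++ t'.2.2))

/-- Renaming of all indices, dummy ones included. -/
def rename (r : ℕ → ℕ) (e : Poly) : Poly :=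
  e.map fun t => (t.1, (t.2.1.map r, t.2.2.map (Fac.rename r)))

/-- No dummy index of one expression occurs in the other. -/
def Compat (e e' : Poly) : Prop :=
  ∀ t ∈ e, ∀ t' ∈ e', (∀ b ∈ t.2.1, b ∉ varsL t'.2.2) ∧ (∀ b ∈ t'.2.1, b ∉ varsL t.2.2)

instance (e e' : Poly) : Decidable (Compat e e') := by unfold Compat; infer_instance

end Poly

theorem evalP_scale (C : Ctx D) (n : ℤ) (e : Poly) (x : ℕ → Fin D) :
    evalP C (e.scale n) x = n * evalP C e x := by
  induction e with
  | nil => simp [Poly.scale]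
  | cons t e ih =>
    have : Poly.scale n (t :: e) = (n * t.1, t.2) :: Poly.scale n e := rfl
    rw [this, evalP_cons, ih, evalP_cons]; push_cast; ring

theorem evalP_bind (C : Ctx D) (b : ℕ) (e : Poly) (x : ℕ → Fin D) :
    evalP C (e.bind b) x = ∑ i, evalP C e (Function.update x b i) := by
  induction e with
  | nil => simp [Poly.bind]
  | cons t e ih =>
    have : Poly.bind b (t :: e) = (t.1, (b :: t.2.1, t.2.2)) :: Poly.bind b e := rfl
    rw [this, evalP_cons, ih]
    simp only [evalM, evalP_cons, Finset.sum_add_distrib, Finset.mul_sum]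

theorem evalP_mul (C : Ctx D) (e e' : Poly) (h : e.Compat e') (x : ℕ → Fin D) :
    evalP C (e.mul e') x = evalP C e x * evalP C e' x := by
  induction e with
  | nil => simp [Poly.mul]
  | cons t e ih =>
    have : Poly.mul (t :: e) e' = (e'.map fun t' => (t.1 * t'.1, (t.2.1 ++ t'.2.1,
      t.2.2 ++ t'.2.2))) ++ Poly.mul e e' := rfl
    rw [this, evalP_append, ih (fun s hs => h s (by simp [hs])), evalP_cons, add_mul]
    congr 1
    have ht := h t (by simp)
    clear this ih h
    induction e' with
    | nil => simp
    | cons t' e' ih' =>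
      simp only [List.map_cons, evalP_cons]
      rw [ih' fun s hs => ht s (by simp [hs]),
        evalM_mul C _ _ _ _ _ (ht t' (by simp)).1 (ht t' (by simp)).2]
      push_cast; ring

theorem evalP_rename (C : Ctx D) {r : ℕ → ℕ} (hr : Function.Injective r) (e : Poly)
    (x : ℕ → Fin D) : evalP C (e.rename r) x = evalP C e (x ∘ r) := by
  induction e with
  | nil => simp [Poly.rename]
  | cons t e ih =>
    have : Poly.rename r (t :: e) =
      (t.1, (t.2.1.map r, t.2.2.map (Fac.rename r))) :: Poly.rename r e := rfl
    rw [this, evalP_cons, ih, evalM_rename_of_injOn C fun _ _ _ _ h => hr h, evalP_cons]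

/-! ### Leibniz rule for tensor expressions -/

section Leibniz

variable {P : Type*} [NormedAddCommGroup P] [NormedSpace ℝ P]

/-- `F` is differentiable at `p` with derivative `c` in the direction `u`. -/
def HasDir (F : P → ℝ) (p u : P) (c : ℝ) : Prop := DifferentiableAt ℝ F p ∧ fderiv ℝ F p u = c

theorem HasDir.add {F G : P → ℝ} {p u : P} {a b : ℝ} (hF : HasDir F p u a) (hG : HasDir G p u b) :
    HasDir (fun y => F y + G y) p u (a + b) :=
  ⟨hF.1.add hG.1, by rw [fderiv_fun_add hF.1 hG.1]; simp [hF.2, hG.2]⟩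

theorem HasDir.mul {F G : P → ℝ} {p u : P} {a b : ℝ} (hF : HasDir F p u a) (hG : HasDir G p u b) :
    HasDir (fun y => F y * G y) p u (a * G p + F p * b) :=
  ⟨hF.1.mul hG.1, by rw [fderiv_fun_mul hF.1 hG.1]; simp [hF.2, hG.2]; ring⟩

theorem HasDir.const (c : ℝ) (p u : P) : HasDir (fun _ : P => c) p u 0 :=
  ⟨differentiableAt_const c, by simp⟩

theorem HasDir.const_mul (c : ℝ) {F : P → ℝ} {p u : P} {a : ℝ} (hF : HasDir F p u a) :
    HasDir (fun y => c * F y) p u (c * a) := by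
  simpa using (HasDir.const c p u).mul hF

theorem HasDir.sum {ι : Type*} {s : Finset ι} {F : ι → P → ℝ} {p u : P} {a : ι → ℝ}
    (h : ∀ i ∈ s, HasDir (F i) p u (a i)) :
    HasDir (fun y => ∑ i ∈ s, F i y) p u (∑ i ∈ s, a i) :=
  ⟨DifferentiableAt.fun_sum fun i hi => (h i hi).1, by
    rw [fderiv_fun_sum fun i hi => (h i hi).1]
    simp only [FunLike.coe_sum, Finset.sum_apply]
    exact Finset.sum_congr rfl fun i hi => (h i hi).2⟩

theorem HasDir.congr_val {F : P → ℝ} {p u : P} {a b : ℝ} (h : HasDir F p u a) (hab : a = b) :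
    HasDir F p u b := hab ▸ h

/-- Leibniz rule for a product of factors. Here `δ k f` is the derivative of the factor `f`,
written with dummy indices `≥ k`. -/
def derList (δ : ℕ → Fac → Poly) (k : ℕ) : List Fac → Poly
  | [] => []
  | f :: fs => ((δ k f).map fun t => (t.1, (t.2.1, t.2.2 ++ fs))) ++
      (derList δ k fs).map fun t => (t.1, (t.2.1, f :: t.2.2))

/-- A name beyond all names in the monomial `m` and beyond `a`. -/
def fresh (a : ℕ) (m : Mono) : ℕ := (a :: (m.1 ++ varsL m.2)).foldr max 0 + 1

/-- The derivative of an expression, in a direction that may depend on the index named `a`, when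
`δ` is the derivative of factors. -/
def derP (δ : ℕ → Fac → Poly) (a : ℕ) (e : Poly) : Poly :=
  e.flatMap fun t => (derList δ (fresh a t.2) t.2.2).map fun t' =>
    (t.1 * t'.1, (t.2.1 ++ t'.2.1, t'.2.2))

theorem le_foldr_max {l : List ℕ} {u : ℕ} (h : u ∈ l) : u ≤ l.foldr max 0 := by
  induction l with
  | nil => simp at h
  | cons b l ih =>
    rcases List.mem_cons.1 h with rfl | h
    · simp
    · exact (ih h).trans (by simp)

/-- `δ` computes the derivative of the factor `f` along the family of contexts `C`, at `p` in the
direction `u`, as long as the index `a` has the value `i₀`. -/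
structure DerRule (C : P → Ctx D) (p u : P) (a : ℕ) (i₀ : Fin D) (δ : ℕ → Fac → Poly)
    (f : Fac) : Prop where
  hasDir : ∀ k, (∀ v ∈ f.vars, v < k) → a < k → ∀ x : ℕ → Fin D, x a = i₀ →
    HasDir (fun y => val (C y) x f) p u (evalP (C p) (δ k f) x)
  le_bound : ∀ k, ∀ t ∈ δ k f, ∀ b ∈ t.2.1, k ≤ b

variable {C : P → Ctx D} {p u : P} {a : ℕ} {i₀ : Fin D} {δ : ℕ → Fac → Poly}

theorem derList_bound {fs : List Fac} (h : ∀ f ∈ fs, DerRule C p u a i₀ δ f) {k : ℕ} :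
    ∀ t ∈ derList δ k fs, ∀ b ∈ t.2.1, k ≤ b := by
  induction fs with
  | nil => simp [derList]
  | cons f fs ih =>
    intro t ht b hb
    rcases List.mem_append.1 ht with ht | ht
    · obtain ⟨s, hs, rfl⟩ := List.mem_map.1 ht
      exact (h f (by simp)).le_bound k s hs b hb
    · obtain ⟨s, hs, rfl⟩ := List.mem_map.1 ht
      exact ih (fun f hf => h f (by simp [hf])) s hs b hb

theorem evalP_map_append (C : Ctx D) (e : Poly) (fs : List Fac) (x : ℕ → Fin D)
    (h : ∀ t ∈ e, ∀ b ∈ t.2.1, b ∉ varsL fs) :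
    evalP C (e.map fun t => (t.1, (t.2.1, t.2.2 ++ fs))) x
      = evalP C e x * evalM C [] fs x := by
  induction e with
  | nil => simp
  | cons t e ih =>
    simp only [List.map_cons, evalP_cons]
    rw [ih fun t ht => h t (by simp [ht]), evalM_append_fs C _ _ _ _ (h t (by simp))]
    ring

theorem evalP_map_cons (C : Ctx D) (e : Poly) (f : Fac) (x : ℕ → Fin D)
    (h : ∀ t ∈ e, ∀ b ∈ t.2.1, b ∉ f.vars) :
    evalP C (e.map fun t => (t.1, (t.2.1, f :: t.2.2))) x
      = val C x f * evalP C e x := by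
  induction e with
  | nil => simp
  | cons t e ih =>
    simp only [List.map_cons, evalP_cons]
    rw [ih fun t ht => h t (by simp [ht]),
      evalM_perm_fs C (List.perm_append_singleton f t.2.2).symm,
      evalM_append_fs C _ _ _ _ (by simpa [varsL] using h t (by simp))]
    simp [evalM]
    ring

theorem derList_hasDir {fs : List Fac} (h : ∀ f ∈ fs, DerRule C p u a i₀ δ f) {k : ℕ}
    (hk : ∀ v ∈ varsL fs, v < k) (ha : a < k) (x : ℕ → Fin D) (hx : x a = i₀) :
    HasDir (fun y => evalM (C y) [] fs x) p u (evalP (C p) (derList δ k fs) x) := by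
  induction fs with
  | nil => simpa [evalM, derList] using HasDir.const (1 : ℝ) p u
  | cons f fs ih =>
    have hf := h f (by simp)
    have hfs : ∀ f ∈ fs, DerRule C p u a i₀ δ f := fun f hf => h f (by simp [hf])
    have hkf : ∀ v ∈ f.vars, v < k := fun v hv => hk v (by simp [varsL, hv])
    have hkfs : ∀ v ∈ varsL fs, v < k := fun v hv => hk v (by
      simp only [varsL, List.flatMap_cons, List.mem_append]; exact Or.inr hv)
    have := (hf.hasDir k hkf ha x hx).mul (ih hfs hkfs)
    refine HasDir.congr_val (by simpa [evalM] using this) ?_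
    rw [derList, evalP_append, evalP_map_append, evalP_map_cons]
    · simp [evalM]
    · intro t ht b hb hb'
      exact absurd (derList_bound hfs t ht b hb) (not_le.2 (hkf b hb'))
    · intro t ht b hb hb'
      exact absurd (hf.le_bound k t ht b hb) (not_le.2 (hkfs b hb'))

theorem evalP_map_bind_list (C : Ctx D) (bs : List ℕ) (b : ℕ) (c : ℤ) (e : Poly)
    (x : ℕ → Fin D) :
    evalP C (e.map fun t => (c * t.1, (b :: bs ++ t.2.1, t.2.2))) x
      = ∑ i, evalP C (e.map fun t => (c * t.1, (bs ++ t.2.1, t.2.2))) (Function.update x b i) := by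
  rw [← evalP_bind]
  congr 1
  simp [Poly.bind]

/-- Leibniz rule under the summation over dummy indices. -/
theorem derM_hasDir {bs : List ℕ} {fs : List Fac} (c : ℤ)
    (h : ∀ f ∈ fs, DerRule C p u a i₀ δ f) {k : ℕ}
    (hk : ∀ v ∈ varsL fs, v < k) (ha : a < k) (hab : a ∉ bs) (x : ℕ → Fin D) (hx : x a = i₀) :
    HasDir (fun y => c * evalM (C y) bs fs x) p u (evalP (C p)
      ((derList δ k fs).map fun t => (c * t.1, (bs ++ t.2.1, t.2.2))) x) := by
  induction bs generalizing x with
  | nil =>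
    have := (derList_hasDir h hk ha x hx).const_mul (c : ℝ)
    refine this.congr_val ?_
    rw [← evalP_scale]
    rfl
  | cons b bs ih =>
    rw [evalP_map_bind_list]
    simp only [evalM, Finset.mul_sum]
    refine HasDir.sum fun i _ => ih (fun h => hab (by simp [h])) _ ?_
    rw [Function.update_of_ne, hx]
    rintro rfl
    exact hab (by simp)

theorem derP_hasDir {e : Poly} (h : ∀ t ∈ e, ∀ f ∈ t.2.2, DerRule C p u a i₀ δ f)
    (ha : ∀ t ∈ e, a ∉ t.2.1) (x : ℕ → Fin D) (hx : x a = i₀) :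
    HasDir (fun y => evalP (C y) e x) p u (evalP (C p) (derP δ a e) x) := by
  induction e with
  | nil => simpa [derP] using HasDir.const (0 : ℝ) p u
  | cons t e ih =>
    have ht : ∀ v, v ∈ a :: (t.2.1 ++ varsL t.2.2) → v < fresh a t.2 := fun v hv =>
      Nat.lt_succ_of_le (le_foldr_max hv)
    have h1 := derM_hasDir t.1 (h t (by simp)) (k := fresh a t.2) (bs := t.2.1)
      (fun v hv => ht v (by simp [hv])) (ht a (by simp)) (ha t (by simp)) x hx
    have h2 := ih (fun s hs => h s (by simp [hs])) (fun s hs => ha s (by simp [hs]))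
    refine (h1.add h2).congr_val ?_
    rw [← evalP_append]
    rfl

end Leibniz

/-! ### Normal forms modulo the strong constraint -/

/-- Membership. The functions used by the normalization branch on Boolean values and compare
numbers by `Nat.beq` and `Nat.ble`, so that they are evaluated efficiently by the kernel. -/
def mem (i : ℕ) : List ℕ → Bool
  | [] => false
  | j :: l => bif Nat.beq i j then true else mem i l

/-- The first factor that satisfies `p`, and the list of the others. -/
def take (p : Fac → Bool) : List Fac → Option (Fac × List Fac)
  | [] => none
  | f :: fs => bif p f then some (f, fs) else
    match take p fs with
    | none => none
    | some t => some (t.1, f :: t.2)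

/-- The slot `𝒟̄_i` occurs in the list. -/
def memBar (i : ℕ) : List (Bool × ℕ) → Bool
  | [] => false
  | s :: l => bif s.1 && Nat.beq i s.2 then true else memBar i l

/-- The list without the first slot `𝒟̄_i`. -/
def dropBar (i : ℕ) : List (Bool × ℕ) → List (Bool × ℕ)
  | [] => []
  | s :: l => bif s.1 && Nat.beq i s.2 then l else s :: dropBar i l

/-- The factor is a jet with a slot `𝒟̄_i`. -/
def hasBar (i : ℕ) : Fac → Bool
  | .T _ l => memBar i l
  | _ => false

/-- The factor is some `g^{ij}`. -/
def isMetric : Fac → Bool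
  | .g _ _ => true
  | _ => false

/-- The factor is `g^{ij}`, with the indices in this order. -/
def isPair (i j : ℕ) : Fac → Bool
  | .g i' j' => Nat.beq i i' && Nat.beq j j'
  | _ => false

/-- `i` and `j` are distinct dummy indices that do not occur in `fs`. -/
def isolated (i j : ℕ) (bs : List ℕ) (fs : List Fac) : Bool :=
  mem i bs && mem j bs && !Nat.beq i j && !mem i (varsL fs) && !mem j (varsL fs)

/-- The strong constraint as a rewriting rule: if `g^{ij}` contracts `𝒟̄_i` with `𝒟̄_j`, on one
factor or on two, they are replaced by `𝒟_i` and `𝒟_j`. -/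
def flip (i j : ℕ) (m : Mono) : Mono :=
  match take (hasBar i) m.2 with
  | some (.T c l, r) =>
    match take (isPair i j) r with
    | some (_, r) =>
      bif memBar j (dropBar i l) then
        bif isolated i j m.1 (.T c (dropBar j (dropBar i l)) :: r) then
          (m.1, .g i j :: .T c ((false, i) :: (false, j) :: dropBar j (dropBar i l)) :: r)
        else m
      else
        match take (hasBar j) r with
        | some (.T c' l', r) =>
          bif isolated i j m.1 (.T c (dropBar i l) :: .T c' (dropBar j l') :: r) then
            (m.1, .g i j :: .T c ((false, i) :: dropBar i l) ::
              .T c' ((false, j) :: dropBar j l') :: r)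
          else m
        | _ => m
    | _ => m
  | _ => m

/-- The rule `flip` for every `g^{ij}` in a list. -/
def flipAll : List Fac → Mono → Mono
  | [], m => m
  | .g i j :: gs, m => flipAll gs (flip i j m)
  | _ :: gs, m => flipAll gs m

/-- All ways of inserting `a` into a list. -/
def insertions {α : Type} (a : α) : List α → List (List α)
  | [] => [[a]]
  | b :: l => (a :: b :: l) :: (insertions a l).map (b :: ·)

/-- All permutations of a list. -/
def perms {α : Type} : List α → List (List α)
  | [] => [[]]
  | a :: l => (perms l).flatMap (insertions a)

/-- A jet with its slots in all orders in which the unbarred ones come first. -/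
def slotOrders : Fac → List Fac
  | .T c l => (perms (l.filter (!·.1))).flatMap fun u =>
      (perms (l.filter (·.1))).map fun v => .T c (u ++ v)
  | f => [f]

/-- All choices of an order of the slots in every factor of a product. -/
def choices : List Fac → List (List Fac)
  | [] => [[]]
  | f :: fs => (slotOrders f).flatMap fun f' => (choices fs).map (f' :: ·)

/-- The index that is contracted with `i` by a `g` in the list, or else `i` itself. -/
def partner (i : ℕ) : List Fac → ℕ
  | [] => i
  | .g j k :: fs => bif Nat.beq i j then k else bif Nat.beq i k then j else partner i fs
  | _ :: fs => partner i fs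

/-- The factors in breadth-first order, when the contractions are seen as the edges of a graph.
The first list holds the indices that remain to be followed; the number bounds the steps. -/
def traverse (gs : List Fac) : ℕ → List ℕ → List Fac → List Fac
  | 0, _, fs => fs
  | _ + 1, [], fs => fs
  | n + 1, v :: vs, fs =>
    match take (fun f => mem (partner v gs) f.vars) fs with
    | none => traverse gs n vs fs
    | some t => t.1 :: traverse gs n (vs ++ t.1.vars) t.2

/-- A factor with a free index, or a parameter `X`: the traversal may start there. -/
def isRoot (bs : List ℕ) : Fac → Bool
  | .X _ _ => true
  | f => f.vars.any fun v => !mem v bs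

/-- All choices of one factor, with the list of the others. -/
def starts : List Fac → List (Fac × List Fac)
  | [] => []
  | f :: fs => (f, fs) :: (starts fs).map fun t => (t.1, f :: t.2)

/-- The orders of the factors among which the normal form is sought: one traversal if the start is
distinguished, and one for every start otherwise. The bound `12` exceeds the number of indices of
the monomials below; a smaller one would only make the normal form less canonical. -/
def arrangements (bs : List ℕ) (gs fs : List Fac) : List (List Fac) :=
  let ss : List (Fac × List Fac) := match take (isRoot bs) fs with
    | some t => [t]
    | none => starts fs
  ss.map fun t => t.1 :: traverse gs 12 t.1.vars t.2

/-- A code of a factor that ignores the names of its indices. -/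
def shape : Fac → List ℕ
  | .g _ _ => [0]
  | .T none l => 1 :: l.map fun s => bif s.1 then 6 else 5
  | .T (some _) l => 2 :: l.map fun s => bif s.1 then 6 else 5
  | .X _ _ => [3]
  | .Y b _ => [bif b then 8 else 7]

/-- The position of `i` in a list, counted from `n`, or `i` itself if it does not occur. -/
def pos (i : ℕ) : ℕ → List ℕ → ℕ
  | _, [] => i
  | n, j :: l => bif Nat.beq i j then n else pos i (n + 1) l

/-- A code of an arrangement that does not depend on the names of its dummy indices. -/
def key (gs fs : List Fac) : ℕ :=
  let vs := varsL fs
  (fs.flatMap shape ++ vs.map fun v =>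
    pos (partner v gs) 10 vs).foldl (fun n d => n * 256 + d) 0

/-- The arrangement with the least `key`. -/
def best (gs : List Fac) : ℕ × List Fac → List (List Fac) → ℕ × List Fac
  | b, [] => b
  | b, fs :: l => bif Nat.ble b.1 (key gs fs) then best gs b l else best gs (key gs fs, fs) l

/-- `g^{ij}` with its indices in increasing order. -/
def orient : Fac → Fac
  | .g i j => bif Nat.ble i j then .g i j else .g j i
  | f => f

def insertBy {α : Type} (w : α → ℕ) (a : α) : List α → List α
  | [] => [a]
  | b :: l => bif Nat.ble (w a) (w b) then a :: b :: l else b :: insertBy w a l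

/-- Insertion sort by weight. -/
def sortBy {α : Type} (w : α → ℕ) : List α → List α
  | [] => []
  | a :: l => insertBy w a (sortBy w l)

/-- The first index of a `g`; it orders the metrics. -/
def weight : Fac → ℕ
  | .g i _ => i
  | _ => 0

/-- The monomial with the dummy indices in `L` renamed to their positions in `L`. Nothing is done
unless `L` consists of dummy indices and the new names are distinct from all remaining ones. -/
def relabelled (bs : List ℕ) (gs fs : List Fac) (L : List ℕ) : Mono :=
  bif ((bs ++ varsL (gs ++ fs)).all fun v => mem v L || Nat.ble L.length v) &&
      L.all fun v => mem v bs then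
    (sortBy id (bs.map (pos · 0 L)),
      sortBy weight (gs.map fun f => orient (f.rename (pos · 0 L))) ++
        fs.map (Fac.rename (pos · 0 L)))
  else (bs, gs ++ fs)

/-- The normal form of a monomial, with its `key`. -/
def canon (m : Mono) : ℕ × Mono :=
  let m := flipAll m.2 m
  let gs := m.2.filter isMetric
  match (choices (m.2.filter (!isMetric ·))).flatMap (arrangements m.1 gs) with
  | [] => (0, m)
  | a :: l =>
    let b := best gs (key gs a, a) l
    (b.1, relabelled m.1 gs b.2 ((varsL b.2).filter (mem · m.1)))

def eqNats : List ℕ → List ℕ → Bool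
  | [], [] => true
  | i :: l, j :: l' => Nat.beq i j && eqNats l l'
  | _, _ => false

def eqSlots : List (Bool × ℕ) → List (Bool × ℕ) → Bool
  | [], [] => true
  | (b, i) :: l, (b', j) :: l' => (bif b then b' else !b') && Nat.beq i j && eqSlots l l'
  | _, _ => false

/-- Boolean equality of factors. -/
def Fac.eqb : Fac → Fac → Bool
  | .g i j, .g i' j' => Nat.beq i i' && Nat.beq j j'
  | .T none l, .T none l' => eqSlots l l'
  | .T (some (i, j)) l, .T (some (i', j')) l' => Nat.beq i i' && Nat.beq j j' && eqSlots l l'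
  | .X i j, .X i' j' => Nat.beq i i' && Nat.beq j j'
  | .Y b i, .Y b' i' => (bif b then b' else !b') && Nat.beq i i'
  | _, _ => false

def eqFacs : List Fac → List Fac → Bool
  | [], [] => true
  | f :: l, f' :: l' => f.eqb f' && eqFacs l l'
  | _, _ => false

/-- Addition of a term to a list of terms, with like terms combined. -/
def insertTerm (c : ℤ) (k : ℕ) (m : Mono) : List (ℤ × ℕ × Mono) → List (ℤ × ℕ × Mono)
  | [] => [(c, k, m)]
  | t :: l => bif Nat.beq t.2.1 k && eqNats t.2.2.1 m.1 && eqFacs t.2.2.2 m.2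
      then (t.1 + c, k, m) :: l
      else t :: insertTerm c k m l

/-- The normal form of an expression: like terms in normal form are combined. -/
def collect (e : Poly) : List (ℤ × ℕ × Mono) :=
  e.foldr (fun t l => insertTerm t.1 (canon t.2).1 (canon t.2).2 l) []

/-- All terms cancel in the normal form. -/
def isZero (e : Poly) : Bool := (collect e).all fun t => t.1 == 0

/-! ### Soundness of normal forms -/

/-- What the normalization needs to know: `g` is invertible, jets are symmetric, and the strong
constraint `∂_M A ∂^M B = 0`, `∂_M ∂^M A = 0` holds for jets `A`, `B` of the fields. -/
structure Ctx.Good (C : Ctx D) : Prop where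
  det_ne_zero : (gLow C.E).det ≠ 0
  perm : ∀ c {Ms Ns : List (DIdx D)}, Ms.Perm Ns → C.J c Ms = C.J c Ns
  null : ∀ c c' l l', ∑ k, (proj C.E l (fun Ms => C.J c (.inl k :: Ms)) *
      proj C.E l' (fun Ms => C.J c' (.inr k :: Ms)) +
    proj C.E l (fun Ms => C.J c (.inr k :: Ms)) *
      proj C.E l' (fun Ms => C.J c' (.inl k :: Ms))) = 0
  box : ∀ c l, ∑ k, proj C.E l (fun Ms => C.J c (.inl k :: .inr k :: Ms)) = 0

theorem gLow_transpose (E : Matrix (Fin D) (Fin D) ℝ) : (gLow E).transpose = gLow E := by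
  simp [gLow, add_comm]

theorem gUp_symm (E : Matrix (Fin D) (Fin D) ℝ) (i j : Fin D) : gUp E i j = gUp E j i := by
  have : (gUp E).transpose = gUp E := by
    rw [gUp, Matrix.transpose_nonsing_inv, gLow_transpose]
  rw [← this, Matrix.transpose_apply, this]

theorem gLow_mul_gUp {E : Matrix (Fin D) (Fin D) ℝ} (h : (gLow E).det ≠ 0) :
    gLow E * gUp E = 1 := Matrix.mul_nonsing_inv _ (isUnit_iff_ne_zero.2 h)

theorem gUp_mul_gLow {E : Matrix (Fin D) (Fin D) ℝ} (h : (gLow E).det ≠ 0) :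
    gUp E * gLow E = 1 := Matrix.nonsing_inv_mul _ (isUnit_iff_ne_zero.2 h)

theorem transpose_eq_two_gLow_sub (E : Matrix (Fin D) (Fin D) ℝ) :
    E.transpose = (2 : ℝ) • gLow E - E := by
  simp [gLow]

/-- `g^{ij} (ē_i^M ē_j^N - e_i^M e_j^N) = 2 η^{MN}`, with the constant metric `η` of `O(D,D)`. -/
theorem frame_completeness {E : Matrix (Fin D) (Fin D) ℝ} (h : (gLow E).det ≠ 0) (M N : DIdx D) :
    ∑ a, ∑ b, gUp E a b * (frame E true a M * frame E true b N) =
      ∑ a, ∑ b, gUp E a b * (frame E false a M * frame E false b N) +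
      2 * ∑ k, ((if M = .inl k then if N = .inr k then 1 else 0 else 0) +
        (if M = .inr k then if N = .inl k then 1 else 0 else 0)) := by
  have key : ∀ k l, (gUp E * E.transpose) k l = 2 * (1 : Matrix (Fin D) (Fin D) ℝ) k l
      - (gUp E * E) k l := by
    intro k l
    rw [transpose_eq_two_gLow_sub, mul_sub, Matrix.mul_smul, gUp_mul_gLow h]
    simp
  -- both sides equal `2 ℰᵀ - ℰᵀ g⁻¹ ℰᵀ`, as `ℰ = 2 g - ℰᵀ`
  have key2 : E * gUp E * E.transpose = E.transpose * gUp E * E := by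
    have h1 : E = (2 : ℝ) • gLow E - E.transpose := by rw [transpose_eq_two_gLow_sub]; abel
    calc E * gUp E * E.transpose = ((2 : ℝ) • gLow E - E.transpose) * gUp E * E.transpose := by
          rw [← h1]
      _ = (2 : ℝ) • E.transpose - E.transpose * (gUp E * E.transpose) := by
          rw [sub_mul, sub_mul, Matrix.smul_mul, gLow_mul_gUp h, Matrix.smul_mul, one_mul,
            mul_assoc]
      _ = E.transpose * gUp E * E := by
          nth_rw 3 [transpose_eq_two_gLow_sub]
          rw [mul_sub, Matrix.mul_smul, gUp_mul_gLow h, mul_sub, Matrix.mul_smul, mul_one,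
            mul_assoc]
          abel
  rcases M with k | k <;> rcases N with l | l
  · simp [frame]
  · have := key k l
    simp only [Matrix.mul_apply, Matrix.transpose_apply, Matrix.one_apply] at this
    simp [frame, this]
    by_cases hkl : k = l
    · simp [hkl]
      ring
    · simp [hkl, eq_comm]
  · have := key l k
    simp only [Matrix.mul_apply, Matrix.transpose_apply, Matrix.one_apply] at this
    simp [frame, gUp_symm _ _ l, this]
    by_cases hkl : k = l
    · simp [hkl]
      ring
    · simp [hkl, eq_comm]
  · have := congrFun (congrFun key2 k) l
    simp only [Matrix.mul_apply, Matrix.transpose_apply, Finset.sum_mul] at this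
    rw [Finset.sum_comm, Finset.sum_comm (f := fun b a => E a k * gUp E a b * E b l)] at this
    simp [frame]
    refine Eq.trans ?_ (this.trans ?_) <;>
      exact Finset.sum_congr rfl fun a _ => Finset.sum_congr rfl fun b _ => by ring

/-- A contraction over barred indices equals the one over unbarred indices for every array
`Q_{MN}` with `η^{MN} Q_{MN} = 0`. -/
theorem sum_frame_completeness {E : Matrix (Fin D) (Fin D) ℝ} (h : (gLow E).det ≠ 0)
    (Q : DIdx D → DIdx D → ℝ) (hQ : ∑ k, (Q (.inl k) (.inr k) + Q (.inr k) (.inl k)) = 0) :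
    ∑ a, ∑ b, gUp E a b * ∑ M, ∑ N, frame E true a M * frame E true b N * Q M N =
      ∑ a, ∑ b, gUp E a b * ∑ M, ∑ N, frame E false a M * frame E false b N * Q M N := by
  have swap : ∀ t, ∑ a, ∑ b, gUp E a b * ∑ M, ∑ N, frame E t a M * frame E t b N * Q M N =
      ∑ M, ∑ N, (∑ a, ∑ b, gUp E a b * (frame E t a M * frame E t b N)) * Q M N := by
    intro t
    simp only [Finset.mul_sum, Finset.sum_mul]
    rw [Finset.sum_congr rfl fun a _ => Finset.sum_comm, Finset.sum_comm]
    refine Finset.sum_congr rfl fun M _ => ?_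
    rw [Finset.sum_congr rfl fun a _ => Finset.sum_comm, Finset.sum_comm]
    refine Finset.sum_congr rfl fun N _ => Finset.sum_congr rfl fun a _ =>
      Finset.sum_congr rfl fun b _ => by ring
  rw [swap, swap]
  simp only [frame_completeness h, add_mul, Finset.sum_add_distrib]
  rw [add_eq_left]
  have : ∀ M N, (2 * (∑ k, (if M = .inl k then if N = .inr k then (1 : ℝ) else 0 else 0) +
        ∑ k, (if M = .inr k then if N = .inl k then 1 else 0 else 0))) * Q M N =
      2 * ∑ k, ((if M = .inl k then if N = .inr k then Q M N else 0 else 0) +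
        (if M = .inr k then if N = .inl k then Q M N else 0 else 0)) := by
    intro M N
    rw [mul_assoc, add_mul, Finset.sum_mul, Finset.sum_mul, ← Finset.sum_add_distrib]
    simp only [ite_mul, one_mul, zero_mul]
  simp only [this, ← Finset.mul_sum]
  rw [Finset.sum_congr rfl fun M _ => Finset.sum_comm, Finset.sum_comm]
  simp only [Finset.sum_add_distrib] at hQ ⊢
  simp [hQ]

/-- A jet contracted with frame vectors in all slots but the first, as a function of the latter.
-/
def slot (C : Ctx D) (x : ℕ → Fin D) (c : Option (ℕ × ℕ)) (l : List (Bool × ℕ)) (M : DIdx D) : ℝ :=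
  proj C.E (l.map (Prod.map id x)) fun Ms => C.J (c.map (Prod.map x x)) (M :: Ms)

theorem val_T_cons (C : Ctx D) (x : ℕ → Fin D) (c : Option (ℕ × ℕ)) (b : Bool) (i : ℕ)
    (l : List (Bool × ℕ)) :
    val C x (.T c ((b, i) :: l)) = ∑ M, frame C.E b (x i) M * slot C x c l M := rfl

theorem slot_congr (C : Ctx D) {x y : ℕ → Fin D} {c : Option (ℕ × ℕ)} {l : List (Bool × ℕ)}
    (h : ∀ u ∈ (Fac.T c l).vars, x u = y u) : slot C x c l = slot C y c l := by
  unfold slot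
  rw [(map_congr_of_vars h).1, (map_congr_of_vars h).2]

theorem proj_perm (E : Matrix (Fin D) (Fin D) ℝ) {l l' : List (Bool × Fin D)} (h : l.Perm l')
    {J : List (DIdx D) → ℝ} (hJ : ∀ {Ms Ns : List (DIdx D)}, Ms.Perm Ns → J Ms = J Ns) :
    proj E l J = proj E l' J := by
  induction h generalizing J with
  | nil => rfl
  | cons s _ ih =>
    exact Finset.sum_congr rfl fun M _ => by rw [ih fun hp => hJ (hp.cons M)]
  | swap s t l =>
    simp only [proj, Finset.mul_sum]
    rw [Finset.sum_comm]
    refine Finset.sum_congr rfl fun M _ => Finset.sum_congr rfl fun N _ => ?_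
    have : (fun Ms => J (N :: M :: Ms)) = fun Ms => J (M :: N :: Ms) :=
      funext fun Ms => hJ (.swap _ _ _)
    rw [this]; ring
  | trans _ _ ih1 ih2 => rw [ih1 hJ, ih2 hJ]

variable {C : Ctx D}

theorem val_T_perm (hC : C.Good) (x : ℕ → Fin D) (c : Option (ℕ × ℕ)) {l l' : List (Bool × ℕ)}
    (h : l.Perm l') : val C x (.T c l) = val C x (.T c l') :=
  proj_perm _ (h.map _) fun h => hC.perm _ h

theorem evalM_pair (C : Ctx D) {i j : ℕ} (hij : i ≠ j) {fs r : List Fac} (x : ℕ → Fin D)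
    (hi : i ∉ varsL r) (hj : j ∉ varsL r) :
    evalM C [i, j] (.g i j :: (fs ++ r)) x =
      (∑ a, ∑ b, gUp C.E a b *
        (fs.map (val C (Function.update (Function.update x i a) j b))).prod) *
        (r.map (val C x)).prod := by
  simp only [evalM, Finset.sum_mul]
  refine Finset.sum_congr rfl fun a _ => Finset.sum_congr rfl fun b _ => ?_
  have : (r.map (val C (Function.update (Function.update x i a) j b))).prod =
      (r.map (val C x)).prod := prod_val_congr C fun u hu => by
    rw [Function.update_of_ne, Function.update_of_ne]
    · rintro rfl; exact hi hu
    · rintro rfl; exact hj hu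
  simp [this, val, Function.update_of_ne hij, mul_assoc]

theorem slot_update {i j : ℕ} {c : Option (ℕ × ℕ)} {l : List (Bool × ℕ)} (x : ℕ → Fin D)
    (hi : i ∉ (Fac.T c l).vars) (hj : j ∉ (Fac.T c l).vars) (a b : Fin D) :
    slot C (Function.update (Function.update x i a) j b) c l = slot C x c l :=
  slot_congr C fun u hu => by
    rw [Function.update_of_ne, Function.update_of_ne]
    · rintro rfl; exact hi hu
    · rintro rfl; exact hj hu

/-- The rule `flip` for derivatives of two factors, from `∂_M A ∂^M B = 0`. -/
theorem evalM_flip_null (hC : C.Good) {i j : ℕ} (hij : i ≠ j) {c c' : Option (ℕ × ℕ)}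
    {l l' : List (Bool × ℕ)} {r : List Fac}
    (hi : i ∉ varsL (.T c l :: .T c' l' :: r)) (hj : j ∉ varsL (.T c l :: .T c' l' :: r))
    (x : ℕ → Fin D) :
    evalM C [i, j] (.g i j :: .T c ((true, i) :: l) :: .T c' ((true, j) :: l') :: r) x =
      evalM C [i, j] (.g i j :: .T c ((false, i) :: l) :: .T c' ((false, j) :: l') :: r) x := by
  simp only [varsL, List.flatMap_cons, List.mem_append, not_or] at hi hj
  have := fun t : Bool => evalM_pair C hij (fs := [.T c ((t, i) :: l), .T c' ((t, j) :: l')])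
    (r := r) x hi.2.2 hj.2.2
  simp only [List.cons_append, List.nil_append] at this
  rw [this, this]
  congr 1
  have := sum_frame_completeness hC.det_ne_zero
    (fun M N => slot C x c l M * slot C x c' l' N) (hC.null _ _ _ _)
  simp only [List.map_cons, List.map_nil, List.prod_cons, List.prod_nil, mul_one, val_T_cons,
    slot_update x hi.1 hj.1, slot_update x hi.2.1 hj.2.1, Function.update_self,
    Function.update_of_ne hij]
  convert this using 5
  all_goals
    rw [Finset.sum_mul_sum]
    exact Finset.sum_congr rfl fun M _ => Finset.sum_congr rfl fun N _ => by ring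

/-- The rule `flip` for two derivatives of one factor, from `∂_M ∂^M A = 0`. -/
theorem evalM_flip_box (hC : C.Good) {i j : ℕ} (hij : i ≠ j) {c : Option (ℕ × ℕ)}
    {l : List (Bool × ℕ)} {r : List Fac}
    (hi : i ∉ varsL (.T c l :: r)) (hj : j ∉ varsL (.T c l :: r)) (x : ℕ → Fin D) :
    evalM C [i, j] (.g i j :: .T c ((true, i) :: (true, j) :: l) :: r) x =
      evalM C [i, j] (.g i j :: .T c ((false, i) :: (false, j) :: l) :: r) x := by
  simp only [varsL, List.flatMap_cons, List.mem_append, not_or] at hi hj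
  have := fun t : Bool => evalM_pair C hij (fs := [.T c ((t, i) :: (t, j) :: l)])
    (r := r) x hi.2 hj.2
  simp only [List.cons_append, List.nil_append] at this
  rw [this, this]
  congr 1
  have := sum_frame_completeness hC.det_ne_zero
    (fun M N => proj C.E (l.map (Prod.map id x)) fun Ms =>
      C.J (c.map (Prod.map x x)) (M :: N :: Ms)) (by
      have hb := hC.box (c.map (Prod.map x x)) (l.map (Prod.map id x))
      have hs : ∀ k Ms, C.J (c.map (Prod.map x x)) (.inr k :: .inl k :: Ms) =
          C.J (c.map (Prod.map x x)) (.inl k :: .inr k :: Ms) := fun k Ms =>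
        hC.perm _ (.swap _ _ _)
      simp only [hs, Finset.sum_add_distrib, hb, add_zero])
  have hp : ∀ a b, (l.map (Prod.map id (Function.update (Function.update x i a) j b)) =
      l.map (Prod.map id x)) ∧ (c.map (Prod.map (Function.update (Function.update x i a) j b)
        (Function.update (Function.update x i a) j b)) = c.map (Prod.map x x)) := fun a b =>
    map_congr_of_vars fun u hu => by
      rw [Function.update_of_ne, Function.update_of_ne]
      · rintro rfl; exact hi.1 hu
      · rintro rfl; exact hj.1 hu
  simp only [List.map_cons, List.map_nil, List.prod_cons, List.prod_nil, mul_one, val, proj,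
    Prod.map_apply, id, (hp _ _).1, (hp _ _).2, Function.update_self,
    Function.update_of_ne hij]
  convert this using 5
  all_goals
    rw [Finset.mul_sum]
    exact Finset.sum_congr rfl fun N _ => by ring

theorem mem_iff {i : ℕ} {l : List ℕ} : mem i l = true ↔ i ∈ l := by
  induction l with
  | nil => simp [mem]
  | cons j l ih =>
    by_cases h : i = j
    · simp [mem, h]
    · have : Nat.beq i j = false := by rw [← Bool.not_eq_true, Nat.beq_eq]; exact h
      simp [mem, this, ih, h]

theorem take_perm {p : Fac → Bool} {fs r : List Fac} {f : Fac} (h : take p fs = some (f, r)) :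
    fs.Perm (f :: r) ∧ p f = true := by
  induction fs generalizing r with
  | nil => simp [take] at h
  | cons f' fs ih =>
    rw [take] at h
    cases hp : p f' with
    | true =>
      simp only [hp, cond_true, Option.some.injEq, Prod.mk.injEq] at h
      obtain ⟨rfl, rfl⟩ := h
      exact ⟨List.Perm.refl _, hp⟩
    | false =>
      simp only [hp, cond_false] at h
      cases ht : take p fs with
      | none => simp [ht] at h
      | some t =>
        simp only [ht, Option.some.injEq, Prod.mk.injEq] at h
        obtain ⟨rfl, rfl⟩ := h
        obtain ⟨h1, h2⟩ := ih ht
        exact ⟨(h1.cons f').trans (.swap _ _ _), h2⟩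

theorem dropBar_perm {i : ℕ} {l : List (Bool × ℕ)} (h : memBar i l = true) :
    l.Perm ((true, i) :: dropBar i l) := by
  induction l with
  | nil => simp [memBar] at h
  | cons s l ih =>
    rw [memBar] at h
    rw [dropBar]
    cases hs : s.1 && Nat.beq i s.2 with
    | true =>
      simp only [Bool.and_eq_true, Nat.beq_eq] at hs
      obtain ⟨b, j⟩ := s
      obtain ⟨rfl, rfl⟩ := hs
      simp
    | false =>
      simp only [hs, cond_false] at h ⊢
      exact ((ih h).cons s).trans (.swap _ _ _)

theorem isolated_iff {i j : ℕ} {bs : List ℕ} {fs : List Fac} : isolated i j bs fs = true ↔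
    i ∈ bs ∧ j ∈ bs ∧ i ≠ j ∧ i ∉ varsL fs ∧ j ∉ varsL fs := by
  have h : ∀ (i : ℕ) l, mem i l = false ↔ i ∉ l := fun i l => by
    rw [← mem_iff, Bool.not_eq_true]
  simp [isolated, mem_iff, h, Nat.beq_eq, and_assoc, ← Bool.not_eq_true]

theorem isPair_eq {i j : ℕ} {f : Fac} (h : isPair i j f = true) : f = .g i j := by
  cases f <;> simp_all [isPair, Nat.beq_eq]

/-- A summation over two dummy indices may be taken as the innermost one, so that a rewriting of
it applies within a monomial. -/
theorem evalM_congr_innermost {bs : List ℕ} {i j : ℕ} (hi : i ∈ bs) (hj : j ∈ bs) (hij : i ≠ j)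
    {fs fs' : List Fac} (h : ∀ x, evalM C [i, j] fs x = evalM C [i, j] fs' x) (x : ℕ → Fin D) :
    evalM C bs fs x = evalM C bs fs' x := by
  have hp : bs.Perm ((bs.erase i).erase j ++ [i, j]) :=
    ((List.perm_cons_erase hi).trans ((List.perm_cons_erase
      ((List.mem_erase_of_ne hij.symm).2 hj)).cons i)).trans
      (List.perm_append_comm (l₁ := [i, j]))
  rw [evalM_perm_bs C hp, evalM_perm_bs C hp]
  exact evalM_append_congr C h _ x

theorem evalM_congr_val {bs : List ℕ} {fs fs' : List Fac}
    (h : ∀ x, (fs.map (val C x)).prod = (fs'.map (val C x)).prod) (x : ℕ → Fin D) :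
    evalM C bs fs x = evalM C bs fs' x := by
  induction bs generalizing x with
  | nil => exact h x
  | cons b bs ih => exact Finset.sum_congr rfl fun i _ => ih _

theorem evalM_flip (hC : C.Good) (i j : ℕ) (m : Mono) (x : ℕ → Fin D) :
    evalM C (flip i j m).1 (flip i j m).2 x = evalM C m.1 m.2 x := by
  obtain ⟨bs, fs⟩ := m
  unfold flip
  split
  · rename_i c l r h
    obtain ⟨hp, hb⟩ := take_perm h
    have hl := dropBar_perm hb
    split
    · rename_i f r h'
      obtain ⟨hp', hb'⟩ := take_perm h'
      obtain rfl := isPair_eq hb'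
      have hfs := hp.trans ((hp'.cons _).trans (.swap _ _ _))
      cases hm : memBar j (dropBar i l) with
      | true =>
        have hl' := dropBar_perm hm
        cases hiso : isolated i j bs (.T c (dropBar j (dropBar i l)) :: r) with
        | true =>
          obtain ⟨hi, hj, hij, hi', hj'⟩ := isolated_iff.1 hiso
          simp only [cond_true]
          rw [evalM_perm_fs C hfs]
          refine evalM_congr_innermost hi hj hij (fun x => ?_) x
          rw [← evalM_flip_box hC hij hi' hj' x]
          refine evalM_congr_val (fun x => ?_) x
          simp only [List.map_cons, val_T_perm hC x c (hl.trans (hl'.cons _))]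
        | false => simp
      | false =>
        simp only [cond_false]
        split
        · rename_i c' l' r h''
          obtain ⟨hp'', hb''⟩ := take_perm h''
          have hl' := dropBar_perm hb''
          cases hiso : isolated i j bs (.T c (dropBar i l) :: .T c' (dropBar j l') :: r) with
          | true =>
            obtain ⟨hi, hj, hij, hi', hj'⟩ := isolated_iff.1 hiso
            simp only [cond_true]
            rw [evalM_perm_fs C (hfs.trans ((hp''.cons _).cons _))]
            refine evalM_congr_innermost hi hj hij (fun x => ?_) x
            rw [← evalM_flip_null hC hij hi' hj' x]
            refine evalM_congr_val (fun x => ?_) x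
            simp only [List.map_cons, val_T_perm hC x c hl, val_T_perm hC x c' hl']
          | false => simp
        · rfl
    · rfl
  · rfl

theorem evalM_flipAll (hC : C.Good) (gs : List Fac) (m : Mono) (x : ℕ → Fin D) :
    evalM C (flipAll gs m).1 (flipAll gs m).2 x = evalM C m.1 m.2 x := by
  induction gs generalizing m with
  | nil => rfl
  | cons f gs ih =>
    cases f with
    | g i j => exact (ih _).trans (evalM_flip hC i j m x)
    | _ => exact ih m

theorem perm_of_mem_insertions {α : Type} {a : α} {l l' : List α} (h : l' ∈ insertions a l) :
    l'.Perm (a :: l) := by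
  induction l generalizing l' with
  | nil => simp_all [insertions]
  | cons b l ih =>
    rw [insertions] at h
    rcases List.mem_cons.1 h with rfl | h
    · exact List.Perm.refl _
    · obtain ⟨l'', h'', rfl⟩ := List.mem_map.1 h
      exact ((ih h'').cons b).trans (.swap _ _ _)

theorem perm_of_mem_perms {α : Type} {l l' : List α} (h : l' ∈ perms l) : l'.Perm l := by
  induction l generalizing l' with
  | nil => simp_all [perms]
  | cons b l ih =>
    obtain ⟨l'', h1, h2⟩ := List.mem_flatMap.1 h
    exact (perm_of_mem_insertions h2).trans ((ih h1).cons b)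

theorem val_of_mem_slotOrders (hC : C.Good) {f f' : Fac} (h : f' ∈ slotOrders f)
    (x : ℕ → Fin D) : val C x f' = val C x f := by
  cases f with
  | T c l =>
    simp only [slotOrders, List.mem_flatMap, List.mem_map] at h
    obtain ⟨u, hu, v, hv, rfl⟩ := h
    refine val_T_perm hC x c (((perm_of_mem_perms hu).append (perm_of_mem_perms hv)).trans ?_)
    refine List.perm_append_comm.trans ?_
    simpa using List.filter_append_perm (fun s : Bool × ℕ => s.1) l
  | _ => simp_all [slotOrders]

theorem prod_of_mem_choices (hC : C.Good) {fs fs' : List Fac} (h : fs' ∈ choices fs)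
    (x : ℕ → Fin D) : (fs'.map (val C x)).prod = (fs.map (val C x)).prod := by
  induction fs generalizing fs' with
  | nil => simp_all [choices]
  | cons f fs ih =>
    simp only [choices, List.mem_flatMap, List.mem_map] at h
    obtain ⟨f', hf', fs'', h'', rfl⟩ := h
    simp [val_of_mem_slotOrders hC hf', ih h'']

theorem traverse_perm (gs : List Fac) (n : ℕ) (vs : List ℕ) (fs : List Fac) :
    (traverse gs n vs fs).Perm fs := by
  induction n generalizing vs fs with
  | zero => rw [traverse]
  | succ n ih =>
    cases vs with
    | nil => rw [traverse]
    | cons v vs =>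
      rw [traverse]
      split
      · exact ih _ _
      · rename_i t h
        exact ((ih _ _).cons _).trans (take_perm h).1.symm

theorem starts_perm {fs : List Fac} {t : Fac × List Fac} (h : t ∈ starts fs) :
    (t.1 :: t.2).Perm fs := by
  induction fs generalizing t with
  | nil => simp [starts] at h
  | cons f fs ih =>
    rcases List.mem_cons.1 h with rfl | h
    · exact List.Perm.refl _
    · obtain ⟨s, hs, rfl⟩ := List.mem_map.1 h
      exact (List.Perm.swap _ _ _).trans ((ih hs).cons f)

theorem arrangements_perm {bs : List ℕ} {gs fs fs' : List Fac}
    (h : fs' ∈ arrangements bs gs fs) : fs'.Perm fs := by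
  obtain ⟨t, ht, rfl⟩ := List.mem_map.1 h
  refine ((traverse_perm _ _ _ _).cons _).trans ?_
  split at ht
  · rename_i s hs
    obtain rfl := List.mem_singleton.1 ht
    exact (take_perm hs).1.symm
  · exact starts_perm ht

theorem best_mem (gs : List Fac) (b : ℕ × List Fac) (l : List (List Fac)) :
    (best gs b l).2 ∈ b.2 :: l := by
  induction l generalizing b with
  | nil => simp [best]
  | cons fs l ih =>
    rw [best]
    cases Nat.ble b.1 (key gs fs) with
    | true =>
      rw [cond_true]
      have := ih b
      simp only [List.mem_cons] at this ⊢
      tauto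
    | false =>
      rw [cond_false]
      have := ih (key gs fs, fs)
      simp only [List.mem_cons] at this ⊢
      tauto

theorem insertBy_perm {α : Type} (w : α → ℕ) (a : α) (l : List α) :
    (insertBy w a l).Perm (a :: l) := by
  induction l with
  | nil => exact List.Perm.refl _
  | cons b l ih =>
    rw [insertBy]
    cases Nat.ble (w a) (w b) with
    | true => exact List.Perm.refl _
    | false => exact (ih.cons b).trans (.swap _ _ _)

theorem sortBy_perm {α : Type} (w : α → ℕ) (l : List α) : (sortBy w l).Perm l := by
  induction l with
  | nil => exact List.Perm.refl _
  | cons a l ih => exact (insertBy_perm w a _).trans (ih.cons a)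

theorem pos_of_notMem {i n : ℕ} {L : List ℕ} (h : i ∉ L) : pos i n L = i := by
  induction L generalizing n with
  | nil => rfl
  | cons j L ih =>
    have hj : Nat.beq i j = false := by
      rw [← Bool.not_eq_true, Nat.beq_eq]; rintro rfl; simp at h
    rw [pos, hj, cond_false, ih fun h' => h (by simp [h'])]

theorem pos_bounds {i n : ℕ} {L : List ℕ} (h : i ∈ L) :
    n ≤ pos i n L ∧ pos i n L < n + L.length := by
  induction L generalizing n with
  | nil => simp at h
  | cons j L ih =>
    rw [pos]
    cases hj : Nat.beq i j with
    | true => simp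
    | false =>
      have hne : i ≠ j := by rintro rfl; simp [← Bool.not_eq_true] at hj
      have := ih (n := n + 1) (by simpa [hne] using h)
      simp only [cond_false, List.length_cons]
      omega

theorem pos_injOn {i j n : ℕ} {L : List ℕ} (hi : i ∈ L) (hj : j ∈ L)
    (h : pos i n L = pos j n L) : i = j := by
  induction L generalizing n with
  | nil => simp at hi
  | cons k L ih =>
    by_cases hik : i = k <;> by_cases hjk : j = k
    · rw [hik, hjk]
    · have hj' : j ∈ L := by simpa [hjk] using hj
      have h1 : Nat.beq i k = true := Nat.beq_eq .. ▸ hik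
      have h2 : Nat.beq j k = false := by rw [← Bool.not_eq_true, Nat.beq_eq]; exact hjk
      rw [pos, pos, h1, h2, cond_true, cond_false] at h
      have := (pos_bounds (n := n + 1) hj').1
      omega
    · have hi' : i ∈ L := by simpa [hik] using hi
      have h1 : Nat.beq j k = true := Nat.beq_eq .. ▸ hjk
      have h2 : Nat.beq i k = false := by rw [← Bool.not_eq_true, Nat.beq_eq]; exact hik
      rw [pos, pos, h1, h2, cond_true, cond_false] at h
      have := (pos_bounds (n := n + 1) hi').1
      omega
    · have h1 : Nat.beq i k = false := by rw [← Bool.not_eq_true, Nat.beq_eq]; exact hik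
      have h2 : Nat.beq j k = false := by rw [← Bool.not_eq_true, Nat.beq_eq]; exact hjk
      rw [pos, pos, h1, h2, cond_false, cond_false] at h
      exact ih (by simpa [hik] using hi) (by simpa [hjk] using hj) h

theorem val_orient (C : Ctx D) (x : ℕ → Fin D) (f : Fac) : val C x (orient f) = val C x f := by
  cases f with
  | g i j =>
    rw [orient]
    cases Nat.ble i j
    · exact gUp_symm _ _ _
    · rfl
  | _ => rfl

theorem evalM_relabelled (C : Ctx D) (bs : List ℕ) (gs fs : List Fac) (L : List ℕ)
    (x : ℕ → Fin D) :
    evalM C (relabelled bs gs fs L).1 (relabelled bs gs fs L).2 x = evalM C bs (gs ++ fs) x := by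
  rw [relabelled]
  cases h : ((bs ++ varsL (gs ++ fs)).all fun v => mem v L || Nat.ble L.length v) &&
      L.all fun v => mem v bs with
  | false => rfl
  | true =>
    simp only [Bool.and_eq_true, List.all_eq_true, Bool.or_eq_true, mem_iff, Nat.ble_eq] at h
    rw [cond_true]
    simp only
    rw [evalM_perm_bs C (sortBy_perm _ _),
      evalM_perm_fs C ((sortBy_perm weight (gs.map fun f => orient (f.rename (pos · 0 L)))).append
        (List.Perm.refl (fs.map (Fac.rename (pos · 0 L)))))]
    have : evalM C (bs.map (pos · 0 L)) (gs.map (fun f => orient (f.rename (pos · 0 L))) ++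
        fs.map (Fac.rename (pos · 0 L))) x =
        evalM C (bs.map (pos · 0 L)) ((gs ++ fs).map (Fac.rename (pos · 0 L))) x := by
      refine evalM_congr_val (fun x => ?_) x
      simp [Function.comp_def, val_orient]
    rw [this, evalM_rename_of_injOn]
    · refine evalM_congr C fun u hu hb => ?_
      have : u ∉ L := fun h' => hb (h.2 u h')
      simp [pos_of_notMem this]
    · intro u hu v hv huv
      by_cases h1 : u ∈ L <;> by_cases h2 : v ∈ L
      · exact pos_injOn h1 h2 huv
      · have := (pos_bounds (n := 0) h1).2
        rw [huv, pos_of_notMem h2] at this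
        have := (h.1 v hv).resolve_left h2
        omega
      · have := (pos_bounds (n := 0) h2).2
        rw [← huv, pos_of_notMem h1] at this
        have := (h.1 u hu).resolve_left h1
        omega
      · rwa [pos_of_notMem h1, pos_of_notMem h2] at huv

theorem evalM_canon (hC : C.Good) (m : Mono) (x : ℕ → Fin D) :
    evalM C (canon m).2.1 (canon m).2.2 x = evalM C m.1 m.2 x := by
  rw [← evalM_flipAll hC m.2 m x]
  unfold canon
  generalize flipAll m.2 m = m
  simp only
  split
  · rfl
  · rename_i a l h
    simp only
    rw [evalM_relabelled]
    generalize hb : (best _ _ _).2 = fs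
    have hfs : fs ∈ (choices (m.2.filter (!isMetric ·))).flatMap
        (arrangements m.1 (m.2.filter isMetric)) := by
      rw [h, ← hb]; exact best_mem _ _ _
    obtain ⟨ts, hts, hfs⟩ := List.mem_flatMap.1 hfs
    rw [evalM_perm_fs C ((List.Perm.refl _).append (arrangements_perm hfs)),
      ← evalM_perm_fs C (List.filter_append_perm isMetric m.2)]
    refine evalM_congr_val (fun x => ?_) x
    simp [prod_of_mem_choices hC hts]

theorem eqNats_eq {l l' : List ℕ} (h : eqNats l l' = true) : l = l' := by
  induction l generalizing l' with
  | nil => cases l' <;> simp_all [eqNats]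
  | cons i l ih =>
    cases l' with
    | nil => simp [eqNats] at h
    | cons j l' =>
      simp only [eqNats, Bool.and_eq_true, Nat.beq_eq] at h
      rw [h.1, ih h.2]

theorem eqBool_eq {b b' : Bool} (h : (bif b then b' else !b') = true) : b = b' := by
  cases b <;> cases b' <;> simp_all

theorem eqSlots_eq {l l' : List (Bool × ℕ)} (h : eqSlots l l' = true) : l = l' := by
  induction l generalizing l' with
  | nil => cases l' <;> simp_all [eqSlots]
  | cons s l ih =>
    cases l' with
    | nil => simp [eqSlots] at h
    | cons t l' =>
      simp only [eqSlots, Bool.and_eq_true, Nat.beq_eq] at h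
      rw [ih h.2, Prod.ext (eqBool_eq h.1.1) h.1.2]

theorem Fac.eqb_eq {f f' : Fac} (h : f.eqb f' = true) : f = f' := by
  rcases f with _ | ⟨_ | _, _⟩ | _ | _ <;> rcases f' with _ | ⟨_ | _, _⟩ | _ | _ <;>
    simp only [Fac.eqb, Bool.and_eq_true, Nat.beq_eq, Bool.false_eq_true] at h
  · rw [h.1, h.2]
  · rw [eqSlots_eq h]
  · rw [eqSlots_eq h.2, Prod.ext h.1.1 h.1.2]
  · rw [h.1, h.2]
  · rw [eqBool_eq h.1, h.2]

theorem eqFacs_eq {l l' : List Fac} (h : eqFacs l l' = true) : l = l' := by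
  induction l generalizing l' with
  | nil => cases l' <;> simp_all [eqFacs]
  | cons f l ih =>
    cases l' with
    | nil => simp [eqFacs] at h
    | cons f' l' =>
      simp only [eqFacs, Bool.and_eq_true] at h
      rw [ih h.2, Fac.eqb_eq h.1]

/-- The value of a list of terms in normal form. -/
def evalC (C : Ctx D) (e : List (ℤ × ℕ × Mono)) (x : ℕ → Fin D) : ℝ :=
  (e.map fun t => (t.1 : ℝ) * evalM C t.2.2.1 t.2.2.2 x).sum

theorem evalC_insertTerm (C : Ctx D) (c : ℤ) (k : ℕ) (m : Mono) (e : List (ℤ × ℕ × Mono))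
    (x : ℕ → Fin D) :
    evalC C (insertTerm c k m e) x = c * evalM C m.1 m.2 x + evalC C e x := by
  induction e with
  | nil => simp [insertTerm, evalC]
  | cons t e ih =>
    rw [insertTerm]
    cases h : Nat.beq t.2.1 k && eqNats t.2.2.1 m.1 && eqFacs t.2.2.2 m.2 with
    | true =>
      simp only [Bool.and_eq_true] at h
      simp [evalC, eqNats_eq h.1.2, eqFacs_eq h.2]
      ring
    | false =>
      simp only [evalC, cond_false, List.map_cons, List.sum_cons] at ih ⊢
      rw [ih]; ring

theorem evalC_collect (hC : C.Good) (e : Poly) (x : ℕ → Fin D) :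
    evalC C (collect e) x = evalP C e x := by
  induction e with
  | nil => rfl
  | cons t e ih =>
    have : collect (t :: e) = insertTerm t.1 (canon t.2).1 (canon t.2).2 (collect e) := rfl
    rw [this, evalC_insertTerm, ih, evalM_canon hC, evalP_cons]

/-- Soundness of the normalization. -/
theorem evalP_eq_zero (hC : C.Good) {e : Poly} (h : isZero e = true) (x : ℕ → Fin D) :
    evalP C e x = 0 := by
  rw [← evalC_collect hC, evalC]
  refine List.sum_eq_zero fun r hr => ?_
  obtain ⟨t, ht, rfl⟩ := List.mem_map.1 hr
  have := List.all_eq_true.1 h t ht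
  simp only [beq_iff_eq] at this
  simp [this]

/-! ### Derivatives of elementary factors -/

/-- The part of the derivative of a jet that comes from the frame vectors in the slots. If
`2 γ_{ij}` is the derivative of `ℰ_{ij}`, that of `𝒟_s` is
`-2 γ_{sk} ∂̃^k = -γ_{sk} g^{kl} (𝒟̄_l - 𝒟_l)`, and that of `𝒟̄_s` is
`γ_{ks} g^{kl} (𝒟̄_l - 𝒟_l)`. The two lists hold the slots before and after the current one. -/
def corr (γ : ℕ → ℕ → Fac) (k : ℕ) (c : Option (ℕ × ℕ)) :
    List (Bool × ℕ) → List (Bool × ℕ) → Poly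
  | _, [] => []
  | pre, (b, s) :: l =>
    let γ' := if b then γ k s else γ s k
    (if b then 1 else -1, ([k, k + 1], [γ', .g k (k + 1), .T c (pre ++ (true, k + 1) :: l)])) ::
    (if b then -1 else 1, ([k, k + 1], [γ', .g k (k + 1), .T c (pre ++ (false, k + 1) :: l)])) ::
    corr γ k c (pre ++ [(b, s)]) l

/-- The derivative of `g^{ij}`, when `2 γ_{ij}` is the derivative of `ℰ_{ij}`. -/
def metricRule (γ : ℕ → ℕ → Fac) (k i j : ℕ) : Poly :=
  [(-1, ([k, k + 1], [.g i k, γ k (k + 1), .g (k + 1) j])),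
   (-1, ([k, k + 1], [.g i k, γ (k + 1) k, .g (k + 1) j]))]

/-- The derivative of a factor when `ℰ` moves in the direction `2 X` and the jets are kept fixed.
-/
def shiftRule (k : ℕ) : Fac → Poly
  | .g i j => metricRule .X k i j
  | .T c l => corr .X k c [] l
  | _ => []

/-- The derivative of a factor when `∂_M ℰ_{ij}` moves in the direction `2 v_M X_{ij}`. -/
def gradRule (_ : ℕ) : Fac → Poly
  | .T (some (i, j)) [(b, s)] => [(1, ([], [.Y b s, .X i j]))]
  | _ => []

/-- The derivative of a factor when `∂_M d` moves in the direction `v_M`. -/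
def dilRule (_ : ℕ) : Fac → Poly
  | .T none [(b, s)] => [(1, ([], [.Y b s]))]
  | _ => []

/-- The derivative `𝒟_a` (for `b = false`) or `𝒟̄_a` (for `b = true`) of a factor. -/
def fieldRule (b : Bool) (a : ℕ) (k : ℕ) : Fac → Poly
  | .g i j => metricRule (fun p q => .T (some (p, q)) [(b, a)]) k i j
  | .T c l => (1, ([], [.T c ((b, a) :: l)])) ::
      corr (fun p q => .T (some (p, q)) [(b, a)]) k c [] l
  | _ => []

/-! ### Soundness of the rules -/

theorem proj_append (E : Matrix (Fin D) (Fin D) ℝ) (l l' : List (Bool × Fin D))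
    (J : List (DIdx D) → ℝ) :
    proj E (l ++ l') J = proj E l fun Ms => proj E l' fun Ns => J (Ms ++ Ns) := by
  induction l generalizing J with
  | nil => rfl
  | cons s l ih => simp only [List.cons_append, proj, ih]

theorem proj_add (E : Matrix (Fin D) (Fin D) ℝ) (l : List (Bool × Fin D))
    (J J' : List (DIdx D) → ℝ) :
    proj E l (fun Ms => J Ms + J' Ms) = proj E l J + proj E l J' := by
  induction l generalizing J J' with
  | nil => rfl
  | cons s l ih => simp only [proj, ih, mul_add, Finset.sum_add_distrib]

theorem proj_mul (E : Matrix (Fin D) (Fin D) ℝ) (l : List (Bool × Fin D)) (c : ℝ)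
    (J : List (DIdx D) → ℝ) : proj E l (fun Ms => c * J Ms) = c * proj E l J := by
  induction l generalizing J with
  | nil => rfl
  | cons s l ih =>
    simp only [proj, ih, Finset.mul_sum]
    exact Finset.sum_congr rfl fun M _ => by ring

theorem proj_zero (E : Matrix (Fin D) (Fin D) ℝ) (l : List (Bool × Fin D)) :
    proj E l (fun _ => 0) = 0 := by
  simpa using proj_mul E l 0 fun _ => 0

theorem proj_sum {ι : Type*} (E : Matrix (Fin D) (Fin D) ℝ) (l : List (Bool × Fin D))
    (s : Finset ι) (J : ι → List (DIdx D) → ℝ) :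
    proj E l (fun Ms => ∑ i ∈ s, J i Ms) = ∑ i ∈ s, proj E l (J i) := by
  classical
  induction s using Finset.induction_on with
  | empty => simpa using proj_zero E l
  | insert i s hi ih => simp only [Finset.sum_insert hi, proj_add, ih]

/-- The derivative of the frame vectors when that of `ℰ` is `γ`. -/
def frameDot (γ : Fin D → Fin D → ℝ) (b : Bool) (i : Fin D) : DIdx D → ℝ :=
  Sum.elim (fun _ => 0) (fun k => if b then γ k i else -γ i k)

/-- The part of the derivative of `proj` that comes from the frame. -/
def projDot (γ : Fin D → Fin D → ℝ) (E : Matrix (Fin D) (Fin D) ℝ) :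
    List (Bool × Fin D) → (List (DIdx D) → ℝ) → ℝ
  | [], _ => 0
  | s :: l, J => ∑ M, frameDot γ s.1 s.2 M * proj E l (fun Ms => J (M :: Ms)) +
      ∑ M, frame E s.1 s.2 M * projDot γ E l (fun Ms => J (M :: Ms))

section

variable {P : Type*} [NormedAddCommGroup P] [NormedSpace ℝ P] {p u : P}
  {E : P → Matrix (Fin D) (Fin D) ℝ} {γ : Fin D → Fin D → ℝ}

theorem HasDir.neg {F : P → ℝ} {a : ℝ} (hF : HasDir F p u a) :
    HasDir (fun y => -F y) p u (-a) := by
  simpa using hF.const_mul (-1)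

theorem HasDir.congr_of_eventuallyEq {F G : P → ℝ} {a : ℝ} (hF : HasDir F p u a)
    (h : G =ᶠ[nhds p] F) : HasDir G p u a :=
  ⟨hF.1.congr_of_eventuallyEq h, by rw [h.fderiv_eq]; exact hF.2⟩

theorem hasDir_frame (hE : ∀ i j, HasDir (fun y => E y i j) p u (γ i j)) (b : Bool) (i : Fin D)
    (M : DIdx D) : HasDir (fun y => frame (E y) b i M) p u (frameDot γ b i M) := by
  rcases M with k | k
  · exact HasDir.const _ p u
  · cases b
    · exact (hE i k).neg
    · exact hE k i

theorem hasDir_proj (hE : ∀ i j, HasDir (fun y => E y i j) p u (γ i j))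
    (l : List (Bool × Fin D)) {J : P → List (DIdx D) → ℝ} {J' : List (DIdx D) → ℝ}
    (hJ : ∀ Ms, Ms.length = l.length → HasDir (fun y => J y Ms) p u (J' Ms)) :
    HasDir (fun y => proj (E y) l (J y)) p u (proj (E p) l J' + projDot γ (E p) l (J p)) := by
  induction l generalizing J J' with
  | nil => simpa [proj, projDot] using hJ [] rfl
  | cons s l ih =>
    have := HasDir.sum (s := Finset.univ) fun M _ => (hasDir_frame hE s.1 s.2 M).mul
      (ih (J := fun y Ms => J y (M :: Ms)) (J' := fun Ms => J' (M :: Ms))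
        fun Ms h => hJ (M :: Ms) (by simp [h]))
    refine this.congr_val ?_
    simp only [proj, projDot, Finset.sum_add_distrib, mul_add]
    ring

theorem differentiableAt_det {ι : Type*} [Fintype ι] [DecidableEq ι] {A : P → Matrix ι ι ℝ}
    (h : ∀ i j, DifferentiableAt ℝ (fun y => A y i j) p) :
    DifferentiableAt ℝ (fun y => (A y).det) p := by
  simp only [Matrix.det_apply]
  exact DifferentiableAt.fun_sum fun σ _ =>
    ((HasFDerivAt.finsetProd fun i _ => (h _ _).hasFDerivAt).differentiableAt).const_smul _

theorem hasDir_gLow (hE : ∀ i j, HasDir (fun y => E y i j) p u (γ i j)) (i j : Fin D) :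
    HasDir (fun y => gLow (E y) i j) p u (1 / 2 * (γ i j + γ j i)) := by
  simpa [gLow] using ((hE i j).add (hE j i)).const_mul (1 / 2)

theorem differentiableAt_gUp (hE : ∀ i j, HasDir (fun y => E y i j) p u (γ i j))
    (hdet : (gLow (E p)).det ≠ 0) (i j : Fin D) :
    DifferentiableAt ℝ (fun y => gUp (E y) i j) p := by
  have hg : ∀ i j, DifferentiableAt ℝ (fun y => gLow (E y) i j) p := fun i j =>
    (hasDir_gLow hE i j).1
  simp only [gUp, Matrix.inv_def, Ring.inverse_eq_inv', Matrix.smul_apply, smul_eq_mul,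
    Matrix.adjugate_apply]
  refine ((differentiableAt_det hg).inv hdet).mul (differentiableAt_det fun k l => ?_)
  by_cases hk : k = j
  · subst hk; simp
  · simpa [Matrix.updateRow_ne hk] using hg k l

/-- The derivative of the inverse matrix, from the derivative of `g⁻¹ g = 1`. -/
theorem hasDir_gUp (hE : ∀ i j, HasDir (fun y => E y i j) p u (γ i j))
    (hdet : (gLow (E p)).det ≠ 0) (i j : Fin D) :
    HasDir (fun y => gUp (E y) i j) p u
      (-∑ k, ∑ l, gUp (E p) i k * (1 / 2 * (γ k l + γ l k)) * gUp (E p) l j) := by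
  have hG := fun i j => differentiableAt_gUp hE hdet i j
  refine ⟨hG i j, ?_⟩
  set G' : Matrix (Fin D) (Fin D) ℝ :=
    Matrix.of fun i j => fderiv ℝ (fun y => gUp (E y) i j) p u with hG'
  set g' : Matrix (Fin D) (Fin D) ℝ := Matrix.of fun i j => 1 / 2 * (γ i j + γ j i) with hg'
  have hev : ∀ᶠ y in nhds p, (gLow (E y)).det ≠ 0 :=
    (differentiableAt_det fun i j => (hasDir_gLow hE i j).1).continuousAt.eventually_ne hdet
  -- differentiate `g⁻¹ g = 1`, which holds near `p`
  have hprod : G' * gLow (E p) + gUp (E p) * g' = 0 := by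
    ext i j
    have h1 : HasDir (fun y => ∑ k, gUp (E y) i k * gLow (E y) k j) p u
        (∑ k, (G' i k * gLow (E p) k j + gUp (E p) i k * g' k j)) :=
      HasDir.sum fun k _ => HasDir.mul ⟨hG i k, rfl⟩ (hasDir_gLow hE k j)
    have h2 : HasDir (fun y => ∑ k, gUp (E y) i k * gLow (E y) k j) p u 0 := by
      refine (HasDir.const ((1 : Matrix (Fin D) (Fin D) ℝ) i j) p u).congr_of_eventuallyEq ?_
      filter_upwards [hev] with y hy
      rw [← gUp_mul_gLow hy, Matrix.mul_apply]
    have := h1.2.symm.trans h2.2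
    simpa [Matrix.mul_apply, Finset.sum_add_distrib] using this
  have : G' = -(gUp (E p) * g' * gUp (E p)) := by
    have h3 := congrArg (· * gUp (E p)) hprod
    simp only [add_mul, mul_assoc, gLow_mul_gUp hdet, mul_one, zero_mul] at h3
    rw [mul_assoc]
    exact eq_neg_of_add_eq_zero_left h3
  have := congrFun (congrFun this i) j
  simp only [hG', Matrix.of_apply, Matrix.neg_apply] at this
  rw [this, Matrix.mul_apply]
  simp only [Matrix.mul_apply, Finset.sum_mul, hg', Matrix.of_apply]
  rw [Finset.sum_comm]

end

/-- The derivative of the frame vectors in terms of the frame vectors. -/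
theorem frameDot_eq {E : Matrix (Fin D) (Fin D) ℝ} (hdet : (gLow E).det ≠ 0)
    (γ : Fin D → Fin D → ℝ) (b : Bool) (i : Fin D) (M : DIdx D) :
    ∑ m, ∑ n, 1 / 2 * (if b then γ m i else -γ i m) * gUp E m n *
      (frame E true n M - frame E false n M) = frameDot γ b i M := by
  rcases M with k | k
  · simp [frame, frameDot]
  · have : ∀ n, frame E true n (.inr k) - frame E false n (.inr k) = 2 * gLow E n k := by
      intro n; simp [frame, gLow]; ring
    simp only [this]
    have h : ∀ m, ∑ n, gUp E m n * gLow E n k = if m = k then 1 else 0 := by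
      intro m
      rw [← Matrix.mul_apply, gUp_mul_gLow hdet, Matrix.one_apply]
    have : ∀ m, ∑ n, 1 / 2 * (if b then γ m i else -γ i m) * gUp E m n * (2 * gLow E n k) =
        (if b then γ m i else -γ i m) * ∑ n, gUp E m n * gLow E n k := by
      intro m
      rw [Finset.mul_sum]
      exact Finset.sum_congr rfl fun n _ => by ring
    simp only [this, h]
    simp [frameDot]

/-- Correctness of `corr`. -/
theorem evalP_corr (C : Ctx D) (hdet : (gLow C.E).det ≠ 0) {γf : ℕ → ℕ → Fac}
    {γ : Fin D → Fin D → ℝ} {a k : ℕ} {i₀ : Fin D} (ha : a < k)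
    (hγ : ∀ p q (x : ℕ → Fin D), x a = i₀ → val C x (γf p q) = 1 / 2 * γ (x p) (x q))
    (c : Option (ℕ × ℕ)) (pre l : List (Bool × ℕ))
    (hk : ∀ v ∈ (Fac.T c (pre ++ l)).vars, v < k) (x : ℕ → Fin D) (hx : x a = i₀) :
    evalP C (corr γf k c pre l) x =
      proj C.E (pre.map (Prod.map id x)) fun Ms =>
        projDot γ C.E (l.map (Prod.map id x)) fun Ns =>
          C.J (c.map (Prod.map x x)) (Ms ++ Ns) := by
  induction l generalizing pre with
  | nil => simpa [corr, projDot] using (proj_zero _ _).symm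
  | cons s l ih =>
    obtain ⟨b, s⟩ := s
    rw [corr]
    simp only [evalP_cons]
    rw [ih (pre ++ [(b, s)]) (by simpa using hk)]
    have hk' : ∀ v ∈ (Fac.T c (pre ++ l)).vars, v < k := fun v hv => hk v (by
      simp only [Fac.vars, List.map_append, List.mem_append, List.map_cons, List.mem_cons] at hv ⊢
      tauto)
    have hs : s < k := hk s (by simp [Fac.vars])
    have hval : ∀ (t : Bool) (m n : Fin D),
        val C (Function.update (Function.update x k m) (k + 1) n)
          (.T c (pre ++ (t, k + 1) :: l)) =
        proj C.E (pre.map (Prod.map id x)) fun Ms => ∑ M, frame C.E t n M *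
          proj C.E (l.map (Prod.map id x)) fun Ns =>
            C.J (c.map (Prod.map x x)) (Ms ++ M :: Ns) := by
      intro t m n
      have hc := map_congr_of_vars (x := Function.update (Function.update x k m) (k + 1) n)
        (y := x) (c := c) (l := pre ++ l) fun v hv => by
          have := hk' v hv
          rw [Function.update_of_ne (by omega), Function.update_of_ne (by omega)]
      rw [List.map_append, List.map_append] at hc
      have h12 := List.append_inj hc.1 (by simp)
      rw [val, List.map_append, List.map_cons, proj_append, h12.1, h12.2, hc.2]
      simp [proj]
    have hterm : ∀ t : Bool, evalM C [k, k + 1]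
        [if b then γf k s else γf s k, .g k (k + 1), .T c (pre ++ (t, k + 1) :: l)] x =
        proj C.E (pre.map (Prod.map id x)) fun Ms => ∑ M,
          (∑ m, ∑ n, 1 / 2 * (if b then γ m (x s) else γ (x s) m) * gUp C.E m n *
            frame C.E t n M) * proj C.E (l.map (Prod.map id x)) fun Ns =>
            C.J (c.map (Prod.map x x)) (Ms ++ M :: Ns) := by
      intro t
      simp only [evalM, List.map_cons, List.map_nil, List.prod_cons, List.prod_nil, mul_one, hval]
      simp only [Finset.sum_mul]
      rw [show (fun Ms => ∑ M, ∑ m, ∑ n, 1 / 2 * (if b then γ m (x s) else γ (x s) m) *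
          gUp C.E m n * frame C.E t n M * proj C.E (l.map (Prod.map id x)) fun Ns =>
            C.J (c.map (Prod.map x x)) (Ms ++ M :: Ns)) = fun Ms => ∑ m, ∑ n,
          (1 / 2 * (if b then γ m (x s) else γ (x s) m) * gUp C.E m n) * ∑ M, frame C.E t n M *
          proj C.E (l.map (Prod.map id x)) fun Ns =>
            C.J (c.map (Prod.map x x)) (Ms ++ M :: Ns) from funext fun Ms => by
          rw [Finset.sum_comm]
          refine Finset.sum_congr rfl fun m _ => ?_
          rw [Finset.sum_comm]
          refine Finset.sum_congr rfl fun n _ => ?_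
          rw [Finset.mul_sum]
          exact Finset.sum_congr rfl fun M _ => by ring]
      simp only [proj_sum, proj_mul]
      refine Finset.sum_congr rfl fun m _ => Finset.sum_congr rfl fun n _ => ?_
      rw [← mul_assoc]
      congr 1
      have hx' : Function.update (Function.update x k m) (k + 1) n a = i₀ := by
        rw [Function.update_of_ne (by omega), Function.update_of_ne (by omega), hx]
      have h1 : Function.update (Function.update x k m) (k + 1) n k = m := by
        rw [Function.update_of_ne (by omega), Function.update_self]
      have h2 : Function.update (Function.update x k m) (k + 1) n s = x s := by
        rw [Function.update_of_ne (by omega), Function.update_of_ne (by omega)]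
      have hg : val C (Function.update (Function.update x k m) (k + 1) n) (.g k (k + 1)) =
          gUp C.E m n := by simp [val]
      cases b <;> simp only [Bool.false_eq_true, if_true, if_false, hγ _ _ _ hx', h1, h2, hg]
    rw [hterm, hterm, ← add_assoc, List.map_append, proj_append]
    simp only [List.map_cons, projDot, proj_add]
    congr 1
    · simp only [← frameDot_eq hdet]
      cases b
      all_goals
        simp only [Bool.false_eq_true, if_true, if_false, Int.cast_neg, Int.cast_one, neg_mul,
          one_mul, Prod.map_apply, id]
        rw [← neg_one_mul, ← proj_mul, ← proj_add]
        congr 1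
        funext Ms
        rw [Finset.mul_sum, ← Finset.sum_add_distrib]
        refine Finset.sum_congr rfl fun M _ => ?_
        rw [← mul_assoc, ← add_mul]
        congr 1
        rw [Finset.mul_sum, ← Finset.sum_add_distrib]
        refine Finset.sum_congr rfl fun m _ => ?_
        rw [Finset.mul_sum, ← Finset.sum_add_distrib]
        exact Finset.sum_congr rfl fun n _ => by ring
    · simp [proj]

/-- Correctness of `metricRule`. -/
theorem evalP_metricRule (C : Ctx D) {γf : ℕ → ℕ → Fac} {γ : Fin D → Fin D → ℝ} {a k i j : ℕ}
    {i₀ : Fin D} (ha : a < k)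
    (hγ : ∀ p q (x : ℕ → Fin D), x a = i₀ → val C x (γf p q) = 1 / 2 * γ (x p) (x q))
    (hi : i < k) (hj : j < k) (x : ℕ → Fin D) (hx : x a = i₀) :
    evalP C (metricRule γf k i j) x =
      -∑ m, ∑ n, gUp C.E (x i) m * (1 / 2 * (γ m n + γ n m)) * gUp C.E n (x j) := by
  have hx' : ∀ m n, Function.update (Function.update x k m) (k + 1) n a = i₀ := fun m n => by
    rw [Function.update_of_ne (by omega), Function.update_of_ne (by omega), hx]
  have h1 : ∀ m n, Function.update (Function.update x k m) (k + 1) n k = m := fun m n => by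
    rw [Function.update_of_ne (by omega), Function.update_self]
  have h2 : ∀ {s}, s < k → ∀ m n, Function.update (Function.update x k m) (k + 1) n s = x s :=
    fun {s} hs m n => by
      rw [Function.update_of_ne (by omega), Function.update_of_ne (by omega)]
  simp only [metricRule, evalP_cons, evalP_nil, evalM, List.map_cons, List.map_nil,
    List.prod_cons, List.prod_nil, mul_one, hγ _ _ _ (hx' _ _), h1, Function.update_self, add_zero]
  simp only [val, h1, h2 hi, h2 hj, Function.update_self]
  rw [← mul_add, ← Finset.sum_add_distrib, Int.cast_neg, Int.cast_one, neg_one_mul]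
  congr 1
  refine Finset.sum_congr rfl fun m _ => ?_
  rw [← Finset.sum_add_distrib]
  exact Finset.sum_congr rfl fun n _ => by ring

theorem corr_bound {γf : ℕ → ℕ → Fac} {k : ℕ} {c : Option (ℕ × ℕ)} {pre l : List (Bool × ℕ)} :
    ∀ t ∈ corr γf k c pre l, ∀ b ∈ t.2.1, k ≤ b := by
  induction l generalizing pre with
  | nil => simp [corr]
  | cons s l ih =>
    intro t ht b hb
    simp only [corr, List.mem_cons] at ht
    rcases ht with rfl | rfl | ht
    · simp only [List.mem_cons, List.not_mem_nil, or_false] at hb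
      omega
    · simp only [List.mem_cons, List.not_mem_nil, or_false] at hb
      omega
    · exact ih t ht b hb

theorem metricRule_bound {γf : ℕ → ℕ → Fac} {k i j : ℕ} :
    ∀ t ∈ metricRule γf k i j, ∀ b ∈ t.2.1, k ≤ b := by
  intro t ht b hb
  simp only [metricRule, List.mem_cons, List.not_mem_nil, or_false] at ht
  rcases ht with rfl | rfl <;> simp only [List.mem_cons, List.not_mem_nil, or_false] at hb <;> omega

section

variable {P : Type*} [NormedAddCommGroup P] [NormedSpace ℝ P] {p u : P} {C : P → Ctx D}
  {γ : Fin D → Fin D → ℝ} {γf : ℕ → ℕ → Fac} {a : ℕ} {i₀ : Fin D} {δ : ℕ → Fac → Poly}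

theorem derRule_metric (hE : ∀ i j, HasDir (fun y => (C y).E i j) p u (γ i j))
    (hdet : (gLow (C p).E).det ≠ 0)
    (hγ : ∀ p' q' (x : ℕ → Fin D), x a = i₀ → val (C p) x (γf p' q') = 1 / 2 * γ (x p') (x q'))
    {i j : ℕ} (hδ : ∀ k, δ k (.g i j) = metricRule γf k i j) :
    DerRule C p u a i₀ δ (.g i j) where
  hasDir k hk ha x hx := by
    rw [hδ, evalP_metricRule (C p) ha hγ (hk i (by simp [Fac.vars])) (hk j (by simp [Fac.vars]))
      x hx]
    exact hasDir_gUp hE hdet _ _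
  le_bound k := by rw [hδ]; exact metricRule_bound

theorem derRule_jet (hE : ∀ i j, HasDir (fun y => (C y).E i j) p u (γ i j))
    (hdet : (gLow (C p).E).det ≠ 0)
    (hγ : ∀ p' q' (x : ℕ → Fin D), x a = i₀ → val (C p) x (γf p' q') = 1 / 2 * γ (x p') (x q'))
    {c : Option (ℕ × ℕ)} {l : List (Bool × ℕ)} {J' : Option (Fin D × Fin D) → List (DIdx D) → ℝ}
    (hJ : ∀ c' Ms, Ms.length = l.length → HasDir (fun y => (C y).J c' Ms) p u (J' c' Ms)) {e : Poly}
    (hδ : ∀ k, δ k (.T c l) = e ++ corr γf k c [] l)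
    (he : ∀ x : ℕ → Fin D, x a = i₀ →
      evalP (C p) e x = proj (C p).E (l.map (Prod.map id x)) (J' (c.map (Prod.map x x))))
    (hb : ∀ t ∈ e, t.2.1 = []) :
    DerRule C p u a i₀ δ (.T c l) where
  hasDir k hk ha x hx := by
    rw [hδ, evalP_append, he x hx, evalP_corr (C p) hdet ha hγ c [] l hk x hx]
    exact hasDir_proj hE _ fun Ms h => hJ _ Ms (by simpa using h)
  le_bound k t ht b hbt := by
    rw [hδ] at ht
    rcases List.mem_append.1 ht with ht | ht
    · rw [hb t ht] at hbt; simp at hbt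
    · exact corr_bound t ht b hbt

theorem derRule_const (f : Fac) (h : ∀ x, HasDir (fun y => val (C y) x f) p u 0)
    (hδ : ∀ k, δ k f = []) : DerRule C p u a i₀ δ f where
  hasDir k _ _ x _ := by simpa [hδ] using h x
  le_bound k := by simp [hδ]

end

/-! ### Iterated partial derivatives -/

/-- Iterated partial derivatives. -/
def pdl : List (DIdx D) → (DSpace D → ℝ) → DSpace D → ℝ
  | [], A => A
  | M :: Ms, A => pd M (pdl Ms A)

theorem pdl_append (Ms Ns : List (DIdx D)) (A : DSpace D → ℝ) :
    pdl (Ms ++ Ns) A = pdl Ms (pdl Ns A) := by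
  induction Ms with
  | nil => rfl
  | cons M Ms ih => simp only [List.cons_append, pdl, ih]

theorem fderiv_eq_sum_pd (F : DSpace D → ℝ) (X u : DSpace D) :
    fderiv ℝ F X u = ∑ M, u M * pd M F X := by
  conv_lhs => rw [pi_eq_sum_univ' u]
  rw [map_sum]
  refine Finset.sum_congr rfl fun M _ => ?_
  rw [map_smul, smul_eq_mul, pd]

section Smooth

variable {U : Set (DSpace D)} {A B : DSpace D → ℝ} {X : DSpace D}

theorem pd_congr (hU : IsOpen U) (h : ∀ Y ∈ U, A Y = B Y) (hX : X ∈ U) (M : DIdx D) :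
    pd M A X = pd M B X := by
  have : A =ᶠ[nhds X] B := Filter.eventuallyEq_of_mem (hU.mem_nhds hX) h
  simp only [pd, this.fderiv_eq]

theorem contDiffOn_pd (hU : IsOpen U) (hA : ContDiffOn ℝ ∞ A U) (M : DIdx D) :
    ContDiffOn ℝ ∞ (pd M A) U :=
  (hA.fderiv_of_isOpen hU (m := ∞) (by simp)).clm_apply contDiffOn_const

theorem contDiffOn_pdl (hU : IsOpen U) (hA : ContDiffOn ℝ ∞ A U) (Ms : List (DIdx D)) :
    ContDiffOn ℝ ∞ (pdl Ms A) U := by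
  induction Ms with
  | nil => exact hA
  | cons M Ms ih => exact contDiffOn_pd hU ih M

theorem differentiableAt_of_contDiffOn (hU : IsOpen U) (hA : ContDiffOn ℝ ∞ A U) (hX : X ∈ U) :
    DifferentiableAt ℝ A X :=
  (hA.contDiffAt (hU.mem_nhds hX)).differentiableAt (by simp)

theorem pd_comm (hU : IsOpen U) (hA : ContDiffOn ℝ ∞ A U) (hX : X ∈ U) (M N : DIdx D) :
    pd M (pd N A) X = pd N (pd M A) X := by
  have hA' := hA.contDiffAt (hU.mem_nhds hX)
  have hd : DifferentiableAt ℝ (fderiv ℝ A) X :=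
    (hA'.fderiv_right (m := 1) (by norm_cast)).differentiableAt (by simp)
  have h : ∀ M N : DIdx D, pd M (pd N A) X =
      fderiv ℝ (fderiv ℝ A) X (Pi.single M 1) (Pi.single N 1) := by
    intro M N
    unfold pd
    rw [fderiv_clm_apply hd (differentiableAt_const _)]
    simp
  rw [h, h]
  exact (hA'.isSymmSndFDerivAt (by
    rw [minSmoothness_of_isRCLikeNormedField]
    exact WithTop.coe_le_coe.2 (le_top : (2 : ℕ∞) ≤ ⊤))).eq _ _

theorem pdl_perm (hU : IsOpen U) (hA : ContDiffOn ℝ ∞ A U) {Ms Ns : List (DIdx D)}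
    (h : Ms.Perm Ns) : ∀ X ∈ U, pdl Ms A X = pdl Ns A X := by
  induction h with
  | nil => exact fun _ _ => rfl
  | cons M _ ih => exact fun X hX => pd_congr hU ih hX M
  | swap M N l => exact fun X hX => pd_comm hU (contDiffOn_pdl hU hA l) hX _ _
  | trans _ _ ih1 ih2 => exact fun X hX => (ih1 X hX).trans (ih2 X hX)

end Smooth

/-! ### The jets of the fields and the strong constraint -/

section Fields

variable (E : DSpace D → Matrix (Fin D) (Fin D) ℝ) (d : DSpace D → ℝ)

/-- The fields `ℰ_{ij}` and `d` as functions on the doubled space. -/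
def source : Option (Fin D × Fin D) → DSpace D → ℝ
  | none => d
  | some (i, j) => fun Y => E Y i j

/-- The normalization of the jets in `Fac.T`. -/
def factor : Option (Fin D × Fin D) → ℝ
  | none => 1
  | some _ => 1 / 2

/-- The context of the fields at the point `Y`. -/
def fieldCtx (Δ : Fin D → Fin D → ℝ) (v : DIdx D → ℝ) (Y : DSpace D) : Ctx D where
  E := E Y
  J c Ms := factor c * pdl Ms (source E d c) Y
  X := Δ
  v := v

/-- The hypotheses on the fields: smoothness, invertibility of `g`, and the strong constraint. -/
structure FieldHyp (U : Set (DSpace D)) : Prop where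
  isOpen : IsOpen U
  smoothE : ∀ i j, ContDiffOn ℝ ∞ (fun X => E X i j) U
  smoothd : ContDiffOn ℝ ∞ d U
  det_ne_zero : ∀ X ∈ U, (gLow (E X)).det ≠ 0
  strong : StrongConstraint U E d

variable {E d} {U : Set (DSpace D)}

theorem FieldHyp.source (hF : FieldHyp E d U) (c : Option (Fin D × Fin D)) :
    ContDiffOn ℝ ∞ (source E d c) U ∧ IsFieldQuantity E d (source E d c) := by
  rcases c with _ | ⟨i, j⟩
  · exact ⟨hF.smoothd, .dilaton⟩
  · exact ⟨hF.smoothE i j, .metric i j⟩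

theorem FieldHyp.smooth (hF : FieldHyp E d U) {A : DSpace D → ℝ}
    (hA : IsFieldQuantity E d A) : ContDiffOn ℝ ∞ A U := by
  induction hA with
  | metric i j => exact hF.smoothE i j
  | dilaton => exact hF.smoothd
  | deriv M A _ ih => exact contDiffOn_pd hF.isOpen ih M

variable {X : DSpace D}

theorem FieldHyp.box_eq (hF : FieldHyp E d U) {A : DSpace D → ℝ}
    (hA : IsFieldQuantity E d A) (hX : X ∈ U) : ∑ k, pd (.inl k) (pd (.inr k) A) X = 0 := by
  have := (hF.strong A A hA hA X hX).1
  simpa [box] using this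

/-- `∂_M A ∂^M B = 0`, as `∂_M ∂^M` annihilates `A`, `B` and `A B`. -/
theorem FieldHyp.null_eq (hF : FieldHyp E d U) {A B : DSpace D → ℝ} (hA : IsFieldQuantity E d A)
    (hB : IsFieldQuantity E d B) (hX : X ∈ U) :
    ∑ k, (pd (.inl k) A X * pd (.inr k) B X + pd (.inr k) A X * pd (.inl k) B X) = 0 := by
  have h := (hF.strong A B hA hB X hX).2
  have hdiff : ∀ {F : DSpace D → ℝ}, IsFieldQuantity E d F → ∀ Y ∈ U, DifferentiableAt ℝ F Y :=
    fun hF' Y hY => differentiableAt_of_contDiffOn hF.isOpen (hF.smooth hF') hY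
  have h1 : ∀ M, ∀ Y ∈ U, pd M (fun Y => A Y * B Y) Y = A Y * pd M B Y + B Y * pd M A Y := by
    intro M Y hY
    simp [pd, fderiv_fun_mul (hdiff hA Y hY) (hdiff hB Y hY)]
  have h2 : ∀ k, pd (.inl k) (pd (.inr k) fun Y => A Y * B Y) X =
      (A X * pd (.inl k) (pd (.inr k) B) X + B X * pd (.inl k) (pd (.inr k) A) X) +
      (pd (.inl k) A X * pd (.inr k) B X + pd (.inr k) A X * pd (.inl k) B X) := by
    intro k
    rw [pd_congr hF.isOpen (h1 _) hX]
    have dir : ∀ {F : DSpace D → ℝ}, IsFieldQuantity E d F →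
        HasDir F X (Pi.single (.inl k) 1) (pd (.inl k) F X) :=
      fun hF' => ⟨hdiff hF' X hX, rfl⟩
    have := ((dir hA).mul (dir (hB.deriv (.inr k)))).add ((dir hB).mul (dir (hA.deriv (.inr k))))
    refine this.2.trans ?_
    ring
  simp only [box, h2, Finset.sum_add_distrib, ← Finset.mul_sum, hF.box_eq hA hX,
    hF.box_eq hB hX] at h
  rw [Finset.sum_add_distrib]
  linarith

/-- The frame vector in the first slot contracted with an iterated derivative of `A` is contracted
with the innermost derivative instead. As all `∂_N A` are field quantities, statements on `proj`
follow by induction on the slots. -/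
theorem proj_cons_pdl (hU : IsOpen U) {A : DSpace D → ℝ} (hA : ContDiffOn ℝ ∞ A U) (hX : X ∈ U)
    (Q : Matrix (Fin D) (Fin D) ℝ) (s : Bool × Fin D) (l : List (Bool × Fin D))
    (Ns : List (DIdx D)) :
    proj Q (s :: l) (fun Ms => pdl (Ns ++ Ms) A X) =
      ∑ N, frame Q s.1 s.2 N * proj Q l fun Ms => pdl (Ns ++ Ms) (pd N A) X := by
  refine Finset.sum_congr rfl fun N _ => ?_
  congr 2
  funext Ms
  change pdl (Ns ++ N :: Ms) A X = pdl (Ns ++ Ms) (pd N A) X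
  have : pdl (Ns ++ Ms) (pd N A) = pdl (Ns ++ Ms ++ [N]) A := by rw [pdl_append _ [N]]; rfl
  rw [this, pdl_perm hU hA (Ns := Ns ++ Ms ++ [N]) _ X hX]
  rw [List.append_assoc]
  exact (List.perm_append_singleton N Ms).symm.append_left Ns

theorem FieldHyp.null_proj (hF : FieldHyp E d U) {A B : DSpace D → ℝ} (hA : IsFieldQuantity E d A)
    (hB : IsFieldQuantity E d B) (hX : X ∈ U) (Q : Matrix (Fin D) (Fin D) ℝ)
    (l l' : List (Bool × Fin D)) :
    ∑ k, (proj Q l (fun Ms => pdl ([.inl k] ++ Ms) A X) *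
        proj Q l' (fun Ms => pdl ([.inr k] ++ Ms) B X) +
      proj Q l (fun Ms => pdl ([.inr k] ++ Ms) A X) *
        proj Q l' (fun Ms => pdl ([.inl k] ++ Ms) B X)) = 0 := by
  induction l generalizing A with
  | nil =>
    induction l' generalizing B with
    | nil => exact hF.null_eq hA hB hX
    | cons s l' ih =>
      simp only [proj_cons_pdl hF.isOpen (hF.smooth hB) hX, Finset.mul_sum,
        ← Finset.sum_add_distrib]
      rw [Finset.sum_comm]
      refine Finset.sum_eq_zero fun N _ => ?_
      rw [← mul_zero (frame Q s.1 s.2 N), ← ih (hB.deriv N), Finset.mul_sum]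
      exact Finset.sum_congr rfl fun k _ => by ring
  | cons s l ih =>
    simp only [proj_cons_pdl hF.isOpen (hF.smooth hA) hX, Finset.sum_mul,
      ← Finset.sum_add_distrib]
    rw [Finset.sum_comm]
    refine Finset.sum_eq_zero fun N _ => ?_
    rw [← mul_zero (frame Q s.1 s.2 N), ← ih (hA.deriv N), Finset.mul_sum]
    exact Finset.sum_congr rfl fun k _ => by ring

theorem FieldHyp.box_proj (hF : FieldHyp E d U) {A : DSpace D → ℝ} (hA : IsFieldQuantity E d A)
    (hX : X ∈ U) (Q : Matrix (Fin D) (Fin D) ℝ) (l : List (Bool × Fin D)) :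
    ∑ k, proj Q l (fun Ms => pdl ([.inl k, .inr k] ++ Ms) A X) = 0 := by
  induction l generalizing A with
  | nil => exact hF.box_eq hA hX
  | cons s l ih =>
    simp only [proj_cons_pdl hF.isOpen (hF.smooth hA) hX]
    rw [Finset.sum_comm]
    refine Finset.sum_eq_zero fun N _ => ?_
    rw [← Finset.mul_sum, ih (hA.deriv N), mul_zero]

theorem FieldHyp.good (hF : FieldHyp E d U) (Δ : Fin D → Fin D → ℝ) (v : DIdx D → ℝ) (hX : X ∈ U) :
    (fieldCtx E d Δ v X).Good where
  det_ne_zero := hF.det_ne_zero X hX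
  perm c Ms Ns h := by
    simp only [fieldCtx, pdl_perm hF.isOpen (hF.source c).1 h X hX]
  null c c' l l' := by
    simp only [fieldCtx, proj_mul]
    rw [← mul_zero (factor c * factor c'),
      ← hF.null_proj (hF.source c).2 (hF.source c').2 hX (E X) l l', Finset.mul_sum]
    exact Finset.sum_congr rfl fun k _ => by simp only [List.singleton_append]; ring
  box c l := by
    simp only [fieldCtx, proj_mul]
    rw [← Finset.mul_sum]
    have := hF.box_proj (hF.source c).2 hX (E X) l
    simp only [List.cons_append, List.nil_append] at this
    rw [this, mul_zero]

theorem FieldHyp.hasDir_jet (hF : FieldHyp E d U) (hX : X ∈ U) (u : DSpace D)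
    (c : Option (Fin D × Fin D)) (Ms : List (DIdx D)) :
    HasDir (fun Y => factor c * pdl Ms (DFT.source E d c) Y) X u
      (∑ N, u N * (factor c * pdl (N :: Ms) (DFT.source E d c) X)) := by
  have hd := differentiableAt_of_contDiffOn hF.isOpen
    (contDiffOn_pdl hF.isOpen (hF.source c).1 Ms) hX
  refine (HasDir.const_mul (factor c) ⟨hd, fderiv_eq_sum_pd _ X u⟩).congr_val ?_
  rw [Finset.mul_sum]
  exact Finset.sum_congr rfl fun N _ => by simp only [pdl]; ring

/-- The factor is the parameter `Y`. -/
def Fac.isY : Fac → Bool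
  | .Y _ _ => true
  | _ => false

theorem FieldHyp.hasDir_E (hF : FieldHyp E d U) (hX : X ∈ U) (u : DSpace D) (i j : Fin D) :
    HasDir (fun Y => E Y i j) X u (∑ N, u N * pd N (fun Y => E Y i j) X) :=
  ⟨differentiableAt_of_contDiffOn hF.isOpen (hF.smoothE i j) hX, fderiv_eq_sum_pd _ X u⟩

/-- Frame derivatives of all factors without the parameter `Y` are computed by `fieldRule`. -/
theorem FieldHyp.derRule (hF : FieldHyp E d U) (Δ : Fin D → Fin D → ℝ) (v : DIdx D → ℝ)
    (hX : X ∈ U) (b : Bool) (a : ℕ) (i₀ : Fin D) {f : Fac} (hf : f.isY = false) :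
    DerRule (fieldCtx E d Δ v) X (frame (E X) b i₀) a i₀ (fieldRule b a) f := by
  have hγ : ∀ p q (x : ℕ → Fin D), x a = i₀ →
      val (fieldCtx E d Δ v X) x (.T (some (p, q)) [(b, a)]) =
        1 / 2 * (∑ N, frame (E X) b i₀ N * pd N (fun Y => E Y (x p) (x q)) X) := by
    intro p q x hx
    simp only [val, proj, List.map_cons, List.map_nil, Prod.map_apply, id, hx, Option.map_some,
      fieldCtx, factor, DFT.source, pdl]
    rw [Finset.mul_sum]
    exact Finset.sum_congr rfl fun N _ => by ring
  cases f with
  | g i j =>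
    exact derRule_metric (C := fieldCtx E d Δ v) (fun i j => hF.hasDir_E hX _ i j)
      (hF.det_ne_zero X hX) hγ fun k => rfl
  | T c l =>
    refine derRule_jet (C := fieldCtx E d Δ v) (fun i j => hF.hasDir_E hX _ i j)
      (hF.det_ne_zero X hX) hγ (fun c' Ms _ => hF.hasDir_jet hX _ c' Ms)
      (e := [(1, ([], [.T c ((b, a) :: l)]))]) (fun k => rfl) (fun x hx => ?_) (by simp)
    simp only [evalP_cons, evalP_nil, evalM, List.map_cons, List.map_nil, List.prod_cons,
      List.prod_nil, mul_one, add_zero, Int.cast_one, one_mul, val, proj, Prod.map_apply, id, hx,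
      proj_sum, proj_mul]
    simp only [fieldCtx, proj_mul]
  | X i j => exact derRule_const _ (fun x => HasDir.const _ _ _) fun k => rfl
  | Y b i => simp [Fac.isY] at hf

end Fields

/-! ### Explicit expressions for the field equations -/

/-- `½ 𝒟_a ℰ_{ij}`, or `½ 𝒟̄_a ℰ_{ij}` for `b = true`. -/
abbrev dE (b : Bool) (a i j : ℕ) : Fac := .T (some (i, j)) [(b, a)]

/-- `𝒟_a d`, or `𝒟̄_a d` for `b = true`. -/
abbrev dd (b : Bool) (a : ℕ) : Fac := .T none [(b, a)]

/-- `e^{2d} L`. -/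
def lagrangianPoly : Poly :=
  [(-1, ([0, 1, 2, 3, 4, 5], [.g 0 2, .g 1 3, .g 4 5, dE false 5 2 3, dE false 4 0 1])),
   (1, ([0, 1, 2, 3, 4, 5], [.g 2 3, .g 1 4, dE false 4 0 2, .g 0 5, dE false 5 1 3])),
   (1, ([0, 1, 2, 3, 4, 5], [.g 2 3, .g 1 4, dE true 4 2 0, .g 0 5, dE true 5 3 1])),
   (2, ([0, 1, 2, 3], [.g 0 2, dd false 2, .g 1 3, dE true 3 0 1])),
   (2, ([0, 1, 2, 3], [.g 0 2, dd true 2, .g 1 3, dE false 3 1 0])),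
   (4, ([0, 1], [.g 0 1, dd false 1, dd false 0]))]

/-- The divergence `∂_M e_a^M` of the frame vectors. Its dummy indices do not clash with those of
the expressions that it multiplies. -/
def divFrame (b : Bool) (a : ℕ) : Poly :=
  if b then [(1, ([90, 91], [.g 90 91, dE true 91 90 a])),
      (-1, ([90, 91], [.g 90 91, dE false 91 90 a]))]
  else [(-1, ([90, 91], [.g 90 91, dE true 91 a 90])),
      (1, ([90, 91], [.g 90 91, dE false 91 a 90]))]

/-- `e^{2d} ∂_M (e^{-2d} e_a^M W^a)`, for a vector `W^a` with the index named `100` (barred for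
`b = true`). -/
def divPoly (b : Bool) (W : Poly) : Poly :=
  Poly.bind 100 (derP (fieldRule b 100) 100 W ++ W.mul (divFrame b 100) ++
    W.mul [(-2, ([], [dd b 100]))])

/-- The vectors `W^a`, `W̄^a` with `∂L/∂(∂_M d) = e^{-2d} (e_a^M W^a + ē_a^M W̄^a)`. -/
def dilatonCurrent : Bool → Poly
  | false => [(2, ([0,1,2], [.g 100 0, .g 1 2, dE true 1 0 2])), (8, ([0], [.g 100 0, dd false 0]))]
  | true => [(2, ([0,1,2], [.g 100 0, .g 1 2, dE false 1 2 0]))]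

/-- The vectors `W^a`, `W̄^a` with `2 X_{ij} ∂L/∂(∂_M ℰ_{ij}) = e^{-2d} (e_a^M W^a + ē_a^M W̄^a)`.
-/
def metricCurrent : Bool → Poly
  | false => [(-2, ([0,1,2,3,4], [.g 100 0, .g 1 2, .g 3 4, dE false 0 1 3, .X 2 4])),
      (2, ([0,1,2,3,4], [.g 100 0, .g 1 2, .g 3 4, dE false 1 0 3, .X 2 4])),
      (2, ([0,1,2], [.g 100 0, .g 1 2, dd true 1, .X 0 2]))]
  | true => [(2, ([0,1,2,3,4], [.g 100 0, .g 1 2, .g 3 4, dE true 1 3 0, .X 4 2])),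
      (2, ([0,1,2], [.g 100 0, .g 1 2, dd false 1, .X 2 0]))]

/-- `v_M (e_a^M W^a + ē_a^M W̄^a)` for a pair of vectors `W^a`, `W̄^a`. -/
def pairing (W : Bool → Poly) : Poly :=
  Poly.bind 100 ((W false).mul [(1, ([], [.Y false 100]))]) ++
  Poly.bind 100 ((W true).mul [(1, ([], [.Y true 100]))])

/-- Half the second jet of `ℰ_{ij}`, contracted with two frame vectors. -/
abbrev ddE (b : Bool) (a : ℕ) (b' : Bool) (a' i j : ℕ) : Fac := .T (some (i, j)) [(b, a), (b', a')]

/-- The second jet of `d`, contracted with two frame vectors. -/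
abbrev ddd (b : Bool) (a : ℕ) (b' : Bool) (a' : ℕ) : Fac := .T none [(b, a), (b', a')]

/-- The explicit form of `𝓡`. -/
def scalarPoly : Poly :=
  [(2, ([0, 1, 2, 3], [.g 0 1, .g 2 3, ddE false 1 true 3 0 2])),
   (4, ([0, 1], [.g 0 1, ddd false 0 false 1])),
   (-1, ([0, 1, 2, 3, 4, 5], [.g 0 1, .g 2 3, .g 4 5, dE false 1 0 2, dE false 5 4 3])),
   (-1, ([0, 1, 2, 3, 4, 5], [.g 0 1, .g 2 3, .g 4 5, dE false 4 0 2, dE false 5 1 3])),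
   (-1, ([0, 1, 2, 3, 4, 5], [.g 0 1, .g 2 3, .g 4 5, dE true 3 0 2, dE true 5 1 4])),
   (-2, ([0, 1, 2, 3, 4, 5], [.g 0 1, .g 2 3, .g 4 5, dE false 1 0 2, dE true 5 3 4])),
   (-2, ([0, 1, 2, 3, 4, 5], [.g 0 1, .g 2 3, .g 4 5, dE false 4 0 2, dE true 3 5 1])),
   (-4, ([0, 1, 2, 3], [.g 0 1, .g 2 3, dd false 0, dE true 3 1 2])),
   (-4, ([0, 1, 2, 3], [.g 0 1, .g 2 3, dd true 0, dE false 3 2 1])),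
   (-4, ([0, 1], [.g 0 1, dd false 0, dd false 1]))]

/-- The explicit form of `𝒦_{pq}`. -/
def ricciPoly (p q : ℕ) : Poly :=
  [(-1, ([0, 1], [.g 0 1, ddE false 1 false p 0 q])),
   (-1, ([0, 1], [.g 0 1, ddE true 1 true q p 0])),
   (1, ([0, 1], [.g 0 1, ddE false 0 false 1 p q])),
   (-2, ([], [ddd false p true q])),
   (-1, ([0, 1, 2, 3], [.g 0 1, .g 2 3, dE false 0 p q, dE true 3 1 2])),
   (-1, ([0, 1, 2, 3], [.g 0 1, .g 2 3, dE false 1 0 2, dE true 3 p q])),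
   (-1, ([0, 1, 2, 3], [.g 0 1, .g 2 3, dE false 2 p 0, dE true q 3 1])),
   (-1, ([0, 1, 2, 3], [.g 0 1, .g 2 3, dE false p 0 2, dE true 3 1 q])),
   (-2, ([0, 1, 2, 3], [.g 0 1, .g 2 3, dE false 2 0 q, dE false 3 p 1])),
   (1, ([0, 1, 2, 3], [.g 0 1, .g 2 3, dE false 1 0 2, dE false p 3 q])),
   (1, ([0, 1, 2, 3], [.g 0 1, .g 2 3, dE false 1 0 2, dE true q p 3])),
   (1, ([0, 1, 2, 3], [.g 0 1, .g 2 3, dE false 2 0 q, dE false p 3 1])),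
   (1, ([0, 1, 2, 3], [.g 0 1, .g 2 3, dE false p 0 2, dE true q 1 3])),
   (1, ([0, 1, 2, 3], [.g 0 1, .g 2 3, dE false p 0 q, dE true 3 1 2])),
   (1, ([0, 1, 2, 3], [.g 0 1, .g 2 3, dE true 3 0 2, dE true q p 1])),
   (1, ([0, 1, 2, 3], [.g 0 1, .g 2 3, dE true q 0 2, dE true 3 p 1])),
   (2, ([0, 1, 2, 3], [.g 0 1, .g 2 3, dE false 2 p 0, dE true 1 3 q])),
   (-2, ([0, 1], [.g 0 1, dd false 0, dE false 1 p q])),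
   (2, ([0, 1], [.g 0 1, dd false 0, dE false p 1 q])),
   (2, ([0, 1], [.g 0 1, dd true 0, dE true q p 1]))]

/-- `Γ_{ij}^k`, or `Γ_{i j̄}^{k̄}` for `b = true`. -/
def connPoly (b : Bool) (k i j : ℕ) : Poly :=
  if b then [(1, ([80], [.g k 80, dE false i 80 j])), (1, ([80], [.g k 80, dE true j i 80])),
      (-1, ([80], [.g k 80, dE true 80 i j]))]
  else [(1, ([80], [.g k 80, dE false i j 80]))]

/-- `Γ_{ī j}^k`, or `Γ_{ī j̄}^{k̄}` for `b = true`. -/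
def connBarPoly (b : Bool) (k i j : ℕ) : Poly :=
  if b then [(1, ([80], [.g k 80, dE true i 80 j]))]
  else [(1, ([80], [.g k 80, dE true i j 80])), (1, ([80], [.g k 80, dE false j 80 i])),
      (-1, ([80], [.g k 80, dE false 80 j i]))]

/-- The negative of an expression. -/
def neg (e : Poly) : Poly := e.scale (-1)

/-- `∇_s 𝒦_{pq}`, or `∇̄_s 𝒦_{pq}` for `b = true`; the indices `p`, `q`, `s` are named `100`,
`101`, `102`. -/
def nablaPoly (b : Bool) : Poly :=
  derP (fieldRule b 102) 102 (ricciPoly 100 101) ++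
  neg (Poly.bind 103 (((if b then connBarPoly else connPoly) false 103 102 100).mul
    (ricciPoly 103 101))) ++
  neg (Poly.bind 103 (((if b then connBarPoly else connPoly) true 103 102 101).mul
    (ricciPoly 100 103)))

/-- `½ (𝒟̄^r ℰ_{sr} + 4 𝒟_s d)`, or `½ (𝒟^r ℰ_{rs} + 4 𝒟̄_s d)` for `b = true`; the index `s` is
named `102`. -/
def tracePoly (b : Bool) : Poly :=
  if b then [(1, ([80, 81], [.g 80 81, dE false 81 80 102])), (2, ([], [dd true 102]))]
  else [(1, ([80, 81], [.g 80 81, dE true 81 102 80])), (2, ([], [dd false 102]))]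

/-- Twice the left-hand side of the first Bianchi identity, or of the second one for `b = true`.
The free index `q` or `p` is named `101` or `100`. -/
def bianchiPoly (b : Bool) : Poly :=
  Poly.bind (if b then 101 else 100) (Poly.bind 102
    ((nablaPoly b ++ neg ((ricciPoly 100 101).mul (tracePoly b))).mul
      [(2, ([], [.g (if b then 101 else 100) 102]))])) ++
  derP (fieldRule (!b) (if b then 100 else 101)) (if b then 100 else 101) scalarPoly

/-- `2 X_{ij} e^{2d} δS/δℰ_{ij}`. -/
def metricVariation : Poly :=
  derP shiftRule 99 lagrangianPoly ++ neg (divPoly false (metricCurrent false)) ++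
    neg (divPoly true (metricCurrent true))

/-- `-e^{2d} δS/δd`. -/
def dilatonVariation : Poly :=
  lagrangianPoly.scale 2 ++ divPoly false (dilatonCurrent false) ++
    divPoly true (dilatonCurrent true)

/-- `2 X_{ij} 𝒦^{ij}`, with `𝒦` in its explicit form. -/
def ricciPairing : Poly :=
  Poly.bind 100 (Poly.bind 101 ((ricciPoly 100 101).mul
    [(2, ([70, 71], [.X 70 71, .g 70 100, .g 71 101]))]))

/-! ### Tensor identities verified by normalization -/

theorem isZero_dilatonCurrent :
    isZero (derP dilRule 99 lagrangianPoly ++ neg (pairing dilatonCurrent)) = true := by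
  decide +kernel

theorem isZero_metricCurrent :
    isZero (derP gradRule 99 lagrangianPoly ++ neg (pairing metricCurrent)) = true := by
  decide +kernel

/-- The explicit form of `𝓡` agrees with the one from the Euler-Lagrange derivative. -/
theorem isZero_dilatonVariation :
    isZero (dilatonVariation ++ scalarPoly.scale (-2)) = true := by
  decide +kernel

/-- The explicit form of `𝒦` agrees with the one from the Euler-Lagrange derivative. -/
theorem isZero_metricVariation : isZero (metricVariation ++ neg ricciPairing) = true := by
  decide +kernel

theorem isZero_bianchi : ∀ b, isZero (bianchiPoly b) = true
  | false => by decide +kernel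
  | true => by decide +kernel

/-! ### General facts on evaluation -/

theorem evalP_neg (C : Ctx D) (e : Poly) (x : ℕ → Fin D) : evalP C (neg e) x = -evalP C e x := by
  simp [neg, evalP_scale]

theorem evalP_congr_ctx {C C' : Ctx D} {e : Poly}
    (h : ∀ t ∈ e, ∀ f ∈ t.2.2, ∀ x, val C x f = val C' x f) (x : ℕ → Fin D) :
    evalP C e x = evalP C' e x := by
  have hM : ∀ (fs : List Fac), (∀ f ∈ fs, ∀ x, val C x f = val C' x f) → ∀ (bs : List ℕ) x,
      evalM C bs fs x = evalM C' bs fs x := by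
    intro fs hfs bs
    induction bs with
    | nil => exact fun x => congrArg List.prod (List.map_congr_left fun f hf => hfs f hf x)
    | cons b bs ih => exact fun x => Finset.sum_congr rfl fun i _ => ih _
  refine congrArg List.sum (List.map_congr_left fun t ht => ?_)
  rw [hM _ (h t ht)]

/-! ### The Lagrangian as a tensor expression -/

/-- `C` holds the first derivatives `dE`, `dd` of the fields. The value of `ℰ` is `C.E`, and the
Lagrangian does not involve other jets. -/
structure Ctx.Records (C : Ctx D) (dE : DIdx D → Matrix (Fin D) (Fin D) ℝ)
    (dd : DIdx D → ℝ) : Prop where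
  metric : ∀ i j N, C.J (some (i, j)) [N] = 1 / 2 * dE N i j
  dilaton : ∀ N, C.J none [N] = dd N

theorem sum_frame_false (E : Matrix (Fin D) (Fin D) ℝ) (w : DIdx D → ℝ) (i : Fin D) :
    ∑ M, frame E false i M * w M = cD E w i := by
  simp [frame, cD, Fintype.sum_sum_type, sub_eq_add_neg]

theorem sum_frame_true (E : Matrix (Fin D) (Fin D) ℝ) (w : DIdx D → ℝ) (i : Fin D) :
    ∑ M, frame E true i M * w M = cDbar E w i := by
  simp [frame, cDbar, Fintype.sum_sum_type]

/-- `½ 𝒟_a ℰ_{ij}`, or `½ 𝒟̄_a ℰ_{ij}` for `b = true`. -/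
abbrev Ctx.dE (C : Ctx D) (b : Bool) (a i j : Fin D) : ℝ := proj C.E [(b, a)] (C.J (some (i, j)))

/-- `𝒟_a d`, or `𝒟̄_a d` for `b = true`. -/
abbrev Ctx.dd (C : Ctx D) (b : Bool) (a : Fin D) : ℝ := proj C.E [(b, a)] (C.J none)

/-- The dummy indices of `lagrangianPoly` written as bound variables of sums. -/
theorem evalP_lagrangianPoly (C : Ctx D) (x : ℕ → Fin D) :
    evalP C lagrangianPoly x =
      -(∑ i, ∑ j, ∑ k, ∑ l, ∑ p, ∑ q, gUp C.E i k * gUp C.E j l * gUp C.E p q *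
        C.dE false q k l * C.dE false p i j) +
      (∑ i, ∑ j, ∑ k, ∑ l, ∑ p, ∑ q, gUp C.E k l * gUp C.E j p *
        C.dE false p i k * gUp C.E i q * C.dE false q j l) +
      (∑ i, ∑ j, ∑ k, ∑ l, ∑ p, ∑ q, gUp C.E k l * gUp C.E j p *
        C.dE true p k i * gUp C.E i q * C.dE true q l j) +
      2 * (∑ i, ∑ j, ∑ k, ∑ l, gUp C.E i k * C.dd false k * gUp C.E j l * C.dE true l i j) +
      2 * (∑ i, ∑ j, ∑ k, ∑ l, gUp C.E i k * C.dd true k * gUp C.E j l * C.dE false l j i) +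
      4 * (∑ i, ∑ j, gUp C.E i j * C.dd false j * C.dd false i) := by
  simp only [mul_assoc]
  simp only [lagrangianPoly, evalP_cons, evalP_nil, evalM, List.map_cons, List.map_nil,
    List.prod_cons, List.prod_nil, mul_one]
  push_cast
  simp only [neg_one_mul, one_mul, add_zero, ← add_assoc]
  rfl

namespace Ctx.Records

variable {C : Ctx D} {dE : DIdx D → Matrix (Fin D) (Fin D) ℝ} {dd : DIdx D → ℝ}

theorem cD_dE (h : C.Records dE dd) (a i j : Fin D) :
    cD C.E (fun M => dE M i j) a = 2 * C.dE false a i j := by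
  rw [← sum_frame_false]
  simp only [Ctx.dE, proj, h.metric, Finset.mul_sum]
  exact Finset.sum_congr rfl fun N _ => by ring

theorem cDbar_dE (h : C.Records dE dd) (a i j : Fin D) :
    cDbar C.E (fun M => dE M i j) a = 2 * C.dE true a i j := by
  rw [← sum_frame_true]
  simp only [Ctx.dE, proj, h.metric, Finset.mul_sum]
  exact Finset.sum_congr rfl fun N _ => by ring

theorem cD_dd (h : C.Records dE dd) (a : Fin D) : cD C.E dd a = C.dd false a := by
  simp only [← sum_frame_false, Ctx.dd, proj, h.dilaton]

theorem cDbar_dd (h : C.Records dE dd) (a : Fin D) : cDbar C.E dd a = C.dd true a := by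
  simp only [← sum_frame_true, Ctx.dd, proj, h.dilaton]

theorem lagrangian_eq (h : C.Records dE dd) (d : ℝ) (x : ℕ → Fin D) :
    lagrangian C.E d dE dd = Real.exp (-2 * d) * evalP C lagrangianPoly x := by
  rw [lagrangian, evalP_lagrangianPoly]
  congr 1
  simp only [cDUp, cDbarUp, h.cD_dE, h.cDbar_dE, h.cD_dd, h.cDbar_dd]
  have h1 : ∀ i j k l : Fin D, (∑ p, gUp C.E i k * gUp C.E j l *
      (∑ q, gUp C.E p q * (2 * C.dE false q k l)) * (2 * C.dE false p i j)) =
      4 * ∑ p, ∑ q, gUp C.E i k * gUp C.E j l * gUp C.E p q * C.dE false q k l *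
        C.dE false p i j := by
    intro i j k l
    simp only [Finset.mul_sum, Finset.sum_mul]
    exact Finset.sum_congr rfl fun p _ => Finset.sum_congr rfl fun q _ => by ring
  have h2 : ∀ i j k l : Fin D, ∀ f f' : Fin D → ℝ, (gUp C.E k l *
      ((∑ p, gUp C.E j p * (2 * f p)) * ∑ q, gUp C.E i q * (2 * f' q))) =
      4 * ∑ p, ∑ q, gUp C.E k l * gUp C.E j p * f p * gUp C.E i q * f' q := by
    intro i j k l f f'
    rw [Finset.sum_mul_sum]
    simp only [Finset.mul_sum]
    exact Finset.sum_congr rfl fun p _ => Finset.sum_congr rfl fun q _ => by ring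
  have h3 : ∀ i j : Fin D, ∀ f f' : Fin D → ℝ,
      (∑ k, gUp C.E i k * f k) * ∑ l, gUp C.E j l * (2 * f' l) =
      2 * ∑ k, ∑ l, gUp C.E i k * f k * gUp C.E j l * f' l := by
    intro i j f f'
    rw [Finset.sum_mul_sum]
    simp only [Finset.mul_sum]
    exact Finset.sum_congr rfl fun p _ => Finset.sum_congr rfl fun q _ => by ring
  have h4 : ∀ i : Fin D, (∑ j, gUp C.E i j * C.dd false j) * C.dd false i =
      ∑ j, gUp C.E i j * C.dd false j * C.dd false i := fun i => Finset.sum_mul ..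
  -- `h3` would also rewrite inside `h2`, so it is applied afterwards
  simp only [h1, mul_add, h2]
  simp only [h3, h4, Finset.sum_add_distrib, ← Finset.mul_sum]
  ring

end Ctx.Records

/-! ### Variations of the Lagrangian -/

theorem HasDir.deriv {F : ℝ → ℝ} {c t : ℝ} (h : HasDir F t 1 c) : deriv F t = c := by
  rw [← h.2, fderiv_apply_one_eq_deriv]

theorem HasDir.id (t : ℝ) : HasDir (fun s : ℝ => s) t 1 1 := ⟨differentiableAt_id, by simp⟩

/-- The path `t ↦ ℰ + 2 t X`, with all jets kept fixed. -/
def Ctx.shift (C : Ctx D) (t : ℝ) : Ctx D :=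
  { C with E := C.E + t • Matrix.of fun i j => 2 * C.X i j }

/-- The path `∂_M ℰ_{ij} + 2 t v_M X_{ij}`, with all other jets kept fixed. -/
def Ctx.shiftGrad (C : Ctx D) (t : ℝ) : Ctx D :=
  { C with J := fun c Ms => C.J c Ms + t * (match c, Ms with
      | some (i, j), [N] => C.v N * C.X i j
      | _, _ => 0) }

/-- The path `∂_M d + t v_M`, with all other jets kept fixed. -/
def Ctx.shiftDil (C : Ctx D) (t : ℝ) : Ctx D :=
  { C with J := fun c Ms => C.J c Ms + t * (match c, Ms with
      | none, [N] => C.v N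
      | _, _ => 0) }

theorem Ctx.derRule_shift (C : Ctx D) (hdet : (gLow C.E).det ≠ 0) (a : ℕ) (i₀ : Fin D) {f : Fac}
    (hf : f.isY = false) : DerRule C.shift 0 1 a i₀ shiftRule f := by
  have h0 : (C.shift 0).E = C.E := by simp [Ctx.shift]
  have hE : ∀ i j, HasDir (fun t => (C.shift t).E i j) 0 1 (2 * C.X i j) := by
    intro i j
    have := (HasDir.const (C.E i j) (0 : ℝ) 1).add ((HasDir.id 0).mul
      (HasDir.const (2 * C.X i j) (0 : ℝ) 1))
    simpa [Ctx.shift] using this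
  have hγ : ∀ p q (x : ℕ → Fin D), x a = i₀ →
      val (C.shift 0) x (.X p q) = 1 / 2 * (2 * C.X (x p) (x q)) := fun p q x _ => by
    simp [val, Ctx.shift]
  cases f with
  | g i j => exact derRule_metric hE (by rwa [h0]) hγ fun k => rfl
  | T c l =>
    exact derRule_jet hE (by rwa [h0]) hγ (J' := fun _ _ => 0) (e := [])
      (fun c Ms _ => HasDir.const _ _ _) (fun k => rfl)
      (fun x _ => by simp [proj_zero]) (by simp)
  | X i j => exact derRule_const _ (fun x => HasDir.const _ _ _) fun k => rfl
  | Y b i => simp [Fac.isY] at hf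

theorem hasDir_proj_line (E : Matrix (Fin D) (Fin D) ℝ) (l : List (Bool × Fin D))
    (J J' : List (DIdx D) → ℝ) :
    HasDir (fun t : ℝ => proj E l fun Ms => J Ms + t * J' Ms) 0 1 (proj E l J') := by
  simp only [proj_add, proj_mul]
  simpa using (HasDir.const (proj E l J) (0 : ℝ) 1).add ((HasDir.id 0).mul
    (HasDir.const (proj E l J') (0 : ℝ) 1))

theorem proj_eq_zero {E : Matrix (Fin D) (Fin D) ℝ} {l : List (Bool × Fin D)}
    {J : List (DIdx D) → ℝ} (h : ∀ Ms, Ms.length = l.length → J Ms = 0) : proj E l J = 0 := by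
  induction l generalizing J with
  | nil => exact h [] rfl
  | cons s l ih =>
    exact Finset.sum_eq_zero fun M _ => by rw [ih fun Ms hM => h _ (by simp [hM]), mul_zero]

theorem Ctx.derRule_shiftGrad (C : Ctx D) (a : ℕ) (i₀ : Fin D) (f : Fac) :
    DerRule C.shiftGrad 0 1 a i₀ gradRule f where
  hasDir k _ _ x _ := by
    cases f with
    | T c l =>
      refine (hasDir_proj_line _ _ _ _).congr_val ?_
      rcases c with _ | ⟨i, j⟩
      · simpa [gradRule] using proj_zero _ _
      · rcases l with _ | ⟨⟨b, s⟩, _ | ⟨s', l⟩⟩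
        · simp [gradRule, proj]
        · simp only [gradRule, proj, evalP_cons, evalP_nil, evalM, val, List.map_cons, List.map_nil,
            List.prod_cons, List.prod_nil, Option.map_some, Prod.map_apply, id]
          simp only [Finset.sum_mul, mul_assoc, shiftGrad, Int.cast_one, one_mul, mul_one, add_zero]
        · refine proj_eq_zero fun Ms hM => ?_
          rcases Ms with _ | ⟨M, _ | ⟨N, Ms⟩⟩ <;> simp at hM ⊢
    | g i j => exact HasDir.const (val C x (.g i j)) 0 1
    | X i j => exact HasDir.const (val C x (.X i j)) 0 1
    | Y b i => exact HasDir.const (val C x (.Y b i)) 0 1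
  le_bound k t ht b hb := by
    unfold gradRule at ht
    split at ht
    · simp only [List.mem_singleton] at ht
      simp [ht] at hb
    · simp at ht

theorem Ctx.derRule_shiftDil (C : Ctx D) (a : ℕ) (i₀ : Fin D) (f : Fac) :
    DerRule C.shiftDil 0 1 a i₀ dilRule f where
  hasDir k _ _ x _ := by
    cases f with
    | T c l =>
      refine (hasDir_proj_line _ _ _ _).congr_val ?_
      rcases c with _ | ⟨i, j⟩
      · rcases l with _ | ⟨⟨b, s⟩, _ | ⟨s', l⟩⟩
        · simp [dilRule, proj]
        · simp [dilRule, proj, evalM, val, shiftDil]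
        · refine proj_eq_zero fun Ms hM => ?_
          rcases Ms with _ | ⟨M, _ | ⟨N, Ms⟩⟩ <;> simp at hM ⊢
      · simpa [dilRule] using proj_zero _ _
    | g i j => exact HasDir.const (val C x (.g i j)) 0 1
    | X i j => exact HasDir.const (val C x (.X i j)) 0 1
    | Y b i => exact HasDir.const (val C x (.Y b i)) 0 1
  le_bound k t ht b hb := by
    unfold dilRule at ht
    split at ht
    · simp only [List.mem_singleton] at ht
      simp [ht] at hb
    · simp at ht

theorem Ctx.shift_zero (C : Ctx D) : C.shift 0 = C := by simp [Ctx.shift]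
theorem Ctx.shiftGrad_zero (C : Ctx D) : C.shiftGrad 0 = C := by simp [Ctx.shiftGrad]
theorem Ctx.shiftDil_zero (C : Ctx D) : C.shiftDil 0 = C := by simp [Ctx.shiftDil]

/-- The name `99` is free for the index `a` of `derP`, which plays no role in a fixed direction.
-/
theorem lagrangianPoly_fresh : ∀ t ∈ lagrangianPoly, 99 ∉ t.2.1 := by decide

theorem lagrangianPoly_isY : ∀ t ∈ lagrangianPoly, ∀ f ∈ t.2.2, f.isY = false := by decide

section

variable {C : Ctx D} {dE : DIdx D → Matrix (Fin D) (Fin D) ℝ} {dd : DIdx D → ℝ}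

theorem deriv_lagrangian_dilaton (h : C.Records dE dd) (d : ℝ) (x : ℕ → Fin D) :
    deriv (fun t : ℝ => lagrangian C.E (d + t) dE dd) 0 =
      Real.exp (-2 * d) * (-2 * evalP C lagrangianPoly x) := by
  simp only [fun t => h.lagrangian_eq (d + t) x]
  have := (((hasDerivAt_id (0 : ℝ)).const_add d).const_mul (-2)).exp.mul_const
    (evalP C lagrangianPoly x)
  refine this.deriv.trans ?_
  simp
  ring

theorem deriv_lagrangian_metric (h : C.Records dE dd) (hdet : (gLow C.E).det ≠ 0) (d : ℝ)
    (x : ℕ → Fin D) :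
    deriv (fun t : ℝ => lagrangian (C.E + t • Matrix.of fun i j => 2 * C.X i j) d dE dd) 0 =
      Real.exp (-2 * d) * evalP C (derP shiftRule 99 lagrangianPoly) x := by
  have hrec : ∀ t, (C.shift t).Records dE dd := fun t => ⟨h.metric, h.dilaton⟩
  have := (derP_hasDir (C := C.shift) (fun t ht f hf =>
    C.derRule_shift hdet 99 (x 99) (lagrangianPoly_isY t ht f hf))
    lagrangianPoly_fresh x rfl).const_mul (Real.exp (-2 * d))
  rw [C.shift_zero] at this
  simp only [← (hrec _).lagrangian_eq d x] at this
  exact this.deriv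

theorem deriv_lagrangian_gradE (h : C.Records dE dd) (hC : C.Good) (d : ℝ) (x : ℕ → Fin D) :
    deriv (fun t : ℝ => lagrangian C.E d
      (dE + t • fun N => C.v N • Matrix.of fun i j => 2 * C.X i j) dd) 0 =
      Real.exp (-2 * d) * evalP C (pairing metricCurrent) x := by
  have hrec : ∀ t, (C.shiftGrad t).Records
      (dE + t • fun N => C.v N • Matrix.of fun i j => 2 * C.X i j) dd := fun t =>
    ⟨fun i j N => by simp [Ctx.shiftGrad, h.metric]; ring,
      fun N => by simp [Ctx.shiftGrad, h.dilaton]⟩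
  have := (derP_hasDir (C := C.shiftGrad) (fun _ _ f _ => C.derRule_shiftGrad 99 (x 99) f)
    lagrangianPoly_fresh x rfl).const_mul (Real.exp (-2 * d))
  rw [C.shiftGrad_zero] at this
  simp only [← (hrec _).lagrangian_eq d x] at this
  have h0 := evalP_eq_zero hC isZero_metricCurrent x
  rw [evalP_append, evalP_neg, add_neg_eq_zero] at h0
  rw [← h0]
  exact this.deriv

theorem deriv_lagrangian_gradd (h : C.Records dE dd) (hC : C.Good) (d : ℝ) (x : ℕ → Fin D) :
    deriv (fun t : ℝ => lagrangian C.E d dE (dd + t • C.v)) 0 =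
      Real.exp (-2 * d) * evalP C (pairing dilatonCurrent) x := by
  have hrec : ∀ t, (C.shiftDil t).Records dE (dd + t • C.v) := fun t =>
    ⟨fun i j N => by simp [Ctx.shiftDil, h.metric],
      fun N => by simp [Ctx.shiftDil, h.dilaton]⟩
  have := (derP_hasDir (C := C.shiftDil) (fun _ _ f _ => C.derRule_shiftDil 99 (x 99) f)
    lagrangianPoly_fresh x rfl).const_mul (Real.exp (-2 * d))
  rw [C.shiftDil_zero] at this
  simp only [← (hrec _).lagrangian_eq d x] at this
  have h0 := evalP_eq_zero hC isZero_dilatonCurrent x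
  rw [evalP_append, evalP_neg, add_neg_eq_zero] at h0
  rw [← h0]
  exact this.deriv

end

/-! ### Divergences -/

/-- Side conditions on the vector `W^a`, with `a` named `100`: `Y` does not occur, and no dummy
indices clash in the products below. -/
def IsCurrent (b : Bool) (W : Poly) : Prop :=
  (∀ t ∈ W, ∀ f ∈ t.2.2, f.isY = false) ∧ (∀ t ∈ W, 100 ∉ t.2.1) ∧
    W.Compat [(1, ([], [.Y b 100]))] ∧ W.Compat (divFrame b 100) ∧
    W.Compat [(-2, ([], [dd b 100]))]

instance (b : Bool) (W : Poly) : Decidable (IsCurrent b W) := by unfold IsCurrent; infer_instance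

theorem isCurrent_dilatonCurrent : ∀ b, IsCurrent b (dilatonCurrent b) := by decide

theorem isCurrent_metricCurrent : ∀ b, IsCurrent b (metricCurrent b) := by decide

/-- The component `e_a^M W^a` (or `ē_a^M W^a`) of a vector field. -/
def flux (C : Ctx D) (b : Bool) (W : Poly) (x : ℕ → Fin D) (M : DIdx D) : ℝ :=
  ∑ i, evalP C W (Function.update x 100 i) * frame C.E b i M

theorem evalP_bind_Y (C : Ctx D) {b : Bool} {W : Poly} (h : IsCurrent b W) (x : ℕ → Fin D) :
    evalP C (Poly.bind 100 (W.mul [(1, ([], [.Y b 100]))])) x = ∑ M, C.v M * flux C b W x M := by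
  rw [evalP_bind]
  simp only [evalP_mul C _ _ h.2.2.1, evalP_cons, evalP_nil, evalM, List.map_cons, List.map_nil,
    List.prod_cons, List.prod_nil, val, Function.update_self, flux, Finset.mul_sum,
    Int.cast_one, one_mul, mul_one, add_zero]
  rw [Finset.sum_comm]
  exact Finset.sum_congr rfl fun M _ => Finset.sum_congr rfl fun i _ => by ring

theorem evalP_pairing (C : Ctx D) {W : Bool → Poly} (h : ∀ b, IsCurrent b (W b))
    (x : ℕ → Fin D) :
    evalP C (pairing W) x =
      ∑ M, C.v M * (flux C false (W false) x M + flux C true (W true) x M) := by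
  rw [pairing, evalP_append, evalP_bind_Y C (h false), evalP_bind_Y C (h true),
    ← Finset.sum_add_distrib]
  exact Finset.sum_congr rfl fun M _ => by ring

/-- `g^{mn} (𝒟̄_n - 𝒟_n) = 2 ∂̃^m`, applied to a family of gradients and traced. -/
theorem sum_sub_frame {E : Matrix (Fin D) (Fin D) ℝ} (hdet : (gLow E).det ≠ 0)
    (w : Fin D → DIdx D → ℝ) :
    ∑ m, ∑ n, gUp E m n * (∑ M, frame E true n M * w m M - ∑ M, frame E false n M * w m M) =
      2 * ∑ m, w m (.inr m) := by
  have h1 : ∀ m n, ∑ M, frame E true n M * w m M - ∑ M, frame E false n M * w m M =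
      ∑ k, 2 * (gLow E n k * w m (.inr k)) := by
    intro m n
    rw [sum_frame_true, sum_frame_false, cD, cDbar, add_sub_sub_cancel, ← Finset.sum_add_distrib]
    refine Finset.sum_congr rfl fun k _ => ?_
    simp [gLow]
    ring
  rw [Finset.mul_sum]
  refine Finset.sum_congr rfl fun m _ => ?_
  simp only [h1, Finset.mul_sum]
  rw [Finset.sum_comm]
  have h2 : ∀ k, ∑ n, gUp E m n * gLow E n k = if m = k then 1 else 0 := fun k => by
    rw [← Matrix.mul_apply, gUp_mul_gLow hdet, Matrix.one_apply]
  calc ∑ k, ∑ n, gUp E m n * (2 * (gLow E n k * w m (.inr k)))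
      = ∑ k, 2 * w m (.inr k) * ∑ n, gUp E m n * gLow E n k := by
        refine Finset.sum_congr rfl fun k _ => ?_
        rw [Finset.mul_sum]
        exact Finset.sum_congr rfl fun n _ => by ring
    _ = 2 * w m (.inr m) := by simp [h2]

section Fields

variable {E : DSpace D → Matrix (Fin D) (Fin D) ℝ} {d : DSpace D → ℝ} {U : Set (DSpace D)}
  {X : DSpace D}

theorem fieldCtx_records (E : DSpace D → Matrix (Fin D) (Fin D) ℝ) (d : DSpace D → ℝ)
    (Δ : Fin D → Fin D → ℝ) (v : DIdx D → ℝ) (X : DSpace D) :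
    (fieldCtx E d Δ v X).Records (gradE E X) (grad d X) :=
  ⟨fun i j N => by simp [fieldCtx, factor, source, pdl, gradE],
    fun N => by simp [fieldCtx, factor, source, pdl, grad]⟩

theorem val_fieldCtx_dE (Δ : Fin D → Fin D → ℝ) (v : DIdx D → ℝ) (x : ℕ → Fin D) (b : Bool)
    (a i j : ℕ) : val (fieldCtx E d Δ v X) x (dE b a i j) =
      1 / 2 * ∑ M, frame (E X) b (x a) M * pd M (fun Y => E Y (x i) (x j)) X := by
  simp only [val, proj, List.map_cons, List.map_nil, Prod.map_apply, id, Option.map_some,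
    fieldCtx, factor, source, pdl, Finset.mul_sum]
  exact Finset.sum_congr rfl fun M _ => by ring

theorem val_fieldCtx_dd (Δ : Fin D → Fin D → ℝ) (v : DIdx D → ℝ) (x : ℕ → Fin D) (b : Bool)
    (a : ℕ) : val (fieldCtx E d Δ v X) x (dd b a) = ∑ M, frame (E X) b (x a) M * pd M d X := by
  simp only [val, proj, List.map_cons, List.map_nil, Prod.map_apply, id, Option.map_none,
    fieldCtx, factor, source, pdl, one_mul]

/-- The divergence of the frame vectors is computed by `divFrame`. -/
theorem sum_frameDot (hdet : (gLow (E X)).det ≠ 0) (Δ : Fin D → Fin D → ℝ)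
    (v : DIdx D → ℝ) (b : Bool) (i : Fin D) (x : ℕ → Fin D) :
    ∑ M, frameDot (fun j k => pd M (fun Y => E Y j k) X) b i M =
      evalP (fieldCtx E d Δ v X) (divFrame b 100) (Function.update x 100 i) := by
  have key := fun f : Fin D → Fin D × Fin D => sum_sub_frame hdet
    fun m M => pd M (fun Y => E Y (f m).1 (f m).2) X
  have hl : ∑ M, frameDot (fun j k => pd M (fun Y => E Y j k) X) b i M =
      ∑ m, if b then pd (.inr m) (fun Y => E Y m i) X else -pd (.inr m) (fun Y => E Y i m) X := by
    simp [frameDot, Fintype.sum_sum_type]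
  have hr : ∀ (m n : Fin D),
      Function.update (Function.update (Function.update x 100 i) 90 m) 91 n 90 = m ∧
      Function.update (Function.update (Function.update x 100 i) 90 m) 91 n 91 = n ∧
      Function.update (Function.update (Function.update x 100 i) 90 m) 91 n 100 = i :=
    fun m n => ⟨rfl, rfl, rfl⟩
  have hg : ∀ (y : ℕ → Fin D) p q,
    val (fieldCtx E d Δ v X) y (.g p q) = gUp (E X) (y p) (y q) := fun _ _ _ => rfl
  rw [hl]
  cases b
  · have := key fun m => (i, m)
    simp only [divFrame, Bool.false_eq_true, if_false, evalP_cons, evalP_nil, evalM, List.map_cons,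
      List.map_nil, List.prod_cons, List.prod_nil, mul_one, val_fieldCtx_dE, hr, hg]
    simp only [mul_sub, Finset.sum_sub_distrib, mul_left_comm _ (1 / 2 : ℝ), ← Finset.mul_sum,
      Finset.sum_neg_distrib] at this ⊢
    push_cast
    linarith
  · have := key fun m => (m, i)
    simp only [divFrame, if_true, evalP_cons, evalP_nil, evalM, List.map_cons,
      List.map_nil, List.prod_cons, List.prod_nil, mul_one, val_fieldCtx_dE, hr, hg]
    simp only [mul_sub, Finset.sum_sub_distrib, mul_left_comm _ (1 / 2 : ℝ), ← Finset.mul_sum]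
      at this ⊢
    push_cast
    linarith

theorem FieldHyp.hasDir_current (hF : FieldHyp E d U) (hX : X ∈ U) (Δ : Fin D → Fin D → ℝ)
    (v : DIdx D → ℝ) {b : Bool} {W : Poly} (hW : IsCurrent b W) (x : ℕ → Fin D) (i : Fin D) :
    HasDir (fun Y => evalP (fieldCtx E d Δ v Y) W (Function.update x 100 i)) X (frame (E X) b i)
      (evalP (fieldCtx E d Δ v X) (derP (fieldRule b 100) 100 W) (Function.update x 100 i)) :=
  derP_hasDir (fun t ht f hf => hF.derRule Δ v hX b 100 i (hW.1 t ht f hf)) hW.2.1 _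
    (Function.update_self ..)

/-- The divergence of the vector field `e^{-2d} e_a^M W^a` is computed by `divPoly`. -/
theorem FieldHyp.divergence (hF : FieldHyp E d U) (hX : X ∈ U) (Δ : Fin D → Fin D → ℝ)
    (v : DIdx D → ℝ) {b : Bool} {W : Poly} (hW : IsCurrent b W) (x : ℕ → Fin D) :
    ∃ c : DIdx D → ℝ, (∀ M, HasDir
      (fun Y => Real.exp (-2 * d Y) * flux (fieldCtx E d Δ v Y) b W x M) X (Pi.single M 1) (c M)) ∧
      ∑ M, c M = Real.exp (-2 * d X) * evalP (fieldCtx E d Δ v X) (divPoly b W) x := by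
  set H : Fin D → DSpace D → ℝ := fun i Y =>
    evalP (fieldCtx E d Δ v Y) W (Function.update x 100 i) with hH
  have hcur := fun i => hF.hasDir_current hX Δ v hW x i
  have hd := differentiableAt_of_contDiffOn hF.isOpen hF.smoothd hX
  have hexp : ∀ M, HasDir (fun Y => Real.exp (-2 * d Y)) X (Pi.single M 1)
      (Real.exp (-2 * d X) * (-2 * pd M d X)) := fun M =>
    ⟨(hd.const_mul _).exp, by rw [fderiv_exp (hd.const_mul _), fderiv_const_mul hd]; simp [pd]⟩
  -- the direction `u` in `hasDir_E` is irrelevant here: only differentiability is used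
  have hflux : ∀ M, HasDir (fun Y => flux (fieldCtx E d Δ v Y) b W x M) X (Pi.single M 1)
      (∑ i, (pd M (H i) X * frame (E X) b i M +
        H i X * frameDot (fun j k => pd M (fun Y => E Y j k) X) b i M)) := fun M =>
    HasDir.sum fun i _ => HasDir.mul (F := H i) ⟨(hcur i).1, rfl⟩
      (hasDir_frame (fun j k => ⟨(hF.hasDir_E hX 0 j k).1, rfl⟩) b i M)
  refine ⟨_, fun M => (hexp M).mul (hflux M), ?_⟩
  have h1 : ∀ i, evalP (fieldCtx E d Δ v X) (derP (fieldRule b 100) 100 W)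
      (Function.update x 100 i) = ∑ M, frame (E X) b i M * pd M (H i) X := fun i => by
    rw [← (hcur i).2, fderiv_eq_sum_pd]
  rw [divPoly, evalP_bind]
  simp only [evalP_append, evalP_mul _ _ _ hW.2.2.2.1, evalP_mul _ _ _ hW.2.2.2.2, h1,
    ← sum_frameDot (hF.det_ne_zero X hX)]
  simp only [evalP_cons, evalP_nil, evalM, List.map_cons, List.map_nil, List.prod_cons,
    List.prod_nil, mul_one, add_zero, val_fieldCtx_dd, Function.update_self, Int.cast_neg,
    Int.cast_ofNat]
  have h2 : ∀ M, Real.exp (-2 * d X) * (-2 * pd M d X) * flux (fieldCtx E d Δ v X) b W x M +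
      Real.exp (-2 * d X) * ∑ i, (pd M (H i) X * frame (E X) b i M +
        H i X * frameDot (fun j k => pd M (fun Y => E Y j k) X) b i M) =
      Real.exp (-2 * d X) * ∑ i, (frame (E X) b i M * pd M (H i) X +
        H i X * frameDot (fun j k => pd M (fun Y => E Y j k) X) b i M +
        H i X * (-2 * (frame (E X) b i M * pd M d X))) := fun M => by
    rw [mul_assoc, ← mul_add, flux, Finset.mul_sum, ← Finset.sum_add_distrib]
    congr 1
    exact Finset.sum_congr rfl fun i _ => by simp only [hH, fieldCtx]; ring
  simp only [h2]
  rw [← Finset.mul_sum, Finset.sum_comm]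
  simp only [Finset.sum_add_distrib, ← Finset.mul_sum]
  rfl

end Fields

/-! ### The field equations -/

section Fields

variable {E : DSpace D → Matrix (Fin D) (Fin D) ℝ} {d : DSpace D → ℝ} {U : Set (DSpace D)}
  {X : DSpace D}

theorem flux_fieldCtx (Δ : Fin D → Fin D → ℝ) (v v' : DIdx D → ℝ) (X : DSpace D) {b : Bool}
    {W : Poly} (hW : IsCurrent b W) (x : ℕ → Fin D) (M : DIdx D) :
    flux (fieldCtx E d Δ v X) b W x M = flux (fieldCtx E d Δ v' X) b W x M := by
  refine Finset.sum_congr rfl fun i _ => ?_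
  rw [evalP_congr_ctx (C' := fieldCtx E d Δ v' X) fun t ht f hf x => ?_]
  · rfl
  · have := hW.1 t ht f hf
    cases f with
    | Y b i => simp [Fac.isY] at this
    | _ => rfl

/-- The divergence of `F^M = e^{-2d} (e_a^M W^a + ē_a^M W̄^a)`. The component `F^M` is given as
the pairing with the basis covector `v = Pi.single M 1`. -/
theorem FieldHyp.sum_pd_pairing (hF : FieldHyp E d U) (hX : X ∈ U) (Δ : Fin D → Fin D → ℝ)
    {W : Bool → Poly} (hW : ∀ b, IsCurrent b (W b)) (x : ℕ → Fin D)
    {F : DIdx D → DSpace D → ℝ} (hP : ∀ M, ∀ Y ∈ U, F M Y = Real.exp (-2 * d Y) *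
      evalP (fieldCtx E d Δ (Pi.single M 1) Y) (pairing W) x) :
    ∑ M, pd M (F M) X = Real.exp (-2 * d X) *
      (evalP (fieldCtx E d Δ 0 X) (divPoly false (W false)) x +
        evalP (fieldCtx E d Δ 0 X) (divPoly true (W true)) x) := by
  obtain ⟨c, hc, hcs⟩ := hF.divergence hX Δ 0 (hW false) x
  obtain ⟨c', hc', hcs'⟩ := hF.divergence hX Δ 0 (hW true) x
  rw [mul_add, ← hcs, ← hcs', ← Finset.sum_add_distrib]
  refine Finset.sum_congr rfl fun M _ => ?_
  rw [← ((hc M).add (hc' M)).2]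
  refine pd_congr hF.isOpen (fun Y hY => ?_) hX M
  rw [hP M Y hY, evalP_pairing _ hW, Finset.sum_eq_single M]
  · rw [flux_fieldCtx Δ _ 0 Y (hW false), flux_fieldCtx Δ _ 0 Y (hW true)]
    simp [fieldCtx, mul_add]
  · intro N _ hN
    simp [fieldCtx, Pi.single_eq_of_ne hN]
  · simp

theorem FieldHyp.varD_eq (hF : FieldHyp E d U) (hX : X ∈ U) (x : ℕ → Fin D) :
    varD E d X = -Real.exp (-2 * d X) * evalP (fieldCtx E d 0 0 X) dilatonVariation x := by
  have h2 := hF.sum_pd_pairing hX 0 isCurrent_dilatonCurrent x fun M Y hY =>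
    deriv_lagrangian_gradd (fieldCtx_records E d 0 (Pi.single M 1) Y) (hF.good _ _ hY) (d Y) x
  have h1 := deriv_lagrangian_dilaton (fieldCtx_records E d 0 0 X) (d X) x
  refine (congrArg₂ _ h1 h2).trans ?_
  simp only [dilatonVariation, evalP_append, evalP_scale]
  push_cast
  ring

theorem FieldHyp.Rscal_eq (hF : FieldHyp E d U) (hX : X ∈ U) (x : ℕ → Fin D) :
    Rscal E d X = evalP (fieldCtx E d 0 0 X) scalarPoly x := by
  have h := evalP_eq_zero (hF.good 0 0 hX) isZero_dilatonVariation x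
  rw [evalP_append, evalP_scale] at h
  have he : Real.exp (2 * d X) * Real.exp (-2 * d X) = 1 := by rw [← Real.exp_add]; simp
  rw [Rscal, hF.varD_eq hX x]
  push_cast at h
  linear_combination (1 / 2 * evalP (fieldCtx E d 0 0 X) dilatonVariation x) * he + 1 / 2 * h

theorem FieldHyp.varE_eq (hF : FieldHyp E d U) (hX : X ∈ U) (p q : Fin D) (x : ℕ → Fin D) :
    varE E d p q X = Real.exp (-2 * d X) *
      evalP (fieldCtx E d (fun i j => 1 / 2 * Matrix.single p q 1 i j) 0 X) metricVariation x := by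
  set Δ : Fin D → Fin D → ℝ := fun i j => 1 / 2 * Matrix.single p q 1 i j with hΔ
  have hs : (Matrix.of fun i j => 2 * Δ i j) = Matrix.single p q 1 := by
    ext i j; simp [hΔ]
  -- the variation of `∂_M ℰ_{pq}` alone, in the form `2 v_N X_{ij}` with `v` a basis covector
  have hs' : ∀ M : DIdx D, (fun N => (Pi.single M 1 : DIdx D → ℝ) N •
      (Matrix.of fun i j => 2 * Δ i j)) = Pi.single M (Matrix.single p q 1) := by
    intro M
    funext N
    rw [hs]
    by_cases h : N = M
    · subst h; simp
    · simp [Pi.single_eq_of_ne h]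
  have h1 : deriv (fun t : ℝ => lagrangian (E X + t • Matrix.single p q 1) (d X) (gradE E X)
      (grad d X)) 0 = Real.exp (-2 * d X) *
        evalP (fieldCtx E d Δ 0 X) (derP shiftRule 99 lagrangianPoly) x := by
    rw [← hs]
    exact deriv_lagrangian_metric (fieldCtx_records E d Δ 0 X) (hF.det_ne_zero X hX) (d X) x
  have h2 := hF.sum_pd_pairing hX Δ isCurrent_metricCurrent x
    (F := fun M Y => deriv (fun t : ℝ => lagrangian (E Y) (d Y) (gradE E Y + t •
      (Pi.single M (Matrix.single p q 1) : DIdx D → Matrix (Fin D) (Fin D) ℝ)) (grad d Y)) 0)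
    fun M Y hY => by
      rw [← hs']
      exact deriv_lagrangian_gradE (fieldCtx_records E d Δ (Pi.single M 1) Y) (hF.good _ _ hY)
        (d Y) x
  rw [varE, h1, h2]
  simp only [metricVariation, evalP_append, evalP_neg]
  ring

/-- The factor is one of the parameters `X`, `Y`. -/
def Fac.isParam : Fac → Bool
  | .X _ _ => true
  | .Y _ _ => true
  | _ => false

theorem evalP_fieldCtx_congr (Δ Δ' : Fin D → Fin D → ℝ) (v v' : DIdx D → ℝ) (X : DSpace D)
    {e : Poly} (h : ∀ t ∈ e, ∀ f ∈ t.2.2, f.isParam = false) (x : ℕ → Fin D) :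
    evalP (fieldCtx E d Δ v X) e x = evalP (fieldCtx E d Δ' v' X) e x := by
  refine evalP_congr_ctx (fun t ht f hf x => ?_) x
  have := h t ht f hf
  cases f with
  | X i j => simp [Fac.isParam] at this
  | Y b i => simp [Fac.isParam] at this
  | _ => rfl

theorem ricciPoly_isParam : ∀ t ∈ ricciPoly 100 101, ∀ f ∈ t.2.2, f.isParam = false := by decide

theorem FieldHyp.KUp_eq (hF : FieldHyp E d U) (hX : X ∈ U) (p q : Fin D) (x : ℕ → Fin D) :
    KUp E d p q X = ∑ i, ∑ j, gUp (E X) p i * gUp (E X) q j *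
      evalP (fieldCtx E d 0 0 X) (ricciPoly 100 101)
        (Function.update (Function.update x 100 i) 101 j) := by
  have h := evalP_eq_zero (hF.good (fun i j => 1 / 2 * Matrix.single p q 1 i j) 0 hX)
    isZero_metricVariation x
  rw [evalP_append, evalP_neg, add_neg_eq_zero] at h
  have he : Real.exp (2 * d X) * Real.exp (-2 * d X) = 1 := by rw [← Real.exp_add]; simp
  rw [KUp, hF.varE_eq hX p q x, ← mul_assoc, he, one_mul, h, ricciPairing, evalP_bind]
  refine Finset.sum_congr rfl fun i _ => ?_
  rw [evalP_bind]
  refine Finset.sum_congr rfl fun j _ => ?_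
  rw [evalP_mul _ _ _ (by decide), mul_comm,
    evalP_fieldCtx_congr _ 0 _ 0 X ricciPoly_isParam]
  congr 1
  have hr : ∀ k l : Fin D, ∀ y : ℕ → Fin D,
      y = Function.update (Function.update (Function.update (Function.update x 100 i) 101 j)
        70 k) 71 l → y 70 = k ∧ y 71 = l ∧ y 100 = i ∧ y 101 = j := by
    rintro k l _ rfl
    exact ⟨rfl, rfl, rfl, rfl⟩
  simp only [evalP_cons, evalP_nil, evalM, List.map_cons, List.map_nil, List.prod_cons,
    List.prod_nil, mul_one, val, hr _ _ _ rfl, fieldCtx]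
  rw [Finset.sum_eq_single p, Finset.sum_eq_single q]
  · simp
  · intro l _ hl
    simp [hl.symm]
  · simp
  · intro k _ hk
    simp [hk.symm]
  · simp

/-- `ricciPoly` is `𝒦_{pq}`. Its free indices `p`, `q` are named `100`, `101`. -/
theorem FieldHyp.K_eq (hF : FieldHyp E d U) (hX : X ∈ U) (x : ℕ → Fin D) :
    K E d (x 100) (x 101) X = evalP (fieldCtx E d 0 0 X) (ricciPoly 100 101) x := by
  -- lowering an index undoes raising it; this is used for both indices
  have hc : ∀ (f : Fin D → ℝ) (p : Fin D),
      ∑ k, gLow (E X) p k * ∑ i, gUp (E X) k i * f i = f p := fun f p => by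
    have : (gLow (E X)).mulVec ((gUp (E X)).mulVec f) = f := by
      rw [Matrix.mulVec_mulVec, gLow_mul_gUp (hF.det_ne_zero X hX), Matrix.one_mulVec]
    exact congrFun this p
  have h1 : ∀ (R : Fin D → Fin D → ℝ) (p q : Fin D),
      ∑ k, ∑ l, gLow (E X) p k * gLow (E X) q l *
        ∑ i, ∑ j, gUp (E X) k i * gUp (E X) l j * R i j = R p q := by
    intro R p q
    rw [← hc (fun i => R i q) p]
    refine Finset.sum_congr rfl fun k _ => ?_
    simp only [← hc _ q, mul_assoc, ← Finset.mul_sum]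
    congr 1
    simp only [Finset.mul_sum]
    rw [Finset.sum_comm]
    exact Finset.sum_congr rfl fun i _ => Finset.sum_congr rfl fun l _ =>
      Finset.sum_congr rfl fun j _ => by ring
  simp only [K, hF.KUp_eq hX _ _ x, h1]
  congr 1
  funext n
  by_cases h101 : n = 101
  · simp [h101]
  · by_cases h100 : n = 100 <;> simp [h100, h101]

end Fields

/-! ### The Bianchi identities -/

section Fields

variable {E : DSpace D → Matrix (Fin D) (Fin D) ℝ} {d : DSpace D → ℝ} {U : Set (DSpace D)}
  {X : DSpace D}

/-- Frame derivatives of a function that is given by an expression throughout `U`. -/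
theorem FieldHyp.evalP_derP (hF : FieldHyp E d U) (hX : X ∈ U) {e : Poly}
    (he : ∀ t ∈ e, ∀ f ∈ t.2.2, f.isParam = false) {a : ℕ} (ha : ∀ t ∈ e, a ∉ t.2.1)
    (x : ℕ → Fin D) {F : DSpace D → ℝ} (hFe : ∀ Y ∈ U, F Y = evalP (fieldCtx E d 0 0 Y) e x)
    (b : Bool) : evalP (fieldCtx E d 0 0 X) (derP (fieldRule b a) a e) x =
      if b then Dbar E (x a) F X else Dop E (x a) F X := by
  have h : HasDir (fun Y => evalP (fieldCtx E d 0 0 Y) e x) X (frame (E X) b (x a))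
      (evalP (fieldCtx E d 0 0 X) (derP (fieldRule b a) a e) x) :=
    derP_hasDir (fun t ht f hf => hF.derRule 0 0 hX b a (x a) (by
      have := he t ht f hf
      cases f <;> simp_all [Fac.isParam, Fac.isY])) ha x rfl
  rw [← h.2, fderiv_eq_sum_pd]
  simp only [← fun M => pd_congr hF.isOpen hFe hX M]
  cases b
  · exact sum_frame_false ..
  · exact sum_frame_true ..

theorem val_dE_false (x : ℕ → Fin D) (a i j : ℕ) :
    val (fieldCtx E d 0 0 X) x (dE false a i j) = 1 / 2 * DE E (x a) (x i) (x j) X := by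
  rw [val_fieldCtx_dE, sum_frame_false]; rfl

theorem val_dE_true (x : ℕ → Fin D) (a i j : ℕ) :
    val (fieldCtx E d 0 0 X) x (dE true a i j) = 1 / 2 * DbarE E (x a) (x i) (x j) X := by
  rw [val_fieldCtx_dE, sum_frame_true]; rfl

theorem val_dd_false (x : ℕ → Fin D) (a : ℕ) :
    val (fieldCtx E d 0 0 X) x (dd false a) = Dop E (x a) d X := by
  rw [val_fieldCtx_dd, sum_frame_false]; rfl

theorem val_dd_true (x : ℕ → Fin D) (a : ℕ) :
    val (fieldCtx E d 0 0 X) x (dd true a) = Dbar E (x a) d X := by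
  rw [val_fieldCtx_dd, sum_frame_true]; rfl

theorem val_g (x : ℕ → Fin D) (i j : ℕ) :
    val (fieldCtx E d 0 0 X) x (.g i j) = gUp (E X) (x i) (x j) := rfl

theorem update_eighty (x : ℕ → Fin D) (l : Fin D) {i : ℕ} (hi : 80 ≠ i) :
    Function.update x 80 l i = x i := Function.update_of_ne hi.symm ..

theorem evalP_connPoly_false (x : ℕ → Fin D) {k i j : ℕ} (hk : 80 ≠ k) (hi : 80 ≠ i)
    (hj : 80 ≠ j) :
    evalP (fieldCtx E d 0 0 X) (connPoly false k i j) x = Gam E (x k) (x i) (x j) X := by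
  simp only [connPoly, Bool.false_eq_true, if_false, evalP_cons, evalP_nil, evalM, List.map_cons,
    List.map_nil, List.prod_cons, List.prod_nil, val_dE_false, val_g,
    Function.update_self, update_eighty x _ hk, update_eighty x _ hi, update_eighty x _ hj, Gam,
    Finset.mul_sum]
  push_cast
  rw [add_zero]
  exact Finset.sum_congr rfl fun l _ => by ring

theorem evalP_connPoly_true (x : ℕ → Fin D) {k i j : ℕ} (hk : 80 ≠ k) (hi : 80 ≠ i)
    (hj : 80 ≠ j) :
    evalP (fieldCtx E d 0 0 X) (connPoly true k i j) x = GamUB E (x k) (x i) (x j) X := by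
  simp only [connPoly, if_true, evalP_cons, evalP_nil, evalM, List.map_cons,
    List.map_nil, List.prod_cons, List.prod_nil, val_dE_false, val_dE_true, val_g,
    Function.update_self, update_eighty x _ hk, update_eighty x _ hi, update_eighty x _ hj, GamUB,
    Finset.mul_sum]
  push_cast
  simp only [add_zero, ← Finset.sum_add_distrib]
  exact Finset.sum_congr rfl fun l _ => by ring

theorem evalP_connBarPoly_false (x : ℕ → Fin D) {k i j : ℕ} (hk : 80 ≠ k) (hi : 80 ≠ i)
    (hj : 80 ≠ j) :
    evalP (fieldCtx E d 0 0 X) (connBarPoly false k i j) x = GamBU E (x k) (x i) (x j) X := by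
  simp only [connBarPoly, Bool.false_eq_true, if_false, evalP_cons, evalP_nil, evalM,
    List.map_cons, List.map_nil, List.prod_cons, List.prod_nil, val_dE_false, val_dE_true, val_g,
    Function.update_self, update_eighty x _ hk, update_eighty x _ hi, update_eighty x _ hj, GamBU,
    Finset.mul_sum]
  push_cast
  simp only [add_zero, ← Finset.sum_add_distrib]
  exact Finset.sum_congr rfl fun l _ => by ring

theorem evalP_connBarPoly_true (x : ℕ → Fin D) {k i j : ℕ} (hk : 80 ≠ k) (hi : 80 ≠ i)
    (hj : 80 ≠ j) :
    evalP (fieldCtx E d 0 0 X) (connBarPoly true k i j) x = GamBB E (x k) (x i) (x j) X := by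
  simp only [connBarPoly, if_true, evalP_cons, evalP_nil, evalM, List.map_cons,
    List.map_nil, List.prod_cons, List.prod_nil, val_dE_true, val_g,
    Function.update_self, update_eighty x _ hk, update_eighty x _ hi, update_eighty x _ hj, GamBB,
    Finset.mul_sum]
  push_cast
  rw [add_zero]
  exact Finset.sum_congr rfl fun l _ => by ring

theorem evalP_tracePoly_false (x : ℕ → Fin D) :
    evalP (fieldCtx E d 0 0 X) (tracePoly false) x =
      1 / 2 * ((∑ r, ∑ t, gUp (E X) r t * DbarE E t (x 102) r X) + 4 * Dop E (x 102) d X) := by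
  have hr : ∀ k l : Fin D, Function.update (Function.update x 80 k) 81 l 80 = k ∧
      Function.update (Function.update x 80 k) 81 l 102 = x 102 := fun k l => ⟨rfl, rfl⟩
  simp only [tracePoly, Bool.false_eq_true, if_false, evalP_cons, evalP_nil, evalM, List.map_cons,
    List.map_nil, List.prod_cons, List.prod_nil, val_dE_true, val_dd_false, val_g,
    Function.update_self, hr, mul_one, mul_left_comm _ (1 / 2 : ℝ), ← Finset.mul_sum]
  push_cast
  ring

theorem evalP_tracePoly_true (x : ℕ → Fin D) :
    evalP (fieldCtx E d 0 0 X) (tracePoly true) x =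
      1 / 2 * ((∑ r, ∑ t, gUp (E X) r t * DE E t r (x 102) X) + 4 * Dbar E (x 102) d X) := by
  have hr : ∀ k l : Fin D, Function.update (Function.update x 80 k) 81 l 80 = k ∧
      Function.update (Function.update x 80 k) 81 l 102 = x 102 := fun k l => ⟨rfl, rfl⟩
  simp only [tracePoly, if_true, evalP_cons, evalP_nil, evalM, List.map_cons,
    List.map_nil, List.prod_cons, List.prod_nil, val_dE_false, val_dd_true, val_g,
    Function.update_self, hr, mul_one, mul_left_comm _ (1 / 2 : ℝ), ← Finset.mul_sum]
  push_cast
  ring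

theorem FieldHyp.evalP_ricciPoly_left (hF : FieldHyp E d U) (hX : X ∈ U) (x : ℕ → Fin D) :
    evalP (fieldCtx E d 0 0 X) (ricciPoly 103 101) x = K E d (x 103) (x 101) X := by
  rw [show ricciPoly 103 101 = (ricciPoly 100 101).rename (Equiv.swap 100 103) by decide,
    evalP_rename _ (Equiv.injective _), ← hF.K_eq hX]
  rfl

theorem FieldHyp.evalP_ricciPoly_right (hF : FieldHyp E d U) (hX : X ∈ U) (x : ℕ → Fin D) :
    evalP (fieldCtx E d 0 0 X) (ricciPoly 100 103) x = K E d (x 100) (x 103) X := by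
  rw [show ricciPoly 100 103 = (ricciPoly 100 101).rename (Equiv.swap 101 103) by decide,
    evalP_rename _ (Equiv.injective _), ← hF.K_eq hX]
  rfl

theorem FieldHyp.evalP_nablaPoly_false (hF : FieldHyp E d U) (hX : X ∈ U) (x : ℕ → Fin D) :
    evalP (fieldCtx E d 0 0 X) (nablaPoly false) x =
      nabla E (x 102) (K E d) (x 100) (x 101) X := by
  have h0 := hF.evalP_derP hX ricciPoly_isParam (a := 102) (by decide) x
    (fun Y hY => hF.K_eq hY x) false
  have hr : ∀ k : Fin D, Function.update x 103 k 102 = x 102 ∧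
      Function.update x 103 k 101 = x 101 ∧ Function.update x 103 k 100 = x 100 :=
    fun k => ⟨rfl, rfl, rfl⟩
  simp only [nablaPoly, Bool.false_eq_true, if_false, evalP_append, evalP_neg, h0]
  rw [evalP_bind, evalP_bind]
  simp only [fun y => evalP_mul (fieldCtx E d 0 0 X) (connPoly false 103 102 100)
      (ricciPoly 103 101) (by decide) y,
    fun y => evalP_mul (fieldCtx E d 0 0 X) (connPoly true 103 102 101)
      (ricciPoly 100 103) (by decide) y]
  simp only [fun y : ℕ → Fin D => evalP_connPoly_false (E := E) (d := d) (X := X) y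
      (k := 103) (i := 102) (j := 100) (by decide) (by decide) (by decide),
    fun y : ℕ → Fin D => evalP_connPoly_true (E := E) (d := d) (X := X) y
      (k := 103) (i := 102) (j := 101) (by decide) (by decide) (by decide),
    hF.evalP_ricciPoly_left hX, hF.evalP_ricciPoly_right hX, hr, Function.update_self]
  rfl

theorem FieldHyp.evalP_nablaPoly_true (hF : FieldHyp E d U) (hX : X ∈ U) (x : ℕ → Fin D) :
    evalP (fieldCtx E d 0 0 X) (nablaPoly true) x =
      nablaBar E (x 102) (K E d) (x 100) (x 101) X := by
  have h0 := hF.evalP_derP hX ricciPoly_isParam (a := 102) (by decide) x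
    (fun Y hY => hF.K_eq hY x) true
  have hr : ∀ k : Fin D, Function.update x 103 k 102 = x 102 ∧
      Function.update x 103 k 101 = x 101 ∧ Function.update x 103 k 100 = x 100 :=
    fun k => ⟨rfl, rfl, rfl⟩
  simp only [nablaPoly, if_true, evalP_append, evalP_neg, h0]
  rw [evalP_bind, evalP_bind]
  simp only [fun y => evalP_mul (fieldCtx E d 0 0 X) (connBarPoly false 103 102 100)
      (ricciPoly 103 101) (by decide) y,
    fun y => evalP_mul (fieldCtx E d 0 0 X) (connBarPoly true 103 102 101)
      (ricciPoly 100 103) (by decide) y]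
  simp only [fun y : ℕ → Fin D => evalP_connBarPoly_false (E := E) (d := d) (X := X) y
      (k := 103) (i := 102) (j := 100) (by decide) (by decide) (by decide),
    fun y : ℕ → Fin D => evalP_connBarPoly_true (E := E) (d := d) (X := X) y
      (k := 103) (i := 102) (j := 101) (by decide) (by decide) (by decide),
    hF.evalP_ricciPoly_left hX, hF.evalP_ricciPoly_right hX, hr, Function.update_self]
  rfl

theorem FieldHyp.bianchi (hF : FieldHyp E d U) (hX : X ∈ U) (q : Fin D) :
    (∑ p, ∑ s, gUp (E X) p s * nabla E s (K E d) p q X)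
      - (1 / 2) * (∑ p, ∑ s, gUp (E X) p s *
          ((∑ r, ∑ t, gUp (E X) r t * DbarE E t s r X) + 4 * Dop E s d X) * K E d p q X)
      + (1 / 2) * Dbar E q (Rscal E d) X = 0 := by
  -- only the value of the index named `101` matters
  have h := evalP_eq_zero (hF.good 0 0 hX) (isZero_bianchi false) fun _ => q
  have hr : ∀ p s : Fin D, ∀ y : ℕ → Fin D,
      y = Function.update (Function.update (fun _ => q) 100 p) 102 s →
      y 100 = p ∧ y 101 = q ∧ y 102 = s := by
    rintro p s _ rfl
    exact ⟨rfl, rfl, rfl⟩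
  have hc : (nablaPoly false ++ neg ((ricciPoly 100 101).mul (tracePoly false))).Compat
      [(2, ([], [.g 100 102]))] := by decide +kernel
  simp only [bianchiPoly, Bool.false_eq_true, if_false, Bool.not_false, evalP_append,
    hF.evalP_derP hX (e := scalarPoly) (a := 101) (by decide) (by decide) _
      (fun Y hY => hF.Rscal_eq hY _), if_true] at h
  rw [evalP_bind] at h
  simp only [evalP_bind, evalP_mul _ _ _ hc] at h
  simp only [evalP_append, evalP_neg, evalP_mul _ (ricciPoly 100 101) (tracePoly false) (by decide),
    hF.evalP_nablaPoly_false hX, ← hF.K_eq hX, evalP_tracePoly_false, evalP_cons, evalP_nil, evalM,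
    List.map_cons, List.map_nil, List.prod_cons, List.prod_nil, val_g, hr _ _ _ rfl] at h
  push_cast at h
  have h2 : 2 * ((∑ p, ∑ s, gUp (E X) p s * nabla E s (K E d) p q X)
      - (1 / 2) * (∑ p, ∑ s, gUp (E X) p s *
          ((∑ r, ∑ t, gUp (E X) r t * DbarE E t s r X) + 4 * Dop E s d X) * K E d p q X)) +
      Dbar E q (Rscal E d) X = 0 := by
    rw [← h]
    congr 1
    rw [Finset.mul_sum, ← Finset.sum_sub_distrib, Finset.mul_sum]
    refine Finset.sum_congr rfl fun p _ => ?_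
    rw [Finset.mul_sum, ← Finset.sum_sub_distrib, Finset.mul_sum]
    exact Finset.sum_congr rfl fun s _ => by ring
  linarith

theorem FieldHyp.bianchi_barred (hF : FieldHyp E d U) (hX : X ∈ U) (p : Fin D) :
    (∑ q, ∑ s, gUp (E X) q s * nablaBar E s (K E d) p q X)
      - (1 / 2) * (∑ q, ∑ s, gUp (E X) q s *
          ((∑ r, ∑ t, gUp (E X) r t * DE E t r s X) + 4 * Dbar E s d X) * K E d p q X)
      + (1 / 2) * Dop E p (Rscal E d) X = 0 := by
  -- only the value of the index named `100` matters
  have h := evalP_eq_zero (hF.good 0 0 hX) (isZero_bianchi true) fun _ => p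
  have hr : ∀ q s : Fin D, ∀ y : ℕ → Fin D,
      y = Function.update (Function.update (fun _ => p) 101 q) 102 s →
      y 100 = p ∧ y 101 = q ∧ y 102 = s := by
    rintro q s _ rfl
    exact ⟨rfl, rfl, rfl⟩
  have hc : (nablaPoly true ++ neg ((ricciPoly 100 101).mul (tracePoly true))).Compat
      [(2, ([], [.g 101 102]))] := by decide +kernel
  simp only [bianchiPoly, if_true, Bool.not_true, evalP_append,
    hF.evalP_derP hX (e := scalarPoly) (a := 100) (by decide) (by decide) _
      (fun Y hY => hF.Rscal_eq hY _), Bool.false_eq_true, if_false] at h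
  rw [evalP_bind] at h
  simp only [evalP_bind, evalP_mul _ _ _ hc] at h
  simp only [evalP_append, evalP_neg, evalP_mul _ (ricciPoly 100 101) (tracePoly true) (by decide),
    hF.evalP_nablaPoly_true hX, ← hF.K_eq hX, evalP_tracePoly_true, evalP_cons, evalP_nil, evalM,
    List.map_cons, List.map_nil, List.prod_cons, List.prod_nil, val_g, hr _ _ _ rfl] at h
  push_cast at h
  have h2 : 2 * ((∑ q, ∑ s, gUp (E X) q s * nablaBar E s (K E d) p q X)
      - (1 / 2) * (∑ q, ∑ s, gUp (E X) q s *
          ((∑ r, ∑ t, gUp (E X) r t * DE E t r s X) + 4 * Dbar E s d X) * K E d p q X)) +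
      Dop E p (Rscal E d) X = 0 := by
    rw [← h]
    congr 1
    rw [Finset.mul_sum, ← Finset.sum_sub_distrib, Finset.mul_sum]
    refine Finset.sum_congr rfl fun q _ => ?_
    rw [Finset.mul_sum, ← Finset.sum_sub_distrib, Finset.mul_sum]
    exact Finset.sum_congr rfl fun s _ => by ring
  linarith

end Fields

end DFT

end

theorem mainTheorem4 (D : ℕ) (U : Set (DFT.DSpace D)) (hU : IsOpen U)
    (E : DFT.DSpace D → Matrix (Fin D) (Fin D) ℝ) (d : DFT.DSpace D → ℝ)
    (hE : ∀ i j, ContDiffOn ℝ ∞ (fun X => E X i j) U)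
    (hd : ContDiffOn ℝ ∞ d U)
    (hg : ∀ X ∈ U, (DFT.gLow (E X)).det ≠ 0)
    (hstrong : DFT.StrongConstraint U E d) :
    ∀ X ∈ U,
      (∀ q : Fin D,
        (∑ p, ∑ s, DFT.gUp (E X) p s * DFT.nabla E s (DFT.K E d) p q X)
          - (1 / 2) * (∑ p, ∑ s, DFT.gUp (E X) p s *
              ((∑ r, ∑ t, DFT.gUp (E X) r t * DFT.DbarE E t s r X) + 4 * DFT.Dop E s d X)
                * DFT.K E d p q X)
          + (1 / 2) * DFT.Dbar E q (DFT.Rscal E d) X = 0) ∧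
      (∀ p : Fin D,
        (∑ q, ∑ s, DFT.gUp (E X) q s * DFT.nablaBar E s (DFT.K E d) p q X)
          - (1 / 2) * (∑ q, ∑ s, DFT.gUp (E X) q s *
              ((∑ r, ∑ t, DFT.gUp (E X) r t * DFT.DE E t r s X) + 4 * DFT.Dbar E s d X)
                * DFT.K E d p q X)
          + (1 / 2) * DFT.Dop E p (DFT.Rscal E d) X = 0) := by
  have hF : DFT.FieldHyp E d U := ⟨hU, hE, hd, hg, hstrong⟩
  exact fun X hX => ⟨hF.bianchi hX, hF.bianchi_barred hX⟩
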